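/- Let $\alpha\in(0,1)$ and $K,K',T,s>0$. Let $N=\sum_i\delta_{(T_i,P_i)}$ be a Poisson point process on $(0,\infty)^2$ with intensity $\mathrm{Leb}\times\mu$, where $\mu(u,\infty)=Ku^{-\alpha}$ for $u>0$. Put $$\tau_t=\sum_{T_i\le t}P_i,\qquad L_y=\inf\{t\ge 0:\tau_t>y\},\qquad A_y=y-\tau(L_y-),\qquad B_y=\tau(L_y)-y .$$ Let $N'=\sum_i\delta_{(T'_i,P'_i)}$ be a Poisson point process of the same kind with $K'$ in place of $K$ (possibly on another probability space, or $N'=N$). The points $P'_i/\sum_{T'_k\le s}P'_k$ with $T'_i\le s$ form the Pitman–Yor $\mathrm{PD}(\alpha,0)$ mass-partition. Let $(\tilde V_n)_{n\ge1}$ be its size-biased ordering: conditionally on the partition, its blocks are drawn successively without replacement, each remaining block being chosen with probability proportional to its size, and $\tilde V_n$ is the size of the $n$-th block drawn. Let $U$ be uniform on $(0,1)$ and independent of $(\tilde V_n)$. Then $$\left(\frac{A_T}{T},\ \sum_{T_i<L_T}\delta_{P_i/T},\ \frac{B_T}{T}\right)\ \stackrel{d}{=}\ \left(\tilde V_1,\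 \sum_{j\ge2}\delta_{\tilde V_j},\ \tilde V_1\bigl(U^{-1/\alpha}-1\bigr)\right).$$ Moreover, let $(E_i)$ be i.i.d. standard exponential random variables independent of $(T_i,P_i)_i$. Let $T_1^\wedge=\min\{T_i:P_i>E_i\}$ (almost surely attained at a unique index), let $E_1^\wedge$ be the mark $E_i$ of the point at which it is attained, and let $$\Gamma=\sum_{T_i\le T_1^\wedge,\;P_i\le E_i}P_i+E_1^\wedge .$$ Then both triples above also have the law of $$\left(\frac{A_\Gamma}{\Gamma},\ \sum_{T_i\le T_1^\wedge,\;P_i\le E_i}\delta_{P_i/\Gamma},\ \frac{B_\Gamma}{\Gamma}\right).$$ Here counting measures are random elements of the space of measures on $\mathbb R$ with the $\sigma$-algebra generated by the evaluations $m\mapsto m(B)$, $B$ Borel. -/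

import Mathlib

open MeasureTheory ProbabilityTheory Set
open scoped ENNReal

noncomputable section

/-- `N` is a Poisson point process (random measure) with intensity `lam`. It is measurable for the
sigma-algebra on measures generated by the evaluations at measurable sets, the number of points in
a set of finite intensity is Poisson distributed with the corresponding parameter, and the numbers
of points in pairwise disjoint sets are independent. -/
structure IsPoissonPointProcess {Ω X : Type*} [MeasurableSpace Ω] [MeasurableSpace X]
    (N : Ω → Measure X) (lam : Measure X) (μ : Measure Ω) : Prop where
  measurable : Measurable N
  poisson : ∀ A : Set X, MeasurableSet A → lam A ≠ ∞ →
    HasLaw (fun ω => N ω A) ((poissonMeasure (lam A).toNNReal).map (Nat.cast : ℕ → ℝ≥0∞)) μ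
  indep : ∀ (n : ℕ) (A : Fin n → Set X), (∀ k, MeasurableSet (A k)) →
    Pairwise (fun k l => Disjoint (A k) (A l)) → iIndepFun (fun k ω => N ω (A k)) μ

/-- The measure `K α u ^ (-(α + 1)) du` on `(0, ∞)`, whose tail is `K u ^ (-α)`. -/
def stableLevyMeasure (α K : ℝ) : Measure ℝ :=
  (volume.restrict (Ioi 0)).withDensity fun u => ENNReal.ofReal (K * α * u ^ (-(α + 1)))

/-- `(T i, P i)` is a measurable enumeration of the points of a Poisson point process on
`(0, ∞) × (0, ∞)` with intensity `Leb × stableLevyMeasure α K`. -/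
structure IsStableJumpProcess {Ω : Type*} [MeasurableSpace Ω] (α K : ℝ)
    (T P : ℕ → Ω → ℝ) (μ : Measure Ω) : Prop where
  measurable_time : ∀ i, Measurable (T i)
  measurable_jump : ∀ i, Measurable (P i)
  poisson : IsPoissonPointProcess
    (fun ω => Measure.sum fun i => Measure.dirac (T i ω, P i ω))
    ((volume.restrict (Ioi (0 : ℝ))).prod (stableLevyMeasure α K)) μ

/-- `(E i)` is a sequence of i.i.d. standard exponential marks, independent of `(T i, P i)`. -/
structure IsExponentialMarking {Ω : Type*} [MeasurableSpace Ω]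
    (E T P : ℕ → Ω → ℝ) (μ : Measure Ω) : Prop where
  law : ∀ i, HasLaw (E i) (expMeasure 1) μ
  iIndep : iIndepFun E μ
  indep : IndepFun (fun ω i => E i ω) (fun ω i => (T i ω, P i ω)) μ

/-! In the following path functionals, `t i` are the times of the jumps, `p i` are their sizes and
`e i` are their marks. -/

open Classical in
/-- The subordinator `τ_s`, the sum of the jumps `p i` with `t i ≤ s`. -/
def subordinator (t p : ℕ → ℝ) (s : ℝ) : ℝ := ∑' i, if t i ≤ s then p i else 0

/-- The right-continuous inverse `L_x = inf {s ≥ 0 : τ_s > x}`. -/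
def inverseSubordinator (t p : ℕ → ℝ) (x : ℝ) : ℝ :=
  sInf {s | 0 ≤ s ∧ x < subordinator t p s}

/-- The undershoot `A_x = x - τ(L_x -)`. -/
def undershoot (t p : ℕ → ℝ) (x : ℝ) : ℝ :=
  x - Function.leftLim (subordinator t p) (inverseSubordinator t p x)

/-- The overshoot `B_x = τ(L_x) - x`. -/
def overshoot (t p : ℕ → ℝ) (x : ℝ) : ℝ :=
  subordinator t p (inverseSubordinator t p x) - x

open Classical in
/-- The counting measure of the completed jumps divided by `x`, that is, of the points `p i / x`
with `t i < L_x`. -/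
def completedJumps (t p : ℕ → ℝ) (x : ℝ) : Measure ℝ :=
  Measure.sum fun i =>
    if t i < inverseSubordinator t p x then Measure.dirac (p i / x) else 0

/-- The time `T₁^∧` of the first jump that exceeds its mark. -/
def firstExceedTime (t p e : ℕ → ℝ) : ℝ := sInf {u | ∃ i, e i < p i ∧ t i = u}

open Classical in
/-- The mark `E₁^∧` of the first jump that exceeds its mark. -/
def firstExceedMark (t p e : ℕ → ℝ) : ℝ :=
  ∑' i, if e i < p i ∧ t i = firstExceedTime t p e then e i else 0

open Classical in
/-- The random level `Γ`: the sum of the jumps up to time `T₁^∧` which do not exceed their marks,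
plus `E₁^∧`. -/
def thinningLevel (t p e : ℕ → ℝ) : ℝ :=
  (∑' i, if p i ≤ e i ∧ t i ≤ firstExceedTime t p e then p i else 0) + firstExceedMark t p e

open Classical in
/-- The counting measure of the jumps up to time `T₁^∧` which do not exceed their marks, divided
by `x`. -/
def thinnedJumps (t p e : ℕ → ℝ) (x : ℝ) : Measure ℝ :=
  Measure.sum fun i =>
    if p i ≤ e i ∧ t i ≤ firstExceedTime t p e then Measure.dirac (p i / x) else 0

open Classical in
/-- The jumps up to time `s`, normalized by their sum `τ_s`. The index of a jump after time `s`
gets the value `0`, so that the positive entries are the blocks of the mass-partition. -/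
def normalizedJumps (t p : ℕ → ℝ) (s : ℝ) (i : ℕ) : ℝ :=
  if t i ≤ s then p i / subordinator t p s else 0

/-- `W` is a size-biased ordering of the random mass-partition whose blocks are the positive
entries of `V` (infinitely many, with sum `1`, almost surely): `W n = V (σ n)` where, conditionally
on `V`, the indices `σ 0, σ 1, …` are drawn successively without replacement, each remaining block
being chosen with probability proportional to its size. -/
def IsSizeBiasedOrdering {Ω : Type*} [MeasurableSpace Ω] (V W : ℕ → Ω → ℝ) (μ : Measure Ω) :
    Prop :=
  ∃ σ : ℕ → Ω → ℕ, (∀ n, Measurable (σ n)) ∧ (∀ n ω, W n ω = V (σ n ω) ω) ∧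
    ∀ (n : ℕ) (j : Fin n → ℕ), Function.Injective j →
      ∀ B : Set (ℕ → ℝ), MeasurableSet B →
        μ {ω | (fun i => V i ω) ∈ B ∧ ∀ k : Fin n, σ k ω = j k} =
          ∫⁻ ω in {ω | (fun i => V i ω) ∈ B},
            ENNReal.ofReal
              (∏ k : Fin n, V (j k) ω / (1 - ∑ l ∈ Finset.univ.filter (· < k), V (j l) ω)) ∂μ

end

/-! All three laws are computed by Mecke's formula and turn out to be the same integral,
`sizeBiasedValue`. Write τ for the mass and J for the collection of the jumps of N' up to time s.
Add an independent jump p from the Lévy measure with constant s K'. The integral is the mean of H at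
(y, J / (τ + p), y (U^(-1/α) - 1)) with y = p / (τ + p), under the extra weight p / (τ + p).

Size-biased side: conditioning on the first draw gives a sum over i weighted by V i, and the later
draws run through all other blocks (`IsSizeBiasedOrdering.lintegral_eq`). By Mecke's formula the
point i becomes an added point (t, p) with t ≤ s, independent of N'. The integral over t contributes
the factor s (`IsSizeBiasedOrdering.lintegral_normalizedJumps`).

Fixed level x: exactly one jump crosses x, so the law is a sum over i of the events that jump i
crosses. By Mecke's formula this is an integral over a time t and a jump q > x - τ(t-). The Lévy
tail is a power, so q = (x - τ(t-)) U^(-1/α), which gives the overshoot. By self-similarity the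
jumps before t are those of N' up to s multiplied by w(t) = (K t / (s K'))^(1/α). For a fixed path
of N', the substitution w(t) = x / (τ + p) turns dt and the Lévy tail into the weight p / (τ + p)
against the Lévy measure, and both x and K disappear (`lintegral_level_change_of_variables`,
`IsStableJumpProcess.lintegral_crossingValue_eq`).

Thinned level: given the path, jump i is the first to exceed its mark, with mark near y < p i, with
density exp (-τ(t i -)) exp (-y). In terms of g = τ(t i -) + y this is exp (-g) dg on the event that
jump i crosses g. The law is thus an exponential mixture of the fixed-level laws, which do not
depend on the level (`expMeasure_crossingTriple_mul_expNeg`, `tsum_measure_firstExceeds`).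

The total mass of the common integral is 1 because the size-biased side is a probability law. This
in turn yields the almost sure existence of the crossing jump and of the first exceedance. Mecke's
formula itself comes from Laplace functionals, which determine a finite measure on a space of
measures (`ext_of_lintegral_expNeg`), and from a one-dimensional Poisson identity. -/

open scoped Topology

/-! ### Negative exponentials on the extended half-line -/

/-- The function `x ↦ exp (-x)` on `[0, ∞]`. -/
noncomputable def expNeg (x : ℝ≥0∞) : ℝ≥0∞ := (EReal.exp x)⁻¹

lemma expNeg_zero : expNeg 0 = 1 := by simp [expNeg]

lemma expNeg_top : expNeg ∞ = 0 := by simp [expNeg]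

lemma one_le_exp_coe (x : ℝ≥0∞) : 1 ≤ EReal.exp x := by
  simpa using EReal.coe_ennreal_nonneg x

lemma expNeg_le_one (x : ℝ≥0∞) : expNeg x ≤ 1 := by
  simpa [expNeg] using EReal.coe_ennreal_nonneg x

lemma expNeg_ne_top (x : ℝ≥0∞) : expNeg x ≠ ∞ :=
  ((expNeg_le_one x).trans_lt ENNReal.one_lt_top).ne

lemma expNeg_add (x y : ℝ≥0∞) : expNeg (x + y) = expNeg x * expNeg y := by
  have h : ∀ z : ℝ≥0∞, EReal.exp z ≠ 0 := fun z =>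
    (zero_lt_one.trans_le (one_le_exp_coe z)).ne'
  rw [expNeg, EReal.coe_ennreal_add, EReal.exp_add, ENNReal.mul_inv (Or.inl (h x)) (Or.inr (h y))]
  rfl

lemma expNeg_sum {ι : Type*} (s : Finset ι) (f : ι → ℝ≥0∞) :
    expNeg (∑ i ∈ s, f i) = ∏ i ∈ s, expNeg (f i) := by
  classical
  induction s using Finset.induction_on with
  | empty => simp [expNeg_zero]
  | insert a s ha ih => rw [Finset.sum_insert ha, Finset.prod_insert ha, expNeg_add, ih]

lemma expNeg_nat_mul (n : ℕ) (x : ℝ≥0∞) : expNeg (n * x) = expNeg x ^ n := by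
  induction n with
  | zero => simp [expNeg_zero]
  | succ n ih => rw [Nat.cast_succ, add_mul, one_mul, expNeg_add, ih, pow_succ]

lemma expNeg_ofReal {x : ℝ} (hx : 0 ≤ x) :
    expNeg (ENNReal.ofReal x) = ENNReal.ofReal (Real.exp (-x)) := by
  rw [expNeg, EReal.coe_ennreal_ofReal, max_eq_left hx, EReal.exp_coe, Real.exp_neg,
    ENNReal.ofReal_inv_of_pos (Real.exp_pos x)]

lemma expNeg_strictAnti : StrictAnti expNeg := fun x y h => by
  simpa [expNeg] using h

lemma continuous_expNeg : Continuous expNeg :=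
  continuous_inv.comp (ENNReal.continuous_exp.comp continuous_coe_ennreal_ereal)

@[fun_prop]
lemma measurable_expNeg : Measurable expNeg := continuous_expNeg.measurable

/-! ### Laplace functionals determine finite measures on a space of measures -/

/-- `x ↦ exp (-x)` as a map from `[0, ∞]` to the unit interval. -/
noncomputable def expNegUnit (x : ℝ≥0∞) : unitInterval :=
  ⟨(expNeg x).toReal, ENNReal.toReal_nonneg, by
    simpa using ENNReal.toReal_mono ENNReal.one_ne_top (expNeg_le_one x)⟩

lemma measurable_expNegUnit : Measurable expNegUnit :=
  measurable_expNeg.ennreal_toReal.subtype_mk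

lemma measurableEmbedding_expNegUnit : MeasurableEmbedding expNegUnit := by
  refine measurable_expNegUnit.measurableEmbedding fun x y h => ?_
  have h' := congrArg Subtype.val h
  exact expNeg_strictAnti.injective
    ((ENNReal.toReal_eq_toReal_iff' (expNeg_ne_top x) (expNeg_ne_top y)).1 h')

/-- Polynomials in the coordinates form an algebra of bounded continuous functions that separates
the points of the cube, and monomials span it linearly. -/
lemma ext_of_integral_monomial {ι : Type*} [Fintype ι] {P Q : Measure (ι → unitInterval)}
    [IsFiniteMeasure P] [IsFiniteMeasure Q]
    (h : ∀ n : ι → ℕ, ∫ u, ∏ k, (u k : ℝ) ^ n k ∂P = ∫ u, ∏ k, (u k : ℝ) ^ n k ∂Q) : P = Q := by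
  classical
  let c : ι → BoundedContinuousFunction (ι → unitInterval) ℝ := fun k =>
    BoundedContinuousFunction.mkOfCompact ⟨fun u => (u k : ℝ), by fun_prop⟩
  let A : StarSubalgebra ℝ (BoundedContinuousFunction (ι → unitInterval) ℝ) :=
    { Algebra.adjoin ℝ (range c) with
      star_mem' := fun {a} ha => by
        rwa [show star a = a from BoundedContinuousFunction.ext fun u => by simp] }
  have hA : ∀ g ∈ A, g ∈ Algebra.adjoin ℝ (range c) := fun g hg => hg
  refine ext_of_forall_mem_subalgebra_integral_eq_of_polish (𝕜 := ℝ) (A := A) ?_ ?_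
  · intro u v huv
    obtain ⟨k, hk⟩ := Function.ne_iff.1 huv
    refine ⟨fun w => (w k : ℝ), ⟨⟨fun w => (w k : ℝ), by fun_prop⟩, ?_, rfl⟩, ?_⟩
    · exact ⟨c k, Algebra.subset_adjoin ⟨k, rfl⟩, rfl⟩
    · exact fun e => hk (Subtype.ext e)
  · intro g hg
    have hg' := hA g hg
    -- The generated algebra is the linear span of the products of coordinates, so by linearity of
    -- the integral only monomials matter.
    rw [← Subalgebra.mem_toSubmodule, Algebra.adjoin_eq_span] at hg'
    clear hg
    have hint : ∀ (R : Measure (ι → unitInterval)) [IsFiniteMeasure R]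
        (f : BoundedContinuousFunction (ι → unitInterval) ℝ), Integrable f R :=
      fun R _ f => f.integrable R
    induction hg' using Submodule.span_induction with
    | mem f hf =>
      have : ∃ n : ι → ℕ, ∀ u, f u = ∏ k, (u k : ℝ) ^ n k := by
        induction hf using Submonoid.closure_induction with
        | mem f hf =>
          obtain ⟨k, rfl⟩ := hf
          refine ⟨Pi.single k 1, fun u => ?_⟩
          rw [Finset.prod_eq_single k]
          · simp [c]
          · intro b _ hb; simp [hb]
          · simp
        | one => exact ⟨0, fun u => by simp⟩
        | mul f g _ _ hf hg =>
          obtain ⟨n, hn⟩ := hf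
          obtain ⟨m, hm⟩ := hg
          exact ⟨n + m, fun u => by simp [hn, hm, pow_add, Finset.prod_mul_distrib]⟩
      obtain ⟨n, hn⟩ := this
      simp_rw [hn]
      exact h n
    | zero => simp
    | add f g _ _ ihf ihg =>
      simp only [BoundedContinuousFunction.coe_add, Pi.add_apply]
      rw [integral_add (hint P f) (hint P g), integral_add (hint Q f) (hint Q g), ihf, ihg]
    | smul a f _ ih =>
      simp only [BoundedContinuousFunction.coe_smul]
      rw [integral_smul, integral_smul, ih]

section LaplaceFunctional

variable {X : Type*} [MeasurableSpace X]

lemma simpleFunc_coe_sum {ι : Type*} (s : Finset ι) (f : ι → SimpleFunc X ℕ) :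
    ⇑(∑ i ∈ s, f i) = ∑ i ∈ s, ⇑(f i) := by
  classical
  induction s using Finset.induction_on with
  | empty => simp
  | insert a s ha ih => rw [Finset.sum_insert ha, Finset.sum_insert ha, SimpleFunc.coe_add, ih]

/-- The family of the values `exp (-m s)` of a measure `m`, `s` measurable. -/
noncomputable def expNegEval (m : Measure X) (s : {s : Set X // MeasurableSet s}) : unitInterval :=
  expNegUnit (m s)

lemma measurable_expNegEval : Measurable (expNegEval (X := X)) :=
  measurable_pi_lambda _ fun s =>
    measurable_expNegUnit.comp (Measure.measurable_coe s.2)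

/-- The evaluations generate the σ-algebra on measures and `expNegUnit` is a measurable embedding,
so this σ-algebra is pulled back from the product of unit intervals. Equality of laws can then be
tested on the product. -/
lemma exists_preimage_expNegEval {S : Set (Measure X)} (hS : MeasurableSet S) :
    ∃ S', MeasurableSet S' ∧ expNegEval ⁻¹' S' = S := by
  have hid : @Measurable _ _ (MeasurableSpace.comap (expNegEval (X := X)) inferInstance)
      Measure.instMeasurableSpace (fun m : Measure X => m) := by
    refine @Measure.measurable_of_measurable_coe _ _ _
      (MeasurableSpace.comap (expNegEval (X := X)) inferInstance) _ fun s hs => ?_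
    intro C hC
    obtain ⟨C', hC', rfl⟩ := (measurableEmbedding_expNegUnit.comap_eq.symm ▸ hC :
      MeasurableSet[MeasurableSpace.comap expNegUnit inferInstance] C)
    exact ⟨(fun u => u ⟨s, hs⟩) ⁻¹' C', measurable_pi_apply _ hC', rfl⟩
  obtain ⟨S', h1, h2⟩ := hid hS
  exact ⟨S', h1, h2⟩

/-- A finite measure on a space of measures is determined by its Laplace functional. -/
theorem ext_of_lintegral_expNeg {ρ₁ ρ₂ : Measure (Measure X)} [IsFiniteMeasure ρ₁]
    [IsFiniteMeasure ρ₂]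
    (h : ∀ f : SimpleFunc X ℕ, ∫⁻ m, expNeg (∫⁻ x, (f x : ℝ≥0∞) ∂m) ∂ρ₁ =
      ∫⁻ m, expNeg (∫⁻ x, (f x : ℝ≥0∞) ∂m) ∂ρ₂) : ρ₁ = ρ₂ := by
  -- Measures on an infinite product agree once their finite-dimensional marginals do. A mixed
  -- moment of a marginal is the Laplace functional at the simple function ∑ n_k 1_{s_k}.
  have key : ρ₁.map expNegEval = ρ₂.map expNegEval := by
    let P : ∀ J : Finset {s : Set X // MeasurableSet s}, Measure (∀ _ : J, unitInterval) :=
      fun J => (ρ₁.map expNegEval).map J.restrict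
    refine IsProjectiveLimit.unique (P := P) (fun J => rfl) (fun J => ?_)
    refine ext_of_integral_monomial fun n => ?_
    have key : ∀ (ρ : Measure (Measure X)),
        ∫ u, ∏ k, (u k : ℝ) ^ n k ∂((ρ.map expNegEval).map J.restrict) =
        (∫⁻ m, expNeg (∫⁻ x, ((∑ k : J, (SimpleFunc.const X (n k)).restrict k.1.1 :
          SimpleFunc X ℕ) x : ℝ≥0∞) ∂m) ∂ρ).toReal := by
      intro ρ
      have hm := J.measurable_restrict (X := fun _ => unitInterval)
      rw [Measure.map_map hm measurable_expNegEval, integral_map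
        (hm.comp measurable_expNegEval).aemeasurable
        (Continuous.aestronglyMeasurable (by fun_prop))]
      rw [integral_eq_lintegral_of_nonneg_ae]
      · congr 1
        refine lintegral_congr fun m => ?_
        have hs : ∫⁻ x, ((∑ k : J, (SimpleFunc.const X (n k)).restrict k.1.1 :
          SimpleFunc X ℕ) x : ℝ≥0∞) ∂m = ∑ k : J, (n k : ℝ≥0∞) * m k.1.1 := by
          have : ∀ x, ((∑ k : J, (SimpleFunc.const X (n k)).restrict k.1.1 :
              SimpleFunc X ℕ) x : ℝ≥0∞) =
              ∑ k : J, k.1.1.indicator (fun _ => (n k : ℝ≥0∞)) x := by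
            intro x
            rw [simpleFunc_coe_sum, Finset.sum_apply, Nat.cast_sum]
            refine Finset.sum_congr rfl fun k _ => ?_
            rw [SimpleFunc.restrict_apply _ k.1.2]
            by_cases hx : x ∈ k.1.1 <;> simp [hx]
          simp_rw [this]
          rw [lintegral_finsetSum _ fun k _ => measurable_const.indicator k.1.2]
          refine Finset.sum_congr rfl fun k _ => ?_
          rw [lintegral_indicator k.1.2, lintegral_const, Measure.restrict_apply_univ]
        rw [hs, expNeg_sum]
        simp_rw [expNeg_nat_mul]
        simp only [Function.comp, Finset.restrict, expNegEval, expNegUnit]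
        rw [ENNReal.ofReal_prod_of_nonneg (fun _ _ => by positivity)]
        refine Finset.prod_congr rfl fun k _ => ?_
        rw [ENNReal.ofReal_pow ENNReal.toReal_nonneg, ENNReal.ofReal_toReal (expNeg_ne_top _)]
      · refine Filter.Eventually.of_forall fun m => ?_
        exact Finset.prod_nonneg fun k _ => pow_nonneg (unitInterval.nonneg _) _
      · refine Measurable.aestronglyMeasurable ?_
        refine Finset.measurable_prod _ fun k _ => ?_
        exact ((measurable_subtype_coe.comp ((measurable_pi_apply k).comp
          (hm.comp measurable_expNegEval)))).pow_const _
    rw [key, key, h]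
  ext S hS
  obtain ⟨S', hS', rfl⟩ := exists_preimage_expNegEval hS
  rw [← Measure.map_apply measurable_expNegEval hS', key,
    Measure.map_apply measurable_expNegEval hS']

end LaplaceFunctional

/-! ### Poisson counts against exponentials -/

lemma lintegral_poissonMeasure (r : NNReal) (f : ℕ → ℝ≥0∞) :
    ∫⁻ n, f n ∂(poissonMeasure r) =
      ∑' n, f n * ENNReal.ofReal (Real.exp (-r) * (r : ℝ) ^ n / (n.factorial)) := by
  rw [lintegral_countable']
  refine tsum_congr fun n => ?_
  rw [poissonMeasure_singleton]

/-- The factor n cancels against n! and shifts the series by one. This is Mecke's formula for a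
single Poisson count, tested on exponentials. -/
lemma lintegral_poissonMeasure_mul_expNeg (r : NNReal) (c : ℕ) :
    ∫⁻ n, (n : ℝ≥0∞) * expNeg (c * n) ∂(poissonMeasure r) =
      r * expNeg c * ∫⁻ n, expNeg (c * n) ∂(poissonMeasure r) := by
  rw [lintegral_poissonMeasure, lintegral_poissonMeasure, tsum_eq_zero_add' ENNReal.summable,
    ← ENNReal.tsum_mul_left]
  simp only [Nat.cast_zero, zero_mul, zero_add]
  refine tsum_congr fun n => ?_
  have h : (((n + 1 : ℕ) : ℝ≥0∞)) * ENNReal.ofReal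
      (Real.exp (-r) * (r : ℝ) ^ (n + 1) / ((n + 1).factorial)) =
      r * ENNReal.ofReal (Real.exp (-r) * (r : ℝ) ^ n / (n.factorial)) := by
    rw [← ENNReal.ofReal_natCast, ← ENNReal.ofReal_coe_nnreal, ← ENNReal.ofReal_mul (by positivity),
      ← ENNReal.ofReal_mul (by positivity), Nat.factorial_succ]
    congr 1
    push_cast
    field_simp
    ring
  have h2 : expNeg ((c : ℝ≥0∞) * ((n + 1 : ℕ) : ℝ≥0∞)) = expNeg c * expNeg (c * n) := by
    rw [Nat.cast_succ, mul_add, mul_one, expNeg_add, mul_comm]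
  calc _ = expNeg ((c : ℝ≥0∞) * ((n + 1 : ℕ) : ℝ≥0∞)) * ((((n + 1 : ℕ) : ℝ≥0∞)) * ENNReal.ofReal
      (Real.exp (-r) * (r : ℝ) ^ (n + 1) / ((n + 1).factorial))) := by ring
    _ = _ := by rw [h, h2]; ring

/-! ### Counting measures, erasure of a point, and an s-finite substitute for the identity kernel -/

section MeasureSums

variable {Ω X : Type*} [MeasurableSpace Ω] [MeasurableSpace X]

lemma measurable_measureSum {M : ℕ → Ω → Measure X} (hM : ∀ i, Measurable (M i)) :
    Measurable fun ω => Measure.sum fun i => M i ω := by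
  refine Measure.measurable_of_measurable_coe _ fun s hs => ?_
  simp_rw [Measure.sum_apply _ hs]
  exact Measurable.tsum fun i => (Measure.measurable_coe hs).comp (hM i)

lemma measurable_sum_ite_dirac {p : ℕ → Ω → Prop} [∀ i ω, Decidable (p i ω)]
    (hp : ∀ i, MeasurableSet {ω | p i ω}) {x : ℕ → Ω → X} (hx : ∀ i, Measurable (x i)) :
    Measurable fun ω => Measure.sum fun i => if p i ω then Measure.dirac (x i ω) else 0 :=
  measurable_measureSum fun i =>
    Measurable.ite (hp i) (Measure.measurable_dirac.comp (hx i)) measurable_const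

lemma lintegral_simpleFunc_nat (f : SimpleFunc X ℕ) (g : ℕ → ℝ≥0∞) (m : Measure X) :
    ∫⁻ x, g (f x) ∂m = ∑ v ∈ f.range, g v * m (f ⁻¹' {v}) := by
  rw [← SimpleFunc.map_lintegral, ← SimpleFunc.lintegral_eq_lintegral]
  rfl

/-- The set A need not be a union of level sets of f, so it is cut out of each of them. The
resulting pieces are disjoint and independence of the counts applies to them. -/
lemma lintegral_simpleFunc_eq_sum_option (f : SimpleFunc X ℕ) {A : Set X} (hA : MeasurableSet A)
    {v₀ : ℕ} (hv : A ⊆ f ⁻¹' {v₀}) (m : Measure X) :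
    ∫⁻ x, (f x : ℝ≥0∞) ∂m =
      v₀ * m A + ∑ v : f.range, (v.1 : ℝ≥0∞) * m (f ⁻¹' {v.1} \ A) := by
  rw [← lintegral_add_compl _ hA]
  congr 1
  · rw [setLIntegral_congr_fun hA (g := fun _ => (v₀ : ℝ≥0∞)) (fun x hx => by
      have : f x = v₀ := hv hx
      simp [this])]
    simp
  · rw [lintegral_simpleFunc_nat f (fun n => (n : ℝ≥0∞)), ← Finset.sum_coe_sort]
    refine Finset.sum_congr rfl fun v _ => ?_
    rw [Measure.restrict_apply (f.measurableSet_preimage _)]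
    rfl

/-- The counting measure of the points `x j` with `j ≠ i`. -/
noncomputable def sumDiracErase (x : ℕ → X) (i : ℕ) : Measure X :=
  Measure.sum fun j => if j = i then 0 else Measure.dirac (x j)

lemma sum_dirac_eq_add_erase (x : ℕ → X) (i : ℕ) :
    (Measure.sum fun j => Measure.dirac (x j)) = Measure.dirac (x i) + sumDiracErase x i := by
  ext s hs
  rw [Measure.sum_apply _ hs, Measure.add_apply, sumDiracErase, Measure.sum_apply _ hs]
  rw [ENNReal.tsum_eq_add_tsum_ite i]
  congr 1
  refine tsum_congr fun j => ?_
  split_ifs <;> simp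

lemma sumDiracErase_le (x : ℕ → X) (i : ℕ) :
    sumDiracErase x i ≤ Measure.sum fun j => Measure.dirac (x j) := by
  rw [sum_dirac_eq_add_erase x i]
  exact Measure.le_add_left le_rfl

lemma measurable_sumDiracErase {x : ℕ → Ω → X} (hx : ∀ i, Measurable (x i)) (i : ℕ) :
    Measurable fun ω => sumDiracErase (fun j => x j ω) i := by
  refine measurable_measureSum fun j => ?_
  by_cases h : j = i
  · simp [h]
  · simp only [h, if_false]
    exact Measure.measurable_dirac.comp (hx j)

/-- The kernel `m ↦ ∑ n, m.restrict (S n)`, in which the sum is over those `n` for which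
`m (S n) < ∞`. -/
noncomputable def finitePartKernel (S : ℕ → Set X) (hS : ∀ n, MeasurableSet (S n)) :
    Kernel (Measure X) X :=
  -- Slicing by the integer part q.2 of the mass of S q.1 makes each summand a finite kernel, hence
  -- the sum s-finite. The identity kernel on all measures need not be s-finite.
  Kernel.sum fun q : ℕ × ℕ =>
    Kernel.piecewise (s := {m : Measure X | m (S q.1) ∈ Ico (q.2 : ℝ≥0∞) (q.2 + 1)})
      (Measure.measurable_coe (hS q.1) measurableSet_Ico)
      (Kernel.restrict ⟨fun m => m, measurable_id⟩ (hS q.1)) 0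

instance (S : ℕ → Set X) (hS : ∀ n, MeasurableSet (S n)) :
    IsSFiniteKernel (finitePartKernel S hS) := by
  refine Kernel.isSFiniteKernel_sum (hκs := fun q => ?_)
  have : IsFiniteKernel (Kernel.piecewise
      (s := {m : Measure X | m (S q.1) ∈ Ico (q.2 : ℝ≥0∞) (q.2 + 1)})
      (Measure.measurable_coe (hS q.1) measurableSet_Ico)
      (Kernel.restrict ⟨fun m => m, measurable_id⟩ (hS q.1)) 0) := by
    refine ⟨⟨q.2 + 1, by simp, fun m => ?_⟩⟩
    rw [Kernel.piecewise_apply']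
    split_ifs with h
    · rw [Kernel.restrict_apply, Measure.restrict_apply_univ]
      exact h.2.le
    · simp
  infer_instance

lemma finitePartKernel_apply {S : ℕ → Set X} (hS : ∀ n, MeasurableSet (S n))
    (hd : Pairwise (Function.onFun Disjoint S)) (hu : ⋃ n, S n = univ) {m : Measure X}
    (hm : ∀ n, m (S n) ≠ ∞) : finitePartKernel S hS m = m := by
  ext s hs
  rw [finitePartKernel, Kernel.sum_apply' _ _ hs,
    ENNReal.summable.tsum_prod' fun _ => ENNReal.summable]
  have h : ∀ n, ∑' k : ℕ, (Kernel.piecewise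
      (s := {m : Measure X | m (S n) ∈ Ico (k : ℝ≥0∞) (k + 1)})
      (Measure.measurable_coe (hS n) measurableSet_Ico)
      (Kernel.restrict ⟨fun m => m, measurable_id⟩ (hS n)) 0) m s = m (s ∩ S n) := by
    intro n
    simp_rw [Kernel.piecewise_apply']
    obtain ⟨r, hr⟩ : ∃ r : NNReal, (r : ℝ≥0∞) = m (S n) := ⟨_, ENNReal.coe_toNNReal (hm n)⟩
    -- The measure m lies in exactly one slice, that of the integer part of m (S n).
    rw [tsum_eq_single ⌊r⌋₊]
    · rw [if_pos, Kernel.restrict_apply, Measure.restrict_apply hs]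
      · rfl
      · simp only [mem_ofPred_eq, mem_Ico, ← hr]
        exact ⟨by exact_mod_cast Nat.floor_le zero_le,
          by exact_mod_cast Nat.lt_floor_add_one r⟩
    · intro k hk
      rw [if_neg]
      · simp
      · simp only [mem_ofPred_eq, mem_Ico, ← hr]
        rintro ⟨h1, h2⟩
        refine hk ((Nat.floor_eq_iff zero_le).2 ⟨?_, ?_⟩).symm
        · exact_mod_cast h1
        · exact_mod_cast h2
  simp_rw [h]
  rw [← measure_iUnion (fun i j hij => (hd hij).mono inter_subset_right inter_subset_right)
    (fun n => hs.inter (hS n)), ← inter_iUnion, hu, inter_univ]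

end MeasureSums

/-! ### Mecke's formula and uniqueness in law for Poisson processes -/

namespace IsPoissonPointProcess

variable {Ω X : Type*} [MeasurableSpace Ω] [MeasurableSpace X] {N : Ω → Measure X}
  {lam : Measure X} {μ : Measure Ω}

lemma iIndepFun_fintype (hN : IsPoissonPointProcess N lam μ) {ι : Type*} [Fintype ι]
    {A : ι → Set X} (hA : ∀ k, MeasurableSet (A k))
    (hd : Pairwise (fun k l => Disjoint (A k) (A l))) : iIndepFun (fun k ω => N ω (A k)) μ := by
  let e := Fintype.equivFin ι
  have h := (hN.indep _ (fun k => A (e.symm k)) (fun k => hA _)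
    (fun k l hkl => hd (fun h => hkl (e.symm.injective h)))).precomp e.injective
  simpa using h

lemma lintegral_prod (hN : IsPoissonPointProcess N lam μ) {ι : Type*} [Fintype ι]
    {A : ι → Set X} (hA : ∀ k, MeasurableSet (A k))
    (hd : Pairwise (fun k l => Disjoint (A k) (A l))) {g : ι → ℝ≥0∞ → ℝ≥0∞}
    (hg : ∀ k, Measurable (g k)) :
    ∫⁻ ω, ∏ k, g k (N ω (A k)) ∂μ = ∏ k, ∫⁻ ω, g k (N ω (A k)) ∂μ :=
  lintegral_prod_eq_prod_lintegral_of_indepFun Finset.univ (fun k ω => g k (N ω (A k)))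
    ((hN.iIndepFun_fintype hA hd).comp g hg)
    (fun k => (hg k).comp ((Measure.measurable_coe (hA k)).comp hN.measurable))

lemma lintegral_eval (hN : IsPoissonPointProcess N lam μ) {A : Set X} (hA : MeasurableSet A)
    (hfin : lam A ≠ ∞) {g : ℝ≥0∞ → ℝ≥0∞} (hg : Measurable g) :
    ∫⁻ ω, g (N ω A) ∂μ = ∫⁻ n, g (n : ℕ) ∂(poissonMeasure (lam A).toNNReal) := by
  rw [(hN.poisson A hA hfin).lintegral_comp hg.aemeasurable,
    lintegral_map hg measurable_from_top]

lemma lintegral_eval_mul_expNeg (hN : IsPoissonPointProcess N lam μ) {A : Set X}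
    (hA : MeasurableSet A) (hfin : lam A ≠ ∞) (c : ℕ) :
    ∫⁻ ω, N ω A * expNeg (c * N ω A) ∂μ = lam A * expNeg c * ∫⁻ ω, expNeg (c * N ω A) ∂μ := by
  rw [hN.lintegral_eval hA hfin (g := fun x => x * expNeg (c * x)) (by fun_prop),
    hN.lintegral_eval hA hfin (g := fun x => expNeg (c * x)) (by fun_prop),
    lintegral_poissonMeasure_mul_expNeg, ENNReal.coe_toNNReal hfin]

/-- Independence isolates the count on A. On that factor the one-dimensional Poisson identity
replaces the count by lam A and an exponential factor. -/
lemma lintegral_eval_mul_laplace (hN : IsPoissonPointProcess N lam μ) {A : Set X}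
    (hA : MeasurableSet A) (hfin : lam A ≠ ∞) (f : SimpleFunc X ℕ) {v₀ : ℕ}
    (hv : A ⊆ f ⁻¹' {v₀}) :
    ∫⁻ ω, N ω A * expNeg (∫⁻ x, (f x : ℝ≥0∞) ∂(N ω)) ∂μ =
      lam A * expNeg v₀ * ∫⁻ ω, expNeg (∫⁻ x, (f x : ℝ≥0∞) ∂(N ω)) ∂μ := by
  let S : Option f.range → Set X := fun o => o.elim A fun v => f ⁻¹' {v.1} \ A
  have hS : ∀ o, MeasurableSet (S o) := by
    rintro (_ | v)
    · exact hA
    · exact (f.measurableSet_preimage _).diff hA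
  have hd : Pairwise (fun k l => Disjoint (S k) (S l)) := by
    rintro (_ | v) (_ | w) hvw
    · exact absurd rfl hvw
    · exact disjoint_sdiff_right
    · exact disjoint_sdiff_left
    · refine Disjoint.mono sdiff_subset sdiff_subset
        (Disjoint.preimage _ (disjoint_singleton.2 fun h => ?_))
      exact hvw (congrArg some (Subtype.ext h))
  have hE : ∀ ω, expNeg (∫⁻ x, (f x : ℝ≥0∞) ∂(N ω)) =
      expNeg (v₀ * N ω A) * ∏ v : f.range, expNeg (v.1 * N ω (f ⁻¹' {v.1} \ A)) := fun ω => by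
    rw [lintegral_simpleFunc_eq_sum_option f hA hv, expNeg_add, expNeg_sum]
  have h1 := hN.lintegral_prod hS hd (g := fun o => o.elim (fun x => x * expNeg (v₀ * x))
    fun v => fun x => expNeg (v.1 * x)) (by rintro (_ | v) <;> simp <;> fun_prop)
  have h2 := hN.lintegral_prod hS hd (g := fun o => o.elim (fun x => expNeg (v₀ * x))
    fun v => fun x => expNeg (v.1 * x)) (by rintro (_ | v) <;> simp <;> fun_prop)
  simp only [Fintype.prod_option, Option.elim, S] at h1 h2
  simp_rw [hE]
  rw [h2]
  simp_rw [mul_assoc] at h1 ⊢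
  rw [h1, hN.lintegral_eval_mul_expNeg hA hfin]
  ring

/-- Independence of the empty family already forces total mass one. -/
lemma isProbabilityMeasure (hN : IsPoissonPointProcess N lam μ) : IsProbabilityMeasure μ :=
  (hN.indep 0 (fun _ => ∅) (fun _ => MeasurableSet.empty)
    (fun k => k.elim0)).isProbabilityMeasure

section Points

variable {z : ℕ → Ω → X}

/-- Erasing the point z i multiplies the Laplace factor by exp (f (z i)). Summed over i this is the
integral of exp f over B against N. On the level set f = v the Poisson identity produces exp (-v),
which cancels exp v. -/
lemma tsum_lintegral_indicator_laplace (hz : ∀ i, Measurable (z i))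
    (hN : IsPoissonPointProcess (fun ω => Measure.sum fun i => Measure.dirac (z i ω)) lam μ)
    {B : Set X} (hB : MeasurableSet B) (hfin : lam B ≠ ∞) (f : SimpleFunc X ℕ) :
    ∑' i, ∫⁻ ω in z i ⁻¹' B, expNeg (∫⁻ x, (f x : ℝ≥0∞) ∂(sumDiracErase (fun j => z j ω) i)) ∂μ =
      lam B * ∫⁻ ω, expNeg (∫⁻ x, (f x : ℝ≥0∞) ∂(Measure.sum fun i => Measure.dirac (z i ω))) ∂μ := by
  have hfm : Measurable fun x => (f x : ℝ≥0∞) := measurable_from_top.comp f.measurable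
  have hpos : ∀ n : ℕ, expNeg n ≠ 0 := fun n h => by
    rw [← expNeg_top] at h
    exact ENNReal.natCast_ne_top n (expNeg_strictAnti.injective h)
  have hL : ∀ i ω, expNeg (∫⁻ x, (f x : ℝ≥0∞) ∂(sumDiracErase (fun j => z j ω) i)) =
      (expNeg (f (z i ω)))⁻¹ *
        expNeg (∫⁻ x, (f x : ℝ≥0∞) ∂(Measure.sum fun i => Measure.dirac (z i ω))) := by
    intro i ω
    rw [sum_dirac_eq_add_erase (fun j => z j ω) i, lintegral_add_measure, lintegral_dirac' _ hfm,
      expNeg_add, ← mul_assoc, ENNReal.inv_mul_cancel (hpos _) (expNeg_ne_top _), one_mul]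
  have hNm : Measurable fun ω =>
      expNeg (∫⁻ x, (f x : ℝ≥0∞) ∂(Measure.sum fun i => Measure.dirac (z i ω))) :=
    measurable_expNeg.comp ((Measure.measurable_lintegral hfm).comp hN.measurable)
  have hφ : Measurable fun x => B.indicator (fun x => (expNeg (f x))⁻¹) x :=
    ((measurable_expNeg.comp hfm).inv).indicator hB
  calc _ = ∑' i, ∫⁻ ω, B.indicator (fun x => (expNeg (f x))⁻¹) (z i ω) *
        expNeg (∫⁻ x, (f x : ℝ≥0∞) ∂(Measure.sum fun i => Measure.dirac (z i ω))) ∂μ := by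
        refine tsum_congr fun i => ?_
        rw [← lintegral_indicator (hz i hB)]
        refine lintegral_congr fun ω => ?_
        by_cases h : z i ω ∈ B
        · rw [indicator_of_mem (by exact h), indicator_of_mem h, hL]
        · rw [indicator_of_notMem (by exact h), indicator_of_notMem h, zero_mul]
    _ = ∫⁻ ω, (∫⁻ x, B.indicator (fun x => (expNeg (f x))⁻¹) x
          ∂(Measure.sum fun i => Measure.dirac (z i ω))) *
        expNeg (∫⁻ x, (f x : ℝ≥0∞) ∂(Measure.sum fun i => Measure.dirac (z i ω))) ∂μ := by
        have hm : ∀ i, Measurable fun ω => B.indicator (fun x => (expNeg (f x))⁻¹) (z i ω) *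
            expNeg (∫⁻ x, (f x : ℝ≥0∞) ∂(Measure.sum fun i => Measure.dirac (z i ω))) := fun i =>
          (hφ.comp (hz i)).mul hNm
        rw [← lintegral_tsum fun i => (hm i).aemeasurable]
        refine lintegral_congr fun ω => ?_
        rw [ENNReal.tsum_mul_right]
        congr 1
        rw [lintegral_sum_measure]
        exact tsum_congr fun i => (lintegral_dirac' _ hφ).symm
    _ = ∑ v ∈ f.range, (expNeg v)⁻¹ * ∫⁻ ω,
          (Measure.sum fun i => Measure.dirac (z i ω)) (f ⁻¹' {v} ∩ B) *
          expNeg (∫⁻ x, (f x : ℝ≥0∞) ∂(Measure.sum fun i => Measure.dirac (z i ω))) ∂μ := by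
        have hA : ∀ v, MeasurableSet (f ⁻¹' {v} ∩ B) := fun v =>
          (f.measurableSet_preimage _).inter hB
        simp_rw [lintegral_indicator hB,
          lintegral_simpleFunc_nat f (fun n => (expNeg (n : ℝ≥0∞))⁻¹),
          Measure.restrict_apply (f.measurableSet_preimage _), Finset.sum_mul, mul_assoc]
        have hAm : ∀ v, Measurable fun ω =>
            (Measure.sum fun i => Measure.dirac (z i ω)) (f ⁻¹' {v} ∩ B) *
            expNeg (∫⁻ x, (f x : ℝ≥0∞) ∂(Measure.sum fun i => Measure.dirac (z i ω))) := fun v =>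
          ((Measure.measurable_coe (hA v)).comp hN.measurable).mul hNm
        rw [lintegral_finsetSum _ fun v _ => (hAm v).const_mul _]
        exact Finset.sum_congr rfl fun v _ => lintegral_const_mul _ (hAm v)
    _ = ∑ v ∈ f.range, lam (f ⁻¹' {v} ∩ B) * ∫⁻ ω,
          expNeg (∫⁻ x, (f x : ℝ≥0∞) ∂(Measure.sum fun i => Measure.dirac (z i ω))) ∂μ := by
        refine Finset.sum_congr rfl fun v _ => ?_
        rw [hN.lintegral_eval_mul_laplace ((f.measurableSet_preimage _).inter hB)
          (measure_ne_top_of_subset inter_subset_right hfin) f inter_subset_left]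
        rw [mul_comm (lam _) (expNeg v), ← mul_assoc, ← mul_assoc,
          ENNReal.inv_mul_cancel (hpos _) (expNeg_ne_top _), one_mul]
    _ = _ := by
        rw [← Finset.sum_mul]
        congr 1
        have := lintegral_simpleFunc_nat f (fun _ => 1) (lam.restrict B)
        simp_rw [Measure.restrict_apply (f.measurableSet_preimage _)] at this
        simpa using this.symm

/-- The reduced Campbell measure of a Poisson point process with intensity `lam` and law `Q` is
`lam.prod Q`. -/
theorem sum_map_prodMk_sumDiracErase [SigmaFinite lam] (hz : ∀ i, Measurable (z i))
    (hN : IsPoissonPointProcess (fun ω => Measure.sum fun i => Measure.dirac (z i ω)) lam μ) :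
    (Measure.sum fun i => μ.map fun ω => (z i ω, sumDiracErase (fun j => z j ω) i)) =
      lam.prod (μ.map fun ω => Measure.sum fun i => Measure.dirac (z i ω)) := by
  have := hN.isProbabilityMeasure
  have hP := Measure.isProbabilityMeasure_map (μ := μ) hN.measurable.aemeasurable
  have hpm : ∀ i, Measurable fun ω => (z i ω, sumDiracErase (fun j => z j ω) i) := fun i =>
    (hz i).prodMk (measurable_sumDiracErase hz i)
  -- For a fixed B of finite intensity both sides are finite measures on the space of measures with
  -- equal Laplace functionals.
  have key : ∀ B, MeasurableSet B → lam B ≠ ∞ →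
      (Measure.sum fun i => (μ.restrict (z i ⁻¹' B)).map
        fun ω => sumDiracErase (fun j => z j ω) i) =
      lam B • μ.map fun ω => Measure.sum fun i => Measure.dirac (z i ω) := by
    intro B hB hfin
    have hL : ∀ f : SimpleFunc X ℕ, ∫⁻ m, expNeg (∫⁻ x, (f x : ℝ≥0∞) ∂m)
        ∂(Measure.sum fun i => (μ.restrict (z i ⁻¹' B)).map
          fun ω => sumDiracErase (fun j => z j ω) i) =
        ∫⁻ m, expNeg (∫⁻ x, (f x : ℝ≥0∞) ∂m)
        ∂(lam B • μ.map fun ω => Measure.sum fun i => Measure.dirac (z i ω)) := by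
      intro f
      have hfm : Measurable fun m : Measure X => expNeg (∫⁻ x, (f x : ℝ≥0∞) ∂m) :=
        measurable_expNeg.comp (Measure.measurable_lintegral
          (measurable_from_top.comp f.measurable))
      rw [lintegral_sum_measure, lintegral_smul_measure, lintegral_map hfm hN.measurable]
      simp_rw [lintegral_map hfm (measurable_sumDiracErase hz _)]
      exact hN.tsum_lintegral_indicator_laplace hz hB hfin f
    have hf1 : IsFiniteMeasure (lam B • μ.map fun ω => Measure.sum fun i =>
        Measure.dirac (z i ω)) := Measure.smul_finite _ hfin
    have hf2 : IsFiniteMeasure (Measure.sum fun i => (μ.restrict (z i ⁻¹' B)).map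
        fun ω => sumDiracErase (fun j => z j ω) i) := by
      refine ⟨?_⟩
      -- The Laplace functional at f = 0 is the total mass.
      have := hL 0
      simp only [SimpleFunc.coe_zero, Pi.zero_apply, Nat.cast_zero, lintegral_zero, expNeg_zero,
        lintegral_one] at this
      rw [this]
      exact measure_lt_top _ _
    exact ext_of_lintegral_expNeg hL
  symm
  refine Measure.prod_eq fun B S hB hS => ?_
  rw [Measure.sum_apply _ (hB.prod hS)]
  have hfinite : ∀ B, MeasurableSet B → lam B ≠ ∞ →
      ∑' i, (μ.map fun ω => (z i ω, sumDiracErase (fun j => z j ω) i)) (B ×ˢ S) =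
      lam B * (μ.map fun ω => Measure.sum fun i => Measure.dirac (z i ω)) S := by
    intro B hB hfin
    have h := congrArg (fun m => m S) (key B hB hfin)
    simp only [Measure.sum_apply _ hS, Measure.smul_apply, smul_eq_mul] at h
    rw [← h]
    refine tsum_congr fun i => ?_
    rw [Measure.map_apply (hpm i) (hB.prod hS),
      Measure.map_apply (measurable_sumDiracErase hz i) hS,
      Measure.restrict_apply (measurable_sumDiracErase hz i hS)]
    congr 1
    ext ω
    simp [and_comm]
  -- By σ-finiteness, a general B is cut into countably many pieces of finite intensity.
  let D := disjointed (spanningSets lam)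
  have hDm : ∀ n, MeasurableSet (D n) :=
    MeasurableSet.disjointed (measurableSet_spanningSets lam)
  have hDd : Pairwise (Function.onFun Disjoint D) := disjoint_disjointed _
  have hDu : ⋃ n, D n = univ := by rw [iUnion_disjointed, iUnion_spanningSets]
  have hBD : ⋃ n, B ∩ D n = B := by rw [← inter_iUnion, hDu, inter_univ]
  have hdB : Pairwise (Function.onFun Disjoint fun n => B ∩ D n) := fun i j hij =>
    (hDd hij).mono inter_subset_right inter_subset_right
  have h1 : ∀ i, (μ.map fun ω => (z i ω, sumDiracErase (fun j => z j ω) i)) (B ×ˢ S) =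
      ∑' n, (μ.map fun ω => (z i ω, sumDiracErase (fun j => z j ω) i)) ((B ∩ D n) ×ˢ S) := by
    intro i
    rw [← measure_iUnion (fun a b hab => Disjoint.set_prod_left (hdB hab) _ _)
      (fun n => (hB.inter (hDm n)).prod hS), ← iUnion_prod_const, hBD]
  simp_rw [h1]
  rw [ENNReal.tsum_comm]
  have h2 : ∀ n, lam (B ∩ D n) ≠ ∞ := fun n =>
    ((measure_mono (inter_subset_right.trans (disjointed_subset _ n))).trans_lt
      (measure_spanningSets_lt_top lam n)).ne
  simp_rw [hfinite _ (hB.inter (hDm _)) (h2 _)]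
  rw [ENNReal.tsum_mul_right, ← measure_iUnion hdB (fun n => hB.inter (hDm n)), hBD]

lemma ae_forall_ne_top (hN : IsPoissonPointProcess N lam μ) {S : ℕ → Set X}
    (hS : ∀ n, MeasurableSet (S n)) (hfin : ∀ n, lam (S n) ≠ ∞) :
    ∀ᵐ ω ∂μ, ∀ n, N ω (S n) ≠ ∞ := by
  refine ae_all_iff.2 fun n => ?_
  have h := hN.lintegral_eval (hS n) (hfin n) (g := ({∞} : Set ℝ≥0∞).indicator 1)
    (measurable_one.indicator (measurableSet_singleton _))
  simp only [mem_singleton_iff, ENNReal.natCast_ne_top, not_false_eq_true, indicator_of_notMem,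
    lintegral_zero] at h
  have hm : Measurable fun ω => ({∞} : Set ℝ≥0∞).indicator (1 : ℝ≥0∞ → ℝ≥0∞) (N ω (S n)) :=
    (measurable_one.indicator (measurableSet_singleton _)).comp
      ((Measure.measurable_coe (hS n)).comp hN.measurable)
  rw [lintegral_eq_zero_iff hm] at h
  filter_upwards [h] with ω hω he
  simp [he] at hω

/-- **Mecke's formula**. As the measures on `X` need not be s-finite, joint measurability of `h` is
required along s-finite kernels only. -/
theorem mecke [SigmaFinite lam] (hz : ∀ i, Measurable (z i))
    (hN : IsPoissonPointProcess (fun ω => Measure.sum fun i => Measure.dirac (z i ω)) lam μ)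
    (h : X → Measure X → ℝ≥0∞)
    (hh : ∀ κ : Kernel (Measure X) X, IsSFiniteKernel κ →
      Measurable fun q : X × Measure X => h q.1 (κ q.2)) :
    ∑' i, ∫⁻ ω, h (z i ω) (sumDiracErase (fun j => z j ω) i) ∂μ =
      ∫⁻ x, ∫⁻ ω, h x (Measure.sum fun i => Measure.dirac (z i ω)) ∂μ ∂lam := by
  have := hN.isProbabilityMeasure
  have hP := Measure.isProbabilityMeasure_map (μ := μ) hN.measurable.aemeasurable
  let D := disjointed (spanningSets lam)
  have hDm : ∀ n, MeasurableSet (D n) :=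
    MeasurableSet.disjointed (measurableSet_spanningSets lam)
  have hDd : Pairwise (Function.onFun Disjoint D) := disjoint_disjointed _
  have hDu : ⋃ n, D n = univ := by rw [iUnion_disjointed, iUnion_spanningSets]
  have hDf : ∀ n, lam (D n) ≠ ∞ := fun n =>
    ((measure_mono (disjointed_subset _ n)).trans_lt (measure_spanningSets_lt_top lam n)).ne
  -- Almost surely N, and with it each erased measure, is finite on every D n. There κ acts as the
  -- identity, so h may be evaluated through κ, where it is jointly measurable.
  let κ := finitePartKernel D hDm
  have hκ := hh κ inferInstance
  have hae := hN.ae_forall_ne_top hDm hDf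
  have h1 : ∀ i, ∫⁻ ω, h (z i ω) (sumDiracErase (fun j => z j ω) i) ∂μ =
      ∫⁻ q, h q.1 (κ q.2) ∂(μ.map fun ω => (z i ω, sumDiracErase (fun j => z j ω) i)) := by
    intro i
    rw [lintegral_map hκ ((hz i).prodMk (measurable_sumDiracErase hz i))]
    refine lintegral_congr_ae ?_
    filter_upwards [hae] with ω hω
    rw [finitePartKernel_apply hDm hDd hDu fun n =>
      ((sumDiracErase_le (fun j => z j ω) i _).trans_lt (hω n).lt_top).ne]
  simp_rw [h1]
  rw [← lintegral_sum_measure, hN.sum_map_prodMk_sumDiracErase hz,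
    MeasureTheory.lintegral_prod _ hκ.aemeasurable]
  refine lintegral_congr fun x => ?_
  have hκx : Measurable fun m => h x (κ m) := hκ.comp measurable_prodMk_left
  rw [lintegral_map hκx hN.measurable]
  refine lintegral_congr_ae ?_
  filter_upwards [hae] with ω hω
  rw [finitePartKernel_apply hDm hDd hDu hω]

/-- **Campbell's formula**. -/
theorem campbell [SigmaFinite lam] (hz : ∀ i, Measurable (z i))
    (hN : IsPoissonPointProcess (fun ω => Measure.sum fun i => Measure.dirac (z i ω)) lam μ)
    {g : X → ℝ≥0∞} (hg : Measurable g) :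
    ∫⁻ ω, ∑' i, g (z i ω) ∂μ = ∫⁻ x, g x ∂lam := by
  have := hN.isProbabilityMeasure
  have hm : ∀ i, Measurable fun ω => g (z i ω) := fun i => hg.comp (hz i)
  rw [lintegral_tsum fun i => (hm i).aemeasurable,
    hN.mecke hz (fun x _ => g x) fun _ _ => hg.comp measurable_fst]
  simp

end Points

lemma tendsto_lintegral_expNeg_spanningSets [SigmaFinite lam]
    (hN : IsPoissonPointProcess N lam μ) {A : Set X} (hA : MeasurableSet A) (c : ℕ) :
    Filter.Tendsto (fun n => ∫⁻ ω, expNeg (c * N ω (A ∩ spanningSets lam n)) ∂μ) Filter.atTop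
      (nhds (∫⁻ ω, expNeg (c * N ω A) ∂μ)) := by
  have hAn : ∀ n, MeasurableSet (A ∩ spanningSets lam n) := fun n =>
    hA.inter (measurableSet_spanningSets lam n)
  have := hN.isProbabilityMeasure
  refine tendsto_lintegral_of_dominated_convergence (fun _ => 1)
    (fun n => measurable_expNeg.comp
      (((Measure.measurable_coe (hAn n)).comp hN.measurable).const_mul _))
    (fun n => Filter.Eventually.of_forall fun ω => expNeg_le_one _) (by simp)
    (Filter.Eventually.of_forall fun ω => ?_)
  refine (continuous_expNeg.tendsto _).comp
    (ENNReal.Tendsto.const_mul ?_ (Or.inr (ENNReal.natCast_ne_top c)))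
  have := tendsto_measure_iUnion_atTop (μ := N ω) (s := fun n => A ∩ spanningSets lam n)
    (fun i j hij => inter_subset_inter_right _ (monotone_spanningSets lam hij))
  rwa [← inter_iUnion, iUnion_spanningSets, inter_univ] at this

/-- The law of a count is prescribed for finite intensity only. A set of infinite intensity is
exhausted by finite ones, along which the Laplace transforms converge. -/
lemma lintegral_expNeg_eval_congr {Ω' : Type*} [MeasurableSpace Ω'] {μ' : Measure Ω'}
    {N' : Ω' → Measure X} [SigmaFinite lam]
    (hN : IsPoissonPointProcess N lam μ) (hN' : IsPoissonPointProcess N' lam μ')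
    {A : Set X} (hA : MeasurableSet A) (c : ℕ) :
    ∫⁻ ω, expNeg (c * N ω A) ∂μ = ∫⁻ ω, expNeg (c * N' ω A) ∂μ' := by
  have hAn : ∀ n, MeasurableSet (A ∩ spanningSets lam n) := fun n =>
    hA.inter (measurableSet_spanningSets lam n)
  refine tendsto_nhds_unique (hN.tendsto_lintegral_expNeg_spanningSets hA c)
    ((hN'.tendsto_lintegral_expNeg_spanningSets hA c).congr fun n => ?_)
  have hfin : lam (A ∩ spanningSets lam n) ≠ ∞ :=
    ((measure_mono inter_subset_right).trans_lt (measure_spanningSets_lt_top lam n)).ne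
  rw [hN.lintegral_eval (hAn n) hfin (g := fun x => expNeg (c * x)) (by fun_prop),
    hN'.lintegral_eval (hAn n) hfin (g := fun x => expNeg (c * x)) (by fun_prop)]

/-- The law of a Poisson point process is determined by its intensity. -/
theorem map_eq_map {Ω' : Type*} [MeasurableSpace Ω'] {μ' : Measure Ω'}
    {N' : Ω' → Measure X} [SigmaFinite lam]
    (hN : IsPoissonPointProcess N lam μ) (hN' : IsPoissonPointProcess N' lam μ') :
    μ.map N = μ'.map N' := by
  have := hN.isProbabilityMeasure
  have := hN'.isProbabilityMeasure
  refine ext_of_lintegral_expNeg fun f => ?_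
  have hfm : Measurable fun m : Measure X => expNeg (∫⁻ x, (f x : ℝ≥0∞) ∂m) :=
    measurable_expNeg.comp (Measure.measurable_lintegral
      (measurable_from_top.comp f.measurable))
  rw [lintegral_map hfm hN.measurable, lintegral_map hfm hN'.measurable]
  have hd : Pairwise (fun k l : f.range => Disjoint (f ⁻¹' {k.1}) (f ⁻¹' {l.1})) := by
    intro k l hkl
    refine Disjoint.preimage _ (disjoint_singleton.2 fun h => ?_)
    exact hkl (Subtype.ext h)
  have hE : ∀ m : Measure X, expNeg (∫⁻ x, (f x : ℝ≥0∞) ∂m) =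
      ∏ v : f.range, expNeg (v.1 * m (f ⁻¹' {v.1})) := fun m => by
    rw [lintegral_simpleFunc_nat f (fun n => (n : ℝ≥0∞)), ← Finset.sum_coe_sort, expNeg_sum]
  simp_rw [hE]
  rw [hN.lintegral_prod (fun k => f.measurableSet_preimage _) hd
      (g := fun v x => expNeg (v.1 * x)) (fun _ => by fun_prop),
    hN'.lintegral_prod (fun k => f.measurableSet_preimage _) hd
      (g := fun v x => expNeg (v.1 * x)) (fun _ => by fun_prop)]
  exact Finset.prod_congr rfl fun v _ =>
    lintegral_expNeg_eval_congr hN hN' (f.measurableSet_preimage _) _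

/-- Restriction and mapping of a Poisson point process. -/
theorem restrict_map {Y : Type*} [MeasurableSpace Y] (hN : IsPoissonPointProcess N lam μ)
    {S : Set X} (hS : MeasurableSet S) {φ : X → Y} (hφ : Measurable φ) :
    IsPoissonPointProcess (fun ω => ((N ω).restrict S).map φ) ((lam.restrict S).map φ) μ := by
  have h : ∀ (m : Measure X) {A : Set Y}, MeasurableSet A →
      ((m.restrict S).map φ) A = m (φ ⁻¹' A ∩ S) := fun m A hA => by
    rw [Measure.map_apply hφ hA, Measure.restrict_apply (hφ hA)]
  refine ⟨?_, fun A hA hfin => ?_, fun n A hA hd => ?_⟩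
  · refine Measure.measurable_of_measurable_coe _ fun A hA => ?_
    simp_rw [h _ hA]
    exact (Measure.measurable_coe ((hφ hA).inter hS)).comp hN.measurable
  · simp_rw [h _ hA] at hfin ⊢
    exact hN.poisson _ ((hφ hA).inter hS) hfin
  · simp_rw [h _ (hA _)]
    exact hN.indep n _ (fun k => (hφ (hA k)).inter hS) fun k l hkl =>
      ((hd hkl).preimage φ).mono inter_subset_left inter_subset_left

end IsPoissonPointProcess

/-! ### The stable Lévy measure: self-similarity, Pareto tails, change of variables -/

section StableLevyMeasure

variable {α K : ℝ}

lemma measurable_stableDensity (α K : ℝ) :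
    Measurable fun u : ℝ => ENNReal.ofReal (K * α * u ^ (-(α + 1))) := by
  fun_prop

instance sigmaFinite_stableLevyMeasure (α K : ℝ) : SigmaFinite (stableLevyMeasure α K) := by
  unfold stableLevyMeasure
  exact SigmaFinite.withDensity_ofReal _

lemma lintegral_stableLevyMeasure (α K : ℝ) {f : ℝ → ℝ≥0∞} (hf : Measurable f) :
    ∫⁻ u, f u ∂(stableLevyMeasure α K) =
      ∫⁻ u in Ioi 0, ENNReal.ofReal (K * α * u ^ (-(α + 1))) * f u := by
  rw [stableLevyMeasure, lintegral_withDensity_eq_lintegral_mul _ (measurable_stableDensity α K) hf]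
  rfl

lemma stableLevyMeasure_Iic (α K : ℝ) : stableLevyMeasure α K (Iic 0) = 0 := by
  rw [stableLevyMeasure, withDensity_apply _ measurableSet_Iic,
    Measure.restrict_restrict measurableSet_Iic, inter_comm, Ioi_inter_Iic, Ioc_self]
  simp

lemma stableLevyMeasure_const_mul (α : ℝ) {a K : ℝ} (ha : 0 ≤ a) :
    stableLevyMeasure α (a * K) = ENNReal.ofReal a • stableLevyMeasure α K := by
  rw [stableLevyMeasure, stableLevyMeasure,
    ← withDensity_smul _ (measurable_stableDensity α K)]
  congr 1
  ext u
  rw [Pi.smul_apply, smul_eq_mul, ← ENNReal.ofReal_mul ha]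
  congr 1
  ring

/-- The density is homogeneous of degree -(α + 1) and du of degree 1, which leaves the factor w ^ α.
-/
lemma map_mul_stableLevyMeasure (hα : 0 < α) (K : ℝ) {w : ℝ} (hw : 0 < w) :
    (stableLevyMeasure α K).map (fun u => w * u) = stableLevyMeasure α (w ^ α * K) := by
  have hm : Measurable fun u : ℝ => w * u := measurable_const_mul w
  ext A hA
  have hi : Measurable (A.indicator (1 : ℝ → ℝ≥0∞)) := measurable_one.indicator hA
  have h1 : ∀ m : Measure ℝ, m A = ∫⁻ x, A.indicator (1 : ℝ → ℝ≥0∞) x ∂m := fun m => by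
    rw [lintegral_indicator_one hA]
  have hiw : Measurable fun u => A.indicator (1 : ℝ → ℝ≥0∞) (w * u) := hi.comp hm
  rw [h1, h1, lintegral_map hi hm, lintegral_stableLevyMeasure _ _ hiw,
    lintegral_stableLevyMeasure _ _ hi]
  have himg : (fun u : ℝ => w * u) '' Ioi 0 = Ioi 0 := by
    rw [image_mul_left_Ioi hw, mul_zero]
  conv_rhs => rw [← himg]
  rw [lintegral_image_eq_lintegral_abs_deriv_mul measurableSet_Ioi
    (f' := fun _ => w) (fun x _ => by simpa using ((hasDerivAt_id x).const_mul w).hasDerivWithinAt)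
    (fun x _ y _ h => mul_left_cancel₀ hw.ne' h)]
  refine setLIntegral_congr_fun measurableSet_Ioi fun u hu => ?_
  have hu : 0 < u := hu
  rw [← mul_assoc, ← ENNReal.ofReal_mul (abs_nonneg _), abs_of_pos hw,
    Real.mul_rpow hw.le hu.le, Real.rpow_neg hw.le (α + 1), Real.rpow_add hw, Real.rpow_one]
  congr 2
  have := Real.rpow_pos_of_pos hw α
  field_simp

/-- Substitute q = y u^(-1/α): a jump conditioned to exceed y has a Pareto law, and the prefactor is
the tail at y. The uniform variable of the overshoot originates here. -/
lemma setLIntegral_Ioi_stableLevyMeasure (hα : 0 < α) (hK : 0 < K) {y : ℝ} (hy : 0 < y)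
    {φ : ℝ → ℝ≥0∞} (hφ : Measurable φ) :
    ∫⁻ q, (Ioi y).indicator φ q ∂(stableLevyMeasure α K) =
      ENNReal.ofReal (K * y ^ (-α)) * ∫⁻ u in Ioo (0 : ℝ) 1, φ (y * (1 / u ^ (1 / α))) := by
  have hi := hφ.indicator (measurableSet_Ioi (a := y))
  rw [lintegral_stableLevyMeasure _ _ hi]
  have h1 : ∀ u, ENNReal.ofReal (K * α * u ^ (-(α + 1))) * (Ioi y).indicator φ u =
      (Ioi y).indicator (fun u => ENNReal.ofReal (K * α * u ^ (-(α + 1))) * φ u) u := fun u => by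
    by_cases hu : u ∈ Ioi y
    · rw [indicator_of_mem hu, indicator_of_mem hu]
    · rw [indicator_of_notMem hu, indicator_of_notMem hu, mul_zero]
  simp_rw [h1]
  rw [setLIntegral_indicator measurableSet_Ioi, inter_eq_left.2 (Ioi_subset_Ioi hy.le)]
  have himg : (fun u : ℝ => y * u ^ (-(1 / α))) '' Ioo 0 1 = Ioi y := by
    ext q
    constructor
    · rintro ⟨u, ⟨hu0, hu1⟩, rfl⟩
      have : 1 < u ^ (-(1 / α)) :=
        Real.one_lt_rpow_of_pos_of_lt_one_of_neg hu0 hu1 (by simpa using hα)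
      simpa using (mul_lt_mul_of_pos_left this hy)
    · intro hq
      have hq : y < q := hq
      have hq0 : 0 < q := hy.trans hq
      refine ⟨(q / y) ^ (-α), ⟨Real.rpow_pos_of_pos (div_pos hq0 hy) _,
        Real.rpow_lt_one_of_one_lt_of_neg ((one_lt_div hy).2 hq) (by simpa using hα)⟩, ?_⟩
      simp only
      rw [← Real.rpow_mul (div_pos hq0 hy).le, neg_mul_neg, mul_one_div_cancel hα.ne',
        Real.rpow_one, mul_div_cancel₀ _ hy.ne']
  rw [← himg, lintegral_image_eq_lintegral_abs_deriv_mul measurableSet_Ioo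
    (f' := fun u => y * (-(1 / α) * u ^ (-(1 / α) - 1)))
    (fun u hu => ((Real.hasDerivAt_rpow_const (Or.inl hu.1.ne')).const_mul y).hasDerivWithinAt)
    (fun u hu v hv h => Real.rpow_left_injOn (neg_ne_zero.2 (one_div_pos.2 hα).ne')
      (show 0 ≤ u from hu.1.le) (show 0 ≤ v from hv.1.le) (mul_left_cancel₀ hy.ne' h)),
    ← lintegral_const_mul' _ _ ENNReal.ofReal_ne_top]
  refine setLIntegral_congr_fun measurableSet_Ioo fun u hu => ?_
  have hu0 : 0 < u := hu.1
  have hp : 0 < u ^ (-(1 / α)) := Real.rpow_pos_of_pos hu0 _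
  have habs : |y * (-(1 / α) * u ^ (-(1 / α) - 1))| = y * ((1 / α) * u ^ (-(1 / α) - 1)) := by
    rw [neg_mul, mul_neg, abs_neg, abs_of_pos]
    positivity
  rw [habs, ← mul_assoc, ← ENNReal.ofReal_mul (by positivity)]
  have harg : y * u ^ (-(1 / α)) = y * (1 / u ^ (1 / α)) := by
    rw [Real.rpow_neg hu0.le, one_div (u ^ (1 / α))]
  congr 1
  · congr 1
    rw [Real.mul_rpow hy.le hp.le, ← Real.rpow_mul hu0.le]
    have e1 : -(1 / α) * -(α + 1) = 1 + 1 / α := by field_simp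
    have e2 : -(1 / α) - 1 = -(1 + 1 / α) := by ring
    have e3 : -(α + 1) = -α - 1 := by ring
    rw [e1, e2, Real.rpow_neg hu0.le, e3, Real.rpow_sub_one hy.ne']
    have := (Real.rpow_pos_of_pos hu0 (1 + 1 / α)).ne'
    field_simp
  · rw [harg]

lemma stableLevyMeasure_Ioi (hα : 0 < α) (hK : 0 < K) {y : ℝ} (hy : 0 < y) :
    stableLevyMeasure α K (Ioi y) = ENNReal.ofReal (K * y ^ (-α)) := by
  rw [← lintegral_indicator_one measurableSet_Ioi]
  have := setLIntegral_Ioi_stableLevyMeasure hα hK hy (φ := 1) measurable_one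
  rw [this]
  simp

lemma stableLevyMeasure_Ioi_zero (hα : 0 < α) (hK : 0 < K) :
    stableLevyMeasure α K (Ioi 0) = ∞ := by
  refine ENNReal.eq_top_of_forall_nnreal_le fun r => ?_
  -- Chosen so that the tail K y^(-α) equals r + 1.
  let y : ℝ := ((r + 1) / K) ^ (-(1 / α))
  have hr : (0 : ℝ) < (r + 1) / K := by positivity
  have hy : 0 < y := Real.rpow_pos_of_pos hr _
  refine le_trans ?_ (measure_mono (Ioi_subset_Ioi hy.le))
  rw [stableLevyMeasure_Ioi hα hK hy]
  have : y ^ (-α) = (r + 1) / K := by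
    simp only [y]
    rw [← Real.rpow_mul hr.le, neg_mul_neg, one_div_mul_cancel hα.ne', Real.rpow_one]
  rw [this, mul_div_cancel₀ _ hK.ne', ← ENNReal.ofReal_coe_nnreal]
  exact ENNReal.ofReal_le_ofReal (by linarith)

/-- Near 0 the integrand is a multiple of u^(-α), which is integrable because α < 1. On (1, ∞) the
tail bounds it. -/
lemma lintegral_min_one_stableLevyMeasure_ne_top (hα₀ : 0 < α) (hα₁ : α < 1) (hK : 0 < K) :
    ∫⁻ u, ENNReal.ofReal (min u 1) ∂(stableLevyMeasure α K) ≠ ∞ := by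
  rw [← lintegral_add_compl _ (measurableSet_Ioi (a := (1 : ℝ)))]
  refine ENNReal.add_ne_top.2 ⟨?_, ?_⟩
  · have : ∫⁻ u in Ioi (1 : ℝ), ENNReal.ofReal (min u 1) ∂(stableLevyMeasure α K) ≤
        stableLevyMeasure α K (Ioi 1) := by
      rw [← setLIntegral_one]
      refine lintegral_mono fun u => ?_
      exact (ENNReal.ofReal_le_ofReal (min_le_right _ _)).trans ENNReal.ofReal_one.le
    refine (this.trans_lt ?_).ne
    rw [stableLevyMeasure_Ioi hα₀ hK one_pos]
    exact ENNReal.ofReal_lt_top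
  · rw [compl_Ioi, ← lintegral_indicator measurableSet_Iic,
      lintegral_stableLevyMeasure _ _ (Measurable.indicator (by fun_prop) measurableSet_Iic)]
    have h1 : ∀ u, ENNReal.ofReal (K * α * u ^ (-(α + 1))) *
        (Iic 1).indicator (fun u => ENNReal.ofReal (min u 1)) u =
        (Iic 1).indicator (fun u => ENNReal.ofReal (K * α * u ^ (-(α + 1))) *
          ENNReal.ofReal (min u 1)) u := fun u => by
      by_cases hu : u ∈ Iic (1 : ℝ)
      · rw [indicator_of_mem hu, indicator_of_mem hu]
      · rw [indicator_of_notMem hu, indicator_of_notMem hu, mul_zero]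
    simp_rw [h1]
    rw [setLIntegral_indicator measurableSet_Iic, inter_comm, Ioi_inter_Iic]
    have hint : IntegrableOn (fun u : ℝ => K * α * u ^ (-α)) (Ioc 0 1) := by
      have := (intervalIntegral.intervalIntegrable_rpow' (a := 0) (b := 1) (r := -α)
        (by linarith)).const_mul (K * α)
      rwa [intervalIntegrable_iff_integrableOn_Ioc_of_le zero_le_one] at this
    refine (lt_of_le_of_lt (le_of_eq ?_) hint.lintegral_lt_top).ne
    refine setLIntegral_congr_fun measurableSet_Ioc fun u hu => ?_
    have hu0 : 0 < u := hu.1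
    rw [min_eq_left hu.2, ← ENNReal.ofReal_mul (by positivity)]
    congr 1
    rw [show -(α + 1) = -α - 1 by ring, Real.rpow_sub_one hu0.ne']
    field_simp

/-- Change of variables `t = (κ / K) * (x / (τ + p)) ^ α`. -/
lemma lintegral_level_change_of_variables (hα : 0 < α) (hK : 0 < K) {κ : ℝ} (hκ : 0 < κ)
    {x τ : ℝ} (hx : 0 < x) (hτ : 0 < τ) {h : ℝ → ℝ≥0∞} (hh : Measurable h) :
    ∫⁻ t in Ioi 0, {t : ℝ | (K * t / κ) ^ (1 / α) * τ < x}.indicator (fun t =>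
        ENNReal.ofReal (K * (x - (K * t / κ) ^ (1 / α) * τ) ^ (-α)) *
          h ((K * t / κ) ^ (1 / α) / x)) t =
      ∫⁻ p, ENNReal.ofReal (p / (τ + p)) * h (1 / (τ + p)) ∂(stableLevyMeasure α κ) := by
  have hw : Measurable fun t : ℝ => (K * t / κ) ^ (1 / α) := by fun_prop
  have hS : MeasurableSet {t : ℝ | (K * t / κ) ^ (1 / α) * τ < x} :=
    measurableSet_lt (hw.mul_const _) measurable_const
  rw [setLIntegral_indicator hS, lintegral_stableLevyMeasure _ _ (by fun_prop)]
  -- With w(t) = (K t / κ)^(1/α), this solves w(f p) = x / (τ + p).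
  let f : ℝ → ℝ := fun p => κ / K * (x / (τ + p)) ^ α
  have hwf : ∀ p, 0 < p → (K * f p / κ) ^ (1 / α) = x / (τ + p) := by
    intro p hp
    have h0 : 0 < x / (τ + p) := by positivity
    have : K * f p / κ = (x / (τ + p)) ^ α := by
      simp only [f]
      field_simp
    rw [this, ← Real.rpow_mul h0.le, mul_one_div_cancel hα.ne', Real.rpow_one]
  -- The constraint w τ < x corresponds exactly to p > 0.
  have himg : f '' Ioi 0 = {t : ℝ | (K * t / κ) ^ (1 / α) * τ < x} ∩ Ioi 0 := by
    ext t
    constructor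
    · rintro ⟨p, hp, rfl⟩
      have hp : 0 < p := hp
      refine ⟨?_, by simp only [f, mem_Ioi]; positivity⟩
      change _ * τ < x
      rw [hwf p hp, div_mul_eq_mul_div, div_lt_iff₀ (by positivity)]
      nlinarith
    · rintro ⟨ht, ht0⟩
      have ht0 : 0 < t := ht0
      have ht : (K * t / κ) ^ (1 / α) * τ < x := ht
      have hb : 0 < K * t / κ := by positivity
      have hw0 : 0 < (K * t / κ) ^ (1 / α) := Real.rpow_pos_of_pos hb _
      refine ⟨x / (K * t / κ) ^ (1 / α) - τ, ?_, ?_⟩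
      · rw [mem_Ioi, sub_pos, lt_div_iff₀ hw0]
        linarith
      · change κ / K * (x / (τ + (x / (K * t / κ) ^ (1 / α) - τ))) ^ α = t
        rw [add_sub_cancel, div_div_cancel₀ hx.ne', ← Real.rpow_mul hb.le,
          one_div_mul_cancel hα.ne', Real.rpow_one]
        field_simp
  have hder : ∀ p ∈ Ioi (0 : ℝ), HasDerivWithinAt f
      (κ / K * (-(x / (τ + p) ^ 2) * α * (x / (τ + p)) ^ (α - 1))) (Ioi 0) p := by
    intro p hp
    have hp : 0 < p := hp
    have h0 : x / (τ + p) ≠ 0 := by positivity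
    have h1 : HasDerivAt (fun p => x / (τ + p)) (-(x / (τ + p) ^ 2)) p := by
      have := (hasDerivAt_const p x).div ((hasDerivAt_id p).const_add τ) (by simp; positivity)
      refine this.congr_deriv ?_
      simp [neg_div]
    exact ((h1.rpow_const (Or.inl h0)).const_mul _).hasDerivWithinAt
  have hinj : InjOn f (Ioi 0) := by
    intro p hp q hq hpq
    have hp : 0 < p := hp
    have hq : 0 < q := hq
    have h1 := hwf p hp
    rw [hpq, hwf q hq] at h1
    rw [div_eq_div_iff (by positivity) (by positivity)] at h1
    have := mul_left_cancel₀ hx.ne' h1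
    linarith
  rw [← himg, lintegral_image_eq_lintegral_abs_deriv_mul measurableSet_Ioi hder hinj]
  refine setLIntegral_congr_fun measurableSet_Ioi fun p hp => ?_
  have hp : 0 < p := hp
  have hτp : 0 < τ + p := by positivity
  rw [hwf p hp, ← mul_assoc (ENNReal.ofReal _), ← mul_assoc (ENNReal.ofReal _),
    ← ENNReal.ofReal_mul (abs_nonneg _), ← ENNReal.ofReal_mul (by positivity)]
  rw [show x / (τ + p) / x = 1 / (τ + p) by field_simp]
  congr 2
  · have habs : |κ / K * (-(x / (τ + p) ^ 2) * α * (x / (τ + p)) ^ (α - 1))| =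
        κ / K * ((x / (τ + p) ^ 2) * α * (x / (τ + p)) ^ (α - 1)) := by
      rw [neg_mul, neg_mul, mul_neg, abs_neg, abs_of_pos]
      positivity
    -- The tail K (x - w τ)^(-α) times the Jacobian |f' p| equals κ α p^(-(α + 1)) p / (τ + p): all
    -- powers of x / (τ + p) collapse and x cancels.
    have hsub : x - x / (τ + p) * τ = x / (τ + p) * p := by field_simp; ring
    rw [habs, hsub, Real.mul_rpow (by positivity) hp.le,
      Real.rpow_neg (by positivity : 0 ≤ x / (τ + p)),
      Real.rpow_sub_one (by positivity), show -(α + 1) = -α - 1 by ring, Real.rpow_sub_one hp.ne']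
    have := (Real.rpow_pos_of_pos (by positivity : 0 < x / (τ + p)) α).ne'
    field_simp

end StableLevyMeasure

/-! ### Measurability of integrals and images along s-finite kernels -/

section KernelMeasurability

variable {A X Y : Type*} [MeasurableSpace A] [MeasurableSpace X] [MeasurableSpace Y]

lemma measurable_restrict_map_kernel (κ : Kernel A X) [IsSFiniteKernel κ] {D : A → Set X}
    (hD : MeasurableSet {q : A × X | q.2 ∈ D q.1}) {F : A → X → Y}
    (hF : Measurable fun q : A × X => F q.1 q.2) :
    Measurable fun a => ((κ a).restrict (D a)).map (F a) := by
  refine Measure.measurable_of_measurable_coe _ fun s hs => ?_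
  have h : ∀ a, ((κ a).restrict (D a)).map (F a) s =
      κ a (Prod.mk a ⁻¹' ((fun q : A × X => F q.1 q.2) ⁻¹' s ∩ {q : A × X | q.2 ∈ D q.1})) := by
    intro a
    have hFa : Measurable (F a) := hF.comp measurable_prodMk_left
    rw [Measure.map_apply hFa hs, Measure.restrict_apply (hFa hs)]
    rfl
  simp_rw [h]
  exact Kernel.measurable_kernel_prodMk_left ((hF hs).inter hD)

lemma measurable_setLIntegral_kernel (κ : Kernel A X) [IsSFiniteKernel κ] {D : A → Set X}
    (hD : MeasurableSet {q : A × X | q.2 ∈ D q.1}) {g : A → X → ℝ≥0∞}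
    (hg : Measurable fun q : A × X => g q.1 q.2) :
    Measurable fun a => ∫⁻ x in D a, g a x ∂(κ a) := by
  have h : ∀ a, ∫⁻ x in D a, g a x ∂(κ a) =
      ∫⁻ x, {q : A × X | q.2 ∈ D q.1}.indicator (fun q => g q.1 q.2) (a, x) ∂(κ a) := by
    intro a
    have hDa : MeasurableSet (D a) := measurable_prodMk_left hD
    rw [← lintegral_indicator hDa]
    rfl
  simp_rw [h]
  exact (hg.indicator hD).lintegral_kernel_prod_right'

end KernelMeasurability

/-! ### Sets of infinite intensity -/

namespace IsPoissonPointProcess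

variable {Ω X : Type*} [MeasurableSpace Ω] [MeasurableSpace X] {N : Ω → Measure X}
  {lam : Measure X} {μ : Measure Ω}

lemma mul_expNeg_le_one (x : ℝ≥0∞) : x * expNeg x ≤ 1 := by
  rcases eq_or_ne x ∞ with rfl | hx
  · simp [expNeg_top]
  · rw [← ENNReal.ofReal_toReal hx, expNeg_ofReal ENNReal.toReal_nonneg,
      ← ENNReal.ofReal_mul ENNReal.toReal_nonneg, ENNReal.ofReal_le_one, Real.exp_neg,
      ← div_eq_mul_inv, div_le_one (Real.exp_pos _)]
    linarith [Real.add_one_le_exp x.toReal]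

/-- Since x exp (-x) ≤ 1, the identity E[N(A) exp (-N(A))] = lam(A) exp (-1) E[exp (-N(A))] bounds
lam(A) E[exp (-N(S))] uniformly over the A ⊆ S of finite intensity used here. Letting A increase to
S forces E[exp (-N(S))] = 0. -/
lemma ae_eq_top [SigmaFinite lam] (hN : IsPoissonPointProcess N lam μ) {S : Set X}
    (hS : MeasurableSet S) (hinf : lam S = ∞) : ∀ᵐ ω ∂μ, N ω S = ∞ := by
  have := hN.isProbabilityMeasure
  have hm : Measurable fun ω => expNeg (N ω S) :=
    measurable_expNeg.comp ((Measure.measurable_coe hS).comp hN.measurable)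
  have hbd : ∀ n, lam (S ∩ spanningSets lam n) * (expNeg 1 * ∫⁻ ω, expNeg (N ω S) ∂μ) ≤ 1 := by
    intro n
    have hA : MeasurableSet (S ∩ spanningSets lam n) :=
      hS.inter (measurableSet_spanningSets lam n)
    have hfin : lam (S ∩ spanningSets lam n) ≠ ∞ :=
      ((measure_mono inter_subset_right).trans_lt (measure_spanningSets_lt_top lam n)).ne
    have h := hN.lintegral_eval_mul_expNeg hA hfin 1
    simp only [Nat.cast_one, one_mul] at h
    calc _ ≤ lam (S ∩ spanningSets lam n) *
        (expNeg 1 * ∫⁻ ω, expNeg (N ω (S ∩ spanningSets lam n)) ∂μ) := by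
          gcongr
          exact expNeg_strictAnti.antitone (measure_mono inter_subset_left)
      _ = ∫⁻ ω, N ω (S ∩ spanningSets lam n) * expNeg (N ω (S ∩ spanningSets lam n)) ∂μ := by
          rw [h, mul_assoc]
      _ ≤ ∫⁻ ω, 1 ∂μ := lintegral_mono fun ω => mul_expNeg_le_one _
      _ = 1 := by simp
  have hpos : expNeg 1 ≠ 0 := fun h => by
    rw [← expNeg_top] at h
    exact ENNReal.one_ne_top (expNeg_strictAnti.injective h)
  have hzero : ∫⁻ ω, expNeg (N ω S) ∂μ = 0 := by
    by_contra hne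
    have hc : expNeg 1 * ∫⁻ ω, expNeg (N ω S) ∂μ ≠ 0 := mul_ne_zero hpos hne
    have hlim := tendsto_measure_iUnion_atTop (μ := lam) (s := fun n => S ∩ spanningSets lam n)
      (fun i j hij => inter_subset_inter_right _ (monotone_spanningSets lam hij))
    rw [← inter_iUnion, iUnion_spanningSets, inter_univ, hinf] at hlim
    have hlim' := ENNReal.Tendsto.mul_const hlim
      (Or.inl ENNReal.top_ne_zero) (b := expNeg 1 * ∫⁻ ω, expNeg (N ω S) ∂μ)
    rw [ENNReal.top_mul hc] at hlim'
    exact absurd (le_of_tendsto' hlim' hbd) (by simp)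
  rw [lintegral_eq_zero_iff hm] at hzero
  filter_upwards [hzero] with ω hω
  exact expNeg_strictAnti.injective (hω.trans expNeg_top.symm)

end IsPoissonPointProcess

/-! ### Almost sure properties of the jumps -/

/-- Times `t i` and sizes `p i` of the jumps of a strictly increasing pure jump path. -/
structure IsJumpSequence (t p : ℕ → ℝ) : Prop where
  time_pos : ∀ i, 0 < t i
  jump_pos : ∀ i, 0 < p i
  injective : Function.Injective t
  tsum_ne_top : ∀ s : ℝ, ∑' i, (if t i ≤ s then ENNReal.ofReal (p i) else 0) ≠ ∞
  infinite : ∀ s > 0, {i | t i ≤ s}.Infinite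

namespace IsStableJumpProcess

variable {Ω : Type*} [MeasurableSpace Ω] {μ : Measure Ω} {α K : ℝ} {T P : ℕ → Ω → ℝ}

lemma measurable_point (hN : IsStableJumpProcess α K T P μ) (i : ℕ) :
    Measurable fun ω => (T i ω, P i ω) :=
  (hN.measurable_time i).prodMk (hN.measurable_jump i)

lemma ae_pos (hN : IsStableJumpProcess α K T P μ) :
    ∀ᵐ ω ∂μ, ∀ i, 0 < T i ω ∧ 0 < P i ω := by
  have hS : MeasurableSet ((Ioi (0 : ℝ) ×ˢ Ioi (0 : ℝ))ᶜ) :=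
    (measurableSet_Ioi.prod measurableSet_Ioi).compl
  have hm : Measurable (((Ioi (0 : ℝ) ×ˢ Ioi (0 : ℝ))ᶜ).indicator (1 : ℝ × ℝ → ℝ≥0∞)) :=
    measurable_one.indicator hS
  have h := hN.poisson.campbell hN.measurable_point hm
  have h0 : ((volume.restrict (Ioi (0 : ℝ))).prod (stableLevyMeasure α K))
      ((Ioi (0 : ℝ) ×ˢ Ioi (0 : ℝ))ᶜ) = 0 := by
    refine measure_mono_null (t := Iic 0 ×ˢ univ ∪ univ ×ˢ Iic 0) ?_ ?_
    · rintro ⟨a, b⟩ hab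
      simp only [mem_compl_iff, mem_prod, mem_Ioi, not_and_or, not_lt] at hab
      simpa using hab
    · refine measure_union_null ?_ ?_
      · rw [Measure.prod_prod, Measure.restrict_apply measurableSet_Iic, inter_comm, Ioi_inter_Iic]
        simp
      · rw [Measure.prod_prod, stableLevyMeasure_Iic, mul_zero]
  have hsm : Measurable fun ω => ∑' i, ((Ioi (0 : ℝ) ×ˢ Ioi (0 : ℝ))ᶜ).indicator
      (1 : ℝ × ℝ → ℝ≥0∞) (T i ω, P i ω) :=
    Measurable.tsum fun i => hm.comp (hN.measurable_point i)
  rw [lintegral_indicator_one hS, h0, lintegral_eq_zero_iff hsm] at h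
  filter_upwards [h] with ω hω i
  have := ENNReal.tsum_eq_zero.1 hω i
  by_contra hcon
  rw [indicator_of_mem (by simpa [not_and_or] using hcon)] at this
  simp at this

/-- By Mecke's formula the expected number of pairs of distinct indices sharing a time is the
integral of E[N({t} × ℝ)], which vanishes because Lebesgue measure has no atoms. -/
lemma ae_injective (hN : IsStableJumpProcess α K T P μ) :
    ∀ᵐ ω ∂μ, Function.Injective fun i => T i ω := by
  have := hN.poisson.isProbabilityMeasure
  have hms : MeasurableSet {q : ((ℝ × ℝ) × Measure (ℝ × ℝ)) × ℝ × ℝ | q.2.1 = q.1.1.1} :=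
    measurableSet_eq_fun (by fun_prop) (by fun_prop)
  have h := hN.poisson.mecke hN.measurable_point
    (fun z m => m {y | y.1 = z.1}) fun κ hκ =>
      Kernel.measurable_kernel_prodMk_left (κ := κ.comap Prod.snd measurable_snd) hms
  have hz : ∀ x : ℝ, MeasurableSet {y : ℝ × ℝ | y.1 = x} := fun x =>
    measurableSet_eq_fun measurable_fst measurable_const
  have h0 : ∀ x : ℝ, ∫⁻ ω, (Measure.sum fun i => Measure.dirac (T i ω, P i ω))
      {y : ℝ × ℝ | y.1 = x} ∂μ = 0 := by
    intro x
    have hc := hN.poisson.campbell hN.measurable_point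
      (measurable_one.indicator (hz x) : Measurable ({y : ℝ × ℝ | y.1 = x}.indicator 1))
    rw [lintegral_indicator_one (hz x)] at hc
    have : {y : ℝ × ℝ | y.1 = x} = {x} ×ˢ univ := by ext; simp
    rw [this, Measure.prod_prod, Measure.restrict_apply (measurableSet_singleton _)] at hc
    rw [measure_mono_null inter_subset_left (by simp), zero_mul, ← this] at hc
    rw [← hc]
    refine lintegral_congr fun ω => ?_
    rw [Measure.sum_apply _ (hz x)]
    exact tsum_congr fun i => by rw [Measure.dirac_apply' _ (hz x)]
  simp_rw [h0] at h
  rw [lintegral_zero, ENNReal.tsum_eq_zero] at h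
  have h1 : ∀ᵐ ω ∂μ, ∀ i, sumDiracErase (fun j => (T j ω, P j ω)) i
      {y : ℝ × ℝ | y.1 = T i ω} = 0 := by
    refine ae_all_iff.2 fun i => ?_
    have hmi : ∀ j, Measurable fun ω => (if j = i then (0 : Measure (ℝ × ℝ)) else
        Measure.dirac (T j ω, P j ω)) {y : ℝ × ℝ | y.1 = T i ω} := by
      intro j
      by_cases hj : j = i
      · simp [hj]
      · have : ∀ ω, Measure.dirac (T j ω, P j ω) {y : ℝ × ℝ | y.1 = T i ω} =
            {ω | T j ω = T i ω}.indicator 1 ω := fun ω => by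
          rw [Measure.dirac_apply' _ (hz _)]
          rfl
        simp only [hj, if_false, this]
        exact measurable_one.indicator
          (measurableSet_eq_fun (hN.measurable_time j) (hN.measurable_time i))
    have hmm : Measurable fun ω => sumDiracErase (fun j => (T j ω, P j ω)) i
        {y : ℝ × ℝ | y.1 = T i ω} := by
      simp_rw [sumDiracErase, Measure.sum_apply _ (hz _)]
      exact Measurable.tsum hmi
    exact (lintegral_eq_zero_iff hmm).1 (h i)
  filter_upwards [h1] with ω hω i j hij
  by_contra hne
  have := hω j
  rw [sumDiracErase, Measure.sum_apply _ (hz _), ENNReal.tsum_eq_zero] at this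
  have := this i
  rw [if_neg hne, Measure.dirac_apply' _ (hz _), indicator_of_mem (by exact hij)] at this
  simp at this

/-- By Campbell's formula the sum of the jumps truncated at 1 is integrable up to each integer time.
Then only finitely many jumps reach 1, and undoing the truncation adds a finite amount. -/
lemma ae_tsum_ne_top (hα₀ : 0 < α) (hα₁ : α < 1) (hK : 0 < K)
    (hN : IsStableJumpProcess α K T P μ) :
    ∀ᵐ ω ∂μ, ∀ s : ℝ, ∑' i, (if T i ω ≤ s then ENNReal.ofReal (P i ω) else 0) ≠ ∞ := by
  have h1 : ∀ᵐ ω ∂μ, ∀ n : ℕ,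
      ∑' i, (if T i ω ≤ n then ENNReal.ofReal (min (P i ω) 1) else 0) ≠ ∞ := by
    refine ae_all_iff.2 fun n => ?_
    have hg : Measurable fun z : ℝ × ℝ => (Iic (n : ℝ)).indicator 1 z.1 *
        ENNReal.ofReal (min z.2 1) :=
      ((measurable_one.indicator measurableSet_Iic).comp measurable_fst).mul (by fun_prop)
    have hc := hN.poisson.campbell hN.measurable_point hg
    rw [lintegral_prod_mul (f := (Iic (n : ℝ)).indicator 1)
      (g := fun x => ENNReal.ofReal (min x 1))
      (measurable_one.indicator measurableSet_Iic).aemeasurable (by fun_prop),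
    lintegral_indicator_one measurableSet_Iic,
      Measure.restrict_apply measurableSet_Iic, inter_comm, Ioi_inter_Iic, Real.volume_Ioc] at hc
    have hfin : ∫⁻ ω, ∑' i, (Iic (n : ℝ)).indicator 1 (T i ω) *
        ENNReal.ofReal (min (P i ω) 1) ∂μ ≠ ∞ := by
      rw [hc]
      exact ENNReal.mul_ne_top ENNReal.ofReal_ne_top
        (lintegral_min_one_stableLevyMeasure_ne_top hα₀ hα₁ hK)
    have hsm : Measurable fun ω => ∑' i, (Iic (n : ℝ)).indicator 1 (T i ω) *
        ENNReal.ofReal (min (P i ω) 1) :=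
      Measurable.tsum fun i => hg.comp (hN.measurable_point i)
    filter_upwards [ae_lt_top hsm hfin] with ω hω
    refine ne_of_eq_of_ne (tsum_congr fun i => ?_) hω.ne
    by_cases h : T i ω ≤ n <;> simp [h]
  filter_upwards [h1] with ω hω s
  obtain ⟨n, hn⟩ := exists_nat_ge s
  have hfin := ENNReal.finite_const_le_of_tsum_ne_top (hω n) one_ne_zero
  set F := hfin.toFinset with hF
  have hle : ∀ i, (if T i ω ≤ s then ENNReal.ofReal (P i ω) else 0) ≤
      (if T i ω ≤ n then ENNReal.ofReal (min (P i ω) 1) else 0) +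
        (F : Set ℕ).indicator (fun i => ENNReal.ofReal (P i ω)) i := by
    intro i
    split_ifs with h1 h2
    · by_cases hi : i ∈ (F : Set ℕ)
      · rw [indicator_of_mem hi]
        exact le_add_self
      · rw [indicator_of_notMem hi, add_zero]
        refine ENNReal.ofReal_le_ofReal (le_min le_rfl ?_)
        by_contra hcon
        refine hi ?_
        simp only [hF, Finite.coe_toFinset, mem_ofPred_eq, h2, if_true]
        rw [min_eq_right (not_le.1 hcon).le, ENNReal.ofReal_one]
    · exact absurd (h1.trans hn) h2
    · exact zero_le
    · exact zero_le
  refine ne_top_of_le_ne_top ?_ (ENNReal.tsum_le_tsum hle)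
  rw [ENNReal.tsum_add]
  refine ENNReal.add_ne_top.2 ⟨hω n, ?_⟩
  rw [tsum_eq_sum (s := F) fun i hi => indicator_of_notMem (by simpa using hi) _]
  exact ENNReal.sum_ne_top.2 fun i _ =>
    ne_top_of_le_ne_top ENNReal.ofReal_ne_top (indicator_le_self' (by simp) _)

/-- The Lévy measure is infinite, so every strip of times up to 1 / (n + 1) has infinite intensity.
-/
lemma ae_infinite (hα₀ : 0 < α) (hK : 0 < K) (hN : IsStableJumpProcess α K T P μ) :
    ∀ᵐ ω ∂μ, ∀ s > 0, {i | T i ω ≤ s}.Infinite := by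
  have h1 : ∀ᵐ ω ∂μ, ∀ n : ℕ, (Measure.sum fun i => Measure.dirac (T i ω, P i ω))
      (Iic (1 / ((n : ℝ) + 1)) ×ˢ Ioi 0) = ∞ := by
    refine ae_all_iff.2 fun n => ?_
    refine hN.poisson.ae_eq_top (measurableSet_Iic.prod measurableSet_Ioi) ?_
    rw [Measure.prod_prod, stableLevyMeasure_Ioi_zero hα₀ hK,
      Measure.restrict_apply measurableSet_Iic, inter_comm, Ioi_inter_Iic, Real.volume_Ioc]
    refine ENNReal.mul_top ?_
    simp only [sub_zero, ne_eq, ENNReal.ofReal_eq_zero, not_le]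
    positivity
  filter_upwards [h1] with ω hω s hs hfin
  obtain ⟨n, hn⟩ := exists_nat_one_div_lt hs
  have h := hω n
  rw [Measure.sum_apply _ (measurableSet_Iic.prod measurableSet_Ioi)] at h
  refine absurd h (ne_top_of_le_ne_top (b := ∑' i, (hfin.toFinset : Set ℕ).indicator 1 i) ?_
    (ENNReal.tsum_le_tsum fun i => ?_))
  · rw [← tsum_subtype, Finset.tsum_subtype']
    simp
  · rw [Measure.dirac_apply' _ (measurableSet_Iic.prod measurableSet_Ioi)]
    by_cases hi : T i ω ≤ s
    · rw [indicator_of_mem (show i ∈ (hfin.toFinset : Set ℕ) by simpa using hi)]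
      exact indicator_le_self' (by simp) _
    · rw [indicator_of_notMem]
      · exact zero_le
      · rintro ⟨h1, -⟩
        exact hi (le_trans h1 hn.le)

theorem ae_isJumpSequence (hα₀ : 0 < α) (hα₁ : α < 1) (hK : 0 < K)
    (hN : IsStableJumpProcess α K T P μ) :
    ∀ᵐ ω ∂μ, IsJumpSequence (fun i => T i ω) (fun i => P i ω) := by
  filter_upwards [hN.ae_pos, hN.ae_injective, hN.ae_tsum_ne_top hα₀ hα₁ hK,
    hN.ae_infinite hα₀ hK] with ω h1 h2 h3 h4
  exact ⟨fun i => (h1 i).1, fun i => (h1 i).2, h2, h3, h4⟩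

end IsStableJumpProcess

/-! ### Path functionals evaluated at the crossing jump -/

section PathFunctionals

open Classical in
/-- The sum of the jumps before time `u`. -/
noncomputable def massBefore (t p : ℕ → ℝ) (u : ℝ) : ℝ≥0∞ :=
  ∑' j, if t j < u then ENNReal.ofReal (p j) else 0

open Classical in
/-- The counting measure of the jumps before time `u`, divided by `x`. -/
noncomputable def jumpsBefore (t p : ℕ → ℝ) (u x : ℝ) : Measure ℝ :=
  Measure.sum fun j => if t j < u then Measure.dirac (p j / x) else 0

/-- The triple of undershoot, completed jumps and overshoot of a level `x`, divided by `x`, when the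
level is crossed by a jump of size `q` from the mass `m`, and `J` are the normalized completed
jumps. -/
noncomputable def crossingTriple (x q : ℝ) (m : ℝ≥0∞) (J : Measure ℝ) : ℝ × Measure ℝ × ℝ :=
  ((x - m.toReal) / x, J, (m.toReal + q - x) / x)

/-- The level `x` is crossed by the jump `i`. -/
def Crosses (t p : ℕ → ℝ) (x : ℝ) (i : ℕ) : Prop :=
  massBefore t p (t i) < ENNReal.ofReal x ∧
    ENNReal.ofReal x < massBefore t p (t i) + ENNReal.ofReal (p i)

/-- The jump `i` is the first to exceed its mark. -/
def FirstExceeds (t p e : ℕ → ℝ) (i : ℕ) : Prop :=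
  e i < p i ∧ ∀ j, t j < t i → p j ≤ e j

variable {t p e : ℕ → ℝ} {x : ℝ} {i : ℕ}

lemma massBefore_add_le {j : ℕ} (h : t i < t j) :
    massBefore t p (t i) + ENNReal.ofReal (p i) ≤ massBefore t p (t j) := by
  classical
  have h1 : ENNReal.ofReal (p i) = ∑' k, if k = i then ENNReal.ofReal (p k) else 0 := by
    rw [tsum_ite_eq]
  rw [massBefore, massBefore, h1, ← ENNReal.tsum_add]
  refine ENNReal.tsum_le_tsum fun k => ?_
  by_cases hk : k = i
  · subst hk; simp [h]
  · simp only [hk, if_false, add_zero]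
    split_ifs with h2 h3
    · exact le_rfl
    · exact absurd (h2.trans h) h3
    · exact zero_le
    · exact le_rfl

/-- Distinct jumps pass over disjoint open intervals of levels. -/
lemma Crosses.unique (ht : Function.Injective t) {j : ℕ} (hi : Crosses t p x i)
    (hj : Crosses t p x j) : i = j := by
  by_contra hne
  rcases lt_or_gt_of_ne (ht.ne hne) with h | h
  · exact absurd ((hi.2.trans_le (massBefore_add_le h)).trans hj.1) (lt_irrefl _)
  · exact absurd ((hj.2.trans_le (massBefore_add_le h)).trans hi.1) (lt_irrefl _)

lemma FirstExceeds.unique (ht : Function.Injective t) {j : ℕ} (hi : FirstExceeds t p e i)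
    (hj : FirstExceeds t p e j) : i = j := by
  by_contra hne
  rcases lt_or_gt_of_ne (ht.ne hne) with h | h
  · exact absurd (hj.2 i h) (not_le.2 hi.1)
  · exact absurd (hi.2 j h) (not_le.2 hj.1)

namespace IsJumpSequence

lemma massBefore_ne_top (h : IsJumpSequence t p) (u : ℝ) : massBefore t p u ≠ ∞ := by
  refine ne_top_of_le_ne_top (h.tsum_ne_top u) (ENNReal.tsum_le_tsum fun i => ?_)
  split_ifs with h1 h2
  · exact le_rfl
  · exact absurd h1.le h2
  · exact zero_le
  · exact le_rfl

lemma subordinator_eq (h : IsJumpSequence t p) (s : ℝ) :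
    subordinator t p s = (∑' i, (if t i ≤ s then ENNReal.ofReal (p i) else 0)).toReal := by
  rw [ENNReal.tsum_toReal_eq fun i => by split_ifs <;> simp, subordinator]
  refine tsum_congr fun i => ?_
  split_ifs with h1
  · rw [ENNReal.toReal_ofReal (h.jump_pos i).le]
  · rfl

lemma tsum_le_time_eq (h : IsJumpSequence t p) (i : ℕ) :
    ∑' j, (if t j ≤ t i then ENNReal.ofReal (p j) else 0) =
      massBefore t p (t i) + ENNReal.ofReal (p i) := by
  classical
  have h1 : ENNReal.ofReal (p i) = ∑' k, if k = i then ENNReal.ofReal (p k) else 0 := by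
    rw [tsum_ite_eq]
  rw [massBefore, h1, ← ENNReal.tsum_add]
  refine tsum_congr fun k => ?_
  by_cases hk : k = i
  · subst hk; simp
  · have : t k ≤ t i ↔ t k < t i := ⟨fun hle => lt_of_le_of_ne hle (h.injective.ne hk), le_of_lt⟩
    simp [hk, this]

lemma subordinator_time (h : IsJumpSequence t p) (i : ℕ) :
    subordinator t p (t i) = (massBefore t p (t i)).toReal + p i := by
  rw [h.subordinator_eq, h.tsum_le_time_eq, ENNReal.toReal_add (h.massBefore_ne_top _)
    ENNReal.ofReal_ne_top, ENNReal.toReal_ofReal (h.jump_pos i).le]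

lemma subordinator_le_of_lt (h : IsJumpSequence t p) {s u : ℝ} (hs : s < u) :
    subordinator t p s ≤ (massBefore t p u).toReal := by
  rw [h.subordinator_eq]
  refine ENNReal.toReal_mono (h.massBefore_ne_top _) (ENNReal.tsum_le_tsum fun j => ?_)
  split_ifs with h1 h2
  · exact le_rfl
  · exact absurd (h1.trans_lt hs) h2
  · exact zero_le
  · exact le_rfl

/-- Dominated convergence jump by jump: the indicator of t j ≤ s tends to that of t j < u as s
increases to u. -/
lemma leftLim_subordinator (h : IsJumpSequence t p) (u : ℝ) :
    Function.leftLim (subordinator t p) u = (massBefore t p u).toReal := by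
  classical
  refine leftLim_eq_of_tendsto ?_
  have hsum : Summable fun j => if t j < u then p j else 0 := by
    have := ENNReal.summable_toReal (h.massBefore_ne_top u)
    refine this.congr fun j => ?_
    split_ifs
    · rw [ENNReal.toReal_ofReal (h.jump_pos j).le]
    · rfl
  have heq : (massBefore t p u).toReal = ∑' j, if t j < u then p j else 0 := by
    rw [massBefore, ENNReal.tsum_toReal_eq fun i => by split_ifs <;> simp]
    refine tsum_congr fun j => ?_
    split_ifs
    · rw [ENNReal.toReal_ofReal (h.jump_pos j).le]
    · rfl
  rw [heq]
  refine tendsto_tsum_of_dominated_convergence hsum (fun j => ?_) ?_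
  · by_cases hj : t j < u
    · refine tendsto_const_nhds.congr' ?_
      filter_upwards [Ioo_mem_nhdsLT hj] with s hs
      simp [hj, hs.1.le]
    · refine tendsto_const_nhds.congr' ?_
      filter_upwards [self_mem_nhdsWithin] with s hs
      have : ¬ t j ≤ s := fun hle => hj (hle.trans_lt hs)
      simp [hj, this]
  · filter_upwards [self_mem_nhdsWithin] with s hs j
    by_cases hj : t j ≤ s
    · have : t j < u := hj.trans_lt hs
      simp [hj, this, abs_of_pos (h.jump_pos j)]
    · simp only [hj, if_false, norm_zero]
      split_ifs
      · exact (h.jump_pos j).le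
      · exact le_rfl

/-- Before the crossing time the path is at most `massBefore`, which is strictly below x, and at
that time it is strictly above x. The infimum is therefore attained. -/
lemma inverseSubordinator_eq (h : IsJumpSequence t p) (hx : 0 < x) (hi : Crosses t p x i) :
    inverseSubordinator t p x = t i := by
  have hm := h.massBefore_ne_top (t i)
  refine IsLeast.csInf_eq ⟨⟨(h.time_pos i).le, ?_⟩, fun s hs => ?_⟩
  · rw [h.subordinator_time]
    have := hi.2
    rwa [← ENNReal.ofReal_toReal hm, ← ENNReal.ofReal_add ENNReal.toReal_nonneg (h.jump_pos i).le,
      ENNReal.ofReal_lt_ofReal_iff_of_nonneg hx.le] at this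
  · by_contra hlt
    have h1 := h.subordinator_le_of_lt (not_le.1 hlt)
    have h2 : (massBefore t p (t i)).toReal < x :=
      (ENNReal.lt_ofReal_iff_toReal_lt hm).1 hi.1
    exact absurd (hs.2.trans_le h1) (not_lt.2 h2.le)

lemma triple_eq_crossingTriple (h : IsJumpSequence t p) (hx : 0 < x) (hi : Crosses t p x i) :
    (undershoot t p x / x, completedJumps t p x, overshoot t p x / x) =
      crossingTriple x (p i) (massBefore t p (t i)) (jumpsBefore t p (t i) x) := by
  rw [undershoot, completedJumps, overshoot, h.inverseSubordinator_eq hx hi,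
    h.leftLim_subordinator, h.subordinator_time]
  rfl

lemma firstExceedTime_eq (hi : FirstExceeds t p e i) : firstExceedTime t p e = t i := by
  refine IsLeast.csInf_eq ⟨⟨i, hi.1, rfl⟩, ?_⟩
  rintro u ⟨j, hj, rfl⟩
  by_contra hlt
  exact absurd (hi.2 j (not_le.1 hlt)) (not_le.2 hj)

lemma firstExceedMark_eq (h : IsJumpSequence t p) (hi : FirstExceeds t p e i) :
    firstExceedMark t p e = e i := by
  classical
  rw [firstExceedMark, firstExceedTime_eq hi, tsum_eq_single i]
  · simp [hi.1]
  · intro j hj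
    rw [if_neg]
    exact fun hcon => hj (h.injective hcon.2)

/-- Jump i itself is discarded since it exceeds its mark, and no other jump shares its time. The
thinned collection is therefore `jumpsBefore`, just as for a crossing. -/
lemma le_mark_and_le_time_iff (h : IsJumpSequence t p) (hi : FirstExceeds t p e i) (j : ℕ) :
    p j ≤ e j ∧ t j ≤ t i ↔ t j < t i := by
  refine ⟨fun ⟨h1, h2⟩ => lt_of_le_of_ne h2 fun heq => ?_, fun hlt => ⟨hi.2 j hlt, hlt.le⟩⟩
  rw [h.injective heq] at h1
  exact absurd hi.1 (not_lt.2 h1)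

lemma thinningLevel_eq (h : IsJumpSequence t p) (hi : FirstExceeds t p e i) :
    thinningLevel t p e = (massBefore t p (t i)).toReal + e i := by
  classical
  rw [thinningLevel, firstExceedMark_eq h hi, firstExceedTime_eq hi]
  congr 1
  rw [massBefore, ENNReal.tsum_toReal_eq fun i => by split_ifs <;> simp]
  refine tsum_congr fun j => ?_
  simp only [h.le_mark_and_le_time_iff hi]
  split_ifs
  · rw [ENNReal.toReal_ofReal (h.jump_pos j).le]
  · rfl

lemma thinnedJumps_eq (h : IsJumpSequence t p) (hi : FirstExceeds t p e i) (x : ℝ) :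
    thinnedJumps t p e x = jumpsBefore t p (t i) x := by
  classical
  rw [thinnedJumps, jumpsBefore, firstExceedTime_eq hi]
  simp only [h.le_mark_and_le_time_iff hi]

/-- The level lies e i above the mass before jump i, and 0 < e i < p i. The first exceedance is thus
also the jump that crosses the thinning level. -/
lemma crosses_thinningLevel (h : IsJumpSequence t p) (hi : FirstExceeds t p e i) (he : 0 < e i) :
    Crosses t p (thinningLevel t p e) i := by
  have hm := h.massBefore_ne_top (t i)
  have hlev : ENNReal.ofReal (thinningLevel t p e) =
      massBefore t p (t i) + ENNReal.ofReal (e i) := by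
    rw [h.thinningLevel_eq hi, ENNReal.ofReal_add ENNReal.toReal_nonneg he.le,
      ENNReal.ofReal_toReal hm]
  constructor
  · rw [hlev]
    exact ENNReal.lt_add_right hm (ENNReal.ofReal_pos.2 he).ne'
  · rw [hlev]
    exact ENNReal.add_lt_add_left hm
      ((ENNReal.ofReal_lt_ofReal_iff (he.trans hi.1)).2 hi.1)

lemma thinned_triple_eq_crossingTriple (h : IsJumpSequence t p) (hi : FirstExceeds t p e i)
    (he : 0 < e i) :
    (undershoot t p (thinningLevel t p e) / thinningLevel t p e,
      thinnedJumps t p e (thinningLevel t p e),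
      overshoot t p (thinningLevel t p e) / thinningLevel t p e) =
      crossingTriple ((massBefore t p (t i)).toReal + e i) (p i) (massBefore t p (t i))
        (jumpsBefore t p (t i) ((massBefore t p (t i)).toReal + e i)) := by
  have hx : 0 < thinningLevel t p e := by
    rw [h.thinningLevel_eq hi]
    positivity
  have hT := h.triple_eq_crossingTriple hx (h.crosses_thinningLevel hi he)
  rw [← h.thinningLevel_eq hi]
  simp only [crossingTriple, Prod.mk.injEq] at hT ⊢
  exact ⟨hT.1, h.thinnedJumps_eq hi _, hT.2.2⟩

end IsJumpSequence

end PathFunctionals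

/-! ### Random elements read off at a selected index -/

section SelectedIndex

variable {Ω Y : Type*} [MeasurableSpace Ω] [MeasurableSpace Y] {μ : Measure Ω}

/-- Disjointness turns the sum into the probability of the union. The existence of a crossing jump
or of a first exceedance thereby follows from a total mass, without a study of the path. -/
lemma ae_exists_mem_of_tsum_eq_one [IsProbabilityMeasure μ] {C : ℕ → Set Ω}
    (hC : ∀ i, MeasurableSet (C i)) (hd : ∀ᵐ ω ∂μ, ∀ i j, ω ∈ C i → ω ∈ C j → i = j)
    (h1 : ∑' i, μ (C i) = 1) : ∀ᵐ ω ∂μ, ∃ i, ω ∈ C i := by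
  have hdis : Pairwise (Function.onFun (AEDisjoint μ) C) := by
    intro i j hij
    refine measure_mono_null ?_ hd
    rintro ω ⟨hi, hj⟩ hcon
    exact hij (hcon i j hi hj)
  have hU : μ (⋃ i, C i) = 1 := by
    rw [measure_iUnion₀ hdis fun i => (hC i).nullMeasurableSet, h1]
  have := (prob_compl_eq_zero_iff (MeasurableSet.iUnion hC)).2 hU
  filter_upwards [show ∀ᵐ ω ∂μ, ω ∈ ⋃ i, C i from this] with ω hω
  simpa using hω

/-- Gluing over a countable almost sure cover. It spares a direct proof of measurability for
functionals defined through `sInf` and `leftLim`. -/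
lemma aemeasurable_of_selected {C : ℕ → Set Ω}
    (hC : ∀ i, MeasurableSet (C i)) (hex : ∀ᵐ ω ∂μ, ∃ i, ω ∈ C i) {X : Ω → Y} {Φ : ℕ → Ω → Y}
    (hΦ : ∀ i, Measurable (Φ i)) (hX : ∀ᵐ ω ∂μ, ∀ i, ω ∈ C i → X ω = Φ i ω) :
    AEMeasurable X μ := by
  have hr : μ.restrict (⋃ i, C i) = μ := by
    refine Measure.restrict_eq_self_of_ae_mem ?_
    filter_upwards [hex] with ω hω
    simpa using hω
  rw [← hr, aemeasurable_iUnion_iff]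
  intro i
  refine ⟨Φ i, hΦ i, ?_⟩
  rw [Filter.EventuallyEq, ae_restrict_iff' (hC i)]
  filter_upwards [hX] with ω hω
  exact hω i

lemma map_apply_of_selected {C : ℕ → Set Ω} (hC : ∀ i, MeasurableSet (C i))
    (hd : ∀ᵐ ω ∂μ, ∀ i j, ω ∈ C i → ω ∈ C j → i = j)
    (hex : ∀ᵐ ω ∂μ, ∃ i, ω ∈ C i) {X : Ω → Y} {Φ : ℕ → Ω → Y}
    (hΦ : ∀ i, Measurable (Φ i)) (hX : ∀ᵐ ω ∂μ, ∀ i, ω ∈ C i → X ω = Φ i ω)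
    {S : Set Y} (hS : MeasurableSet S) :
    μ.map X S = ∑' i, ∫⁻ ω, (C i).indicator (fun ω => S.indicator 1 (Φ i ω)) ω ∂μ := by
  have hm := aemeasurable_of_selected hC hex hΦ hX
  have hI : ∀ i, Measurable ((C i).indicator fun ω => S.indicator (1 : Y → ℝ≥0∞) (Φ i ω)) :=
    fun i => ((measurable_one.indicator hS).comp (hΦ i)).indicator (hC i)
  rw [← lintegral_indicator_one hS, lintegral_map' (measurable_one.indicator hS).aemeasurable hm,
    ← lintegral_tsum fun i => (hI i).aemeasurable]
  refine lintegral_congr_ae ?_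
  filter_upwards [hd, hex, hX] with ω h1 ⟨i, hi⟩ h3
  rw [tsum_eq_single i fun j hj => indicator_of_notMem (fun hc => hj (h1 j i hc hi)) _,
    indicator_of_mem hi, h3 i hi]

end SelectedIndex

/-! ### Size-biased orderings of a mass-partition -/

section SizeBiased

/-- The counting measure of the blocks of `v` except the block `i`. -/
noncomputable def otherBlocks (v : ℕ → ℝ) (i : ℕ) : Measure ℝ :=
  open Classical in Measure.sum fun k => if k ≠ i ∧ 0 < v k then Measure.dirac (v k) else 0

/-- The probability that the first blocks drawn from `v` are `j 0, j 1, …`. -/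
noncomputable def drawWeight (v : ℕ → ℝ) {n : ℕ} (j : Fin n → ℕ) : ℝ :=
  ∏ k : Fin n, v (j k) / (1 - ∑ l ∈ Finset.univ.filter (· < k), v (j l))

lemma measurable_drawWeight {n : ℕ} (j : Fin n → ℕ) : Measurable fun v => drawWeight v j := by
  unfold drawWeight
  fun_prop

lemma drawWeight_snoc (v : ℕ → ℝ) {n : ℕ} (j : Fin n → ℕ) (a : ℕ) :
    drawWeight v (Fin.snoc j a : Fin (n + 1) → ℕ) =
      drawWeight v j * (v a / (1 - ∑ l, v (j l))) := by
  rw [drawWeight, Fin.prod_univ_castSucc, drawWeight]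
  congr 1
  · refine Finset.prod_congr rfl fun k _ => ?_
    rw [Finset.sum_filter, Fin.sum_univ_castSucc, Finset.sum_filter]
    simp [Fin.castSucc_lt_castSucc_iff, not_lt.2 (Fin.le_last k.castSucc)]
  · rw [Finset.sum_filter, Fin.sum_univ_castSucc]
    simp [Fin.castSucc_lt_last]

/-- `v` is a mass-partition with infinitely many blocks. -/
structure IsMassPartition (v : ℕ → ℝ) : Prop where
  nonneg : ∀ i, 0 ≤ v i
  tsum_eq_one : ∑' i, ENNReal.ofReal (v i) = 1
  infinite : {i | 0 < v i}.Infinite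

namespace IsMassPartition

variable {v : ℕ → ℝ}

lemma ofReal_sum_add (h : IsMassPartition v) {n : ℕ} {j : Fin n → ℕ} (hj : Function.Injective j) :
    ENNReal.ofReal (∑ l, v (j l)) +
      ∑' a, (range j)ᶜ.indicator (fun a => ENNReal.ofReal (v a)) a = 1 := by
  rw [← h.tsum_eq_one, ENNReal.ofReal_sum_of_nonneg fun _ _ => h.nonneg _, ← tsum_subtype,
    ← ENNReal.summable.tsum_add_tsum_compl (s := range j) ENNReal.summable]
  congr 1
  rw [tsum_range (fun a => ENNReal.ofReal (v a)) hj, tsum_fintype]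

/-- With infinitely many blocks, finitely many draws always leave a positive one, so the
denominators in `drawWeight` never vanish. -/
lemma remainder_pos (h : IsMassPartition v) {n : ℕ} {j : Fin n → ℕ}
    (hj : Function.Injective j) : 0 < 1 - ∑ l, v (j l) := by
  obtain ⟨a, ha, haj⟩ := (h.infinite.sdiff (finite_range j)).nonempty
  have ha : 0 < v a := ha
  have h1 := h.ofReal_sum_add hj
  have h2 : ENNReal.ofReal (v a) ≤
      ∑' a, (range j)ᶜ.indicator (fun a => ENNReal.ofReal (v a)) a := by
    refine le_trans ?_ (ENNReal.le_tsum a)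
    rw [indicator_of_mem (show a ∈ (range j)ᶜ from haj)]
  have h3 : ENNReal.ofReal (∑ l, v (j l)) + ENNReal.ofReal (v a) ≤ 1 := by
    rw [← h1]
    gcongr
  rw [← ENNReal.ofReal_add (Finset.sum_nonneg fun _ _ => h.nonneg _) ha.le,
    ENNReal.ofReal_le_one] at h3
  linarith

/-- The undrawn blocks carry exactly the remaining mass. The probabilities of the next draw thus
already add up to one over them, which leaves nothing for a repetition. -/
lemma tsum_indicator_div (h : IsMassPartition v) {n : ℕ} {j : Fin n → ℕ}
    (hj : Function.Injective j) :
    ∑' a, (range j)ᶜ.indicator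
      (fun a => ENNReal.ofReal (v a / (1 - ∑ l, v (j l)))) a = 1 := by
  have hpos := h.remainder_pos hj
  have h1 := h.ofReal_sum_add hj
  have h2 : ∑' a, (range j)ᶜ.indicator (fun a => ENNReal.ofReal (v a)) a =
      ENNReal.ofReal (1 - ∑ l, v (j l)) := by
    rw [ENNReal.ofReal_sub _ (Finset.sum_nonneg fun _ _ => h.nonneg _), ENNReal.ofReal_one, ← h1,
      ENNReal.add_sub_cancel_left ENNReal.ofReal_ne_top]
  have h3 : ∀ a, (range j)ᶜ.indicator
      (fun a => ENNReal.ofReal (v a / (1 - ∑ l, v (j l)))) a =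
      (range j)ᶜ.indicator (fun a => ENNReal.ofReal (v a)) a *
        (ENNReal.ofReal (1 - ∑ l, v (j l)))⁻¹ := fun a => by
    by_cases ha : a ∈ (range j)ᶜ
    · rw [indicator_of_mem ha, indicator_of_mem ha, ENNReal.ofReal_div_of_pos hpos,
        div_eq_mul_inv]
    · rw [indicator_of_notMem ha, indicator_of_notMem ha, zero_mul]
  simp_rw [h3]
  rw [ENNReal.tsum_mul_right, h2]
  exact ENNReal.mul_inv_cancel (ENNReal.ofReal_pos.2 hpos).ne' ENNReal.ofReal_ne_top

lemma drawWeight_nonneg (h : IsMassPartition v) : ∀ {n : ℕ} {j : Fin n → ℕ},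
    Function.Injective j → 0 ≤ drawWeight v j := by
  intro n
  induction n with
  | zero => intro j _; simp [drawWeight]
  | succ n ih =>
    intro j hj
    have hi : Function.Injective (Fin.init j) := fun a b hab =>
      Fin.castSucc_injective n (hj hab)
    rw [← Fin.snoc_init_self j, drawWeight_snoc]
    exact mul_nonneg (ih hi) (div_nonneg (h.nonneg _) (h.remainder_pos hi).le)

end IsMassPartition

variable {Ω : Type*} [MeasurableSpace Ω] {μ : Measure Ω} {V : ℕ → Ω → ℝ}
  {σ : ℕ → Ω → ℕ}

lemma setLIntegral_draw (hVm : ∀ i, Measurable (V i)) (hσm : ∀ n, Measurable (σ n)) {n : ℕ}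
    {j : Fin n → ℕ}
    (hσ : ∀ B : Set (ℕ → ℝ), MeasurableSet B →
        μ {ω | (fun i => V i ω) ∈ B ∧ ∀ k : Fin n, σ k ω = j k} =
          ∫⁻ ω in {ω | (fun i => V i ω) ∈ B},
            ENNReal.ofReal (drawWeight (fun i => V i ω) j) ∂μ)
    {g : (ℕ → ℝ) → ℝ≥0∞} (hg : Measurable g) :
    ∫⁻ ω in {ω | ∀ k : Fin n, σ k ω = j k}, g (fun i => V i ω) ∂μ =
      ∫⁻ ω, ENNReal.ofReal (drawWeight (fun i => V i ω) j) * g (fun i => V i ω) ∂μ := by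
  have hV : Measurable fun ω i => V i ω := measurable_pi_lambda _ hVm
  have hJ : MeasurableSet {ω | ∀ k : Fin n, σ k ω = j k} := by
    rw [ofPred_forall]
    exact MeasurableSet.iInter fun k => hσm k (measurableSet_singleton _)
  have hw : Measurable fun ω => ENNReal.ofReal (drawWeight (fun i => V i ω) j) :=
    ((measurable_drawWeight j).comp hV).ennreal_ofReal
  have key : (μ.restrict {ω | ∀ k : Fin n, σ k ω = j k}).map (fun ω i => V i ω) =
      (μ.withDensity fun ω => ENNReal.ofReal (drawWeight (fun i => V i ω) j)).map
        fun ω i => V i ω := by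
    ext B hB
    rw [Measure.map_apply hV hB, Measure.map_apply hV hB, Measure.restrict_apply (hV hB),
      withDensity_apply _ (hV hB)]
    exact hσ B hB
  have hgV : Measurable fun ω => g fun i => V i ω := hg.comp hV
  rw [← lintegral_map hg hV, key, lintegral_map hg hV,
    lintegral_withDensity_eq_lintegral_mul _ hw hgV]
  rfl

/-- The definition of `IsSizeBiasedOrdering` prescribes probabilities for injective index vectors
only. These suffice: fresh draws exhaust the probability, empty blocks have weight zero, and a
positive block cannot be avoided forever. -/
lemma IsSizeBiasedOrdering.exists_draws [IsProbabilityMeasure μ] {W : ℕ → Ω → ℝ}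
    (hVm : ∀ i, Measurable (V i))
    (hV : ∀ᵐ ω ∂μ, IsMassPartition fun i => V i ω) (hW : IsSizeBiasedOrdering V W μ) :
    ∃ σ : ℕ → Ω → ℕ, (∀ n, Measurable (σ n)) ∧ (∀ n ω, W n ω = V (σ n ω) ω) ∧
      (∀ i (g : (ℕ → ℝ) → ℝ≥0∞), Measurable g →
        ∫⁻ ω in {ω | σ 0 ω = i}, g (fun i => V i ω) ∂μ =
          ∫⁻ ω, ENNReal.ofReal (V i ω) * g (fun i => V i ω) ∂μ) ∧
      ∀ᵐ ω ∂μ, Function.Injective (fun n => σ n ω) ∧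
        range (fun n => σ n ω) = {i | 0 < V i ω} := by
  obtain ⟨σ, hσm, hWσ, hσ⟩ := hW
  have hVv : Measurable fun ω i => V i ω := measurable_pi_lambda _ hVm
  have hσs : ∀ n a, MeasurableSet {ω | σ n ω = a} := fun n a => hσm n (measurableSet_singleton a)
  have hdraw : ∀ {n : ℕ} {j : Fin n → ℕ}, Function.Injective j → ∀ {g : (ℕ → ℝ) → ℝ≥0∞},
      Measurable g → ∫⁻ ω in {ω | ∀ k : Fin n, σ k ω = j k}, g (fun i => V i ω) ∂μ =
      ∫⁻ ω, ENNReal.ofReal (drawWeight (fun i => V i ω) j) * g (fun i => V i ω) ∂μ :=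
    fun hj _ hg => setLIntegral_draw hVm hσm (fun B hB => hσ _ _ hj B hB) hg
  have hJ : ∀ {n : ℕ} (j : Fin n → ℕ), MeasurableSet {ω | ∀ k : Fin n, σ k ω = j k} := by
    intro n j
    rw [ofPred_forall]
    exact MeasurableSet.iInter fun k => hσm k (measurableSet_singleton _)
  have hJμ : ∀ {n : ℕ} {j : Fin n → ℕ}, Function.Injective j →
      μ {ω | ∀ k : Fin n, σ k ω = j k} =
        ∫⁻ ω, ENNReal.ofReal (drawWeight (fun i => V i ω) j) ∂μ := fun {n j} hj => by
    have := hdraw hj (g := 1) measurable_one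
    simpa using this
  have hwm : ∀ {n : ℕ} (j : Fin n → ℕ),
      Measurable fun ω => ENNReal.ofReal (drawWeight (fun i => V i ω) j) :=
    fun j => ((measurable_drawWeight j).comp hVv).ennreal_ofReal
  have hsnocJ : ∀ {n : ℕ} (j : Fin n → ℕ) (a : ℕ),
      {ω | ∀ k : Fin (n + 1), σ k ω = (Fin.snoc j a : Fin (n + 1) → ℕ) k} =
        {ω | ∀ k : Fin n, σ k ω = j k} ∩ {ω | σ n ω = a} := by
    intro n j a
    ext ω
    simp [Fin.forall_fin_succ']
  have hsnocinj : ∀ {n : ℕ} {j : Fin n → ℕ}, Function.Injective j → ∀ {a}, a ∉ range j →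
      Function.Injective (Fin.snoc j a : Fin (n + 1) → ℕ) := fun hj a ha =>
    Fin.snoc_injective_iff.2 ⟨hj, ha⟩
  have hsnocμ : ∀ {n : ℕ} {j : Fin n → ℕ}, Function.Injective j → ∀ {a}, a ∉ range j →
      μ ({ω | ∀ k : Fin n, σ k ω = j k} ∩ {ω | σ n ω = a}) =
        ∫⁻ ω, ENNReal.ofReal (drawWeight (fun i => V i ω) j) *
          ENNReal.ofReal (V a ω / (1 - ∑ l, V (j l) ω)) ∂μ := by
    intro n j hj a ha
    rw [← hsnocJ, hJμ (hsnocinj hj ha)]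
    refine lintegral_congr_ae ?_
    filter_upwards [hV] with ω hω
    rw [drawWeight_snoc, ENNReal.ofReal_mul (hω.drawWeight_nonneg hj)]
  -- successive draws are distinct
  have hnew : ∀ᵐ ω ∂μ, ∀ n (j : Fin n → ℕ), Function.Injective j →
      (∀ k : Fin n, σ k ω = j k) → σ n ω ∉ range j := by
    refine ae_all_iff.2 fun n => ae_all_iff.2 fun j => ?_
    by_cases hj : Function.Injective j
    swap
    · exact Filter.Eventually.of_forall fun ω h => absurd h hj
    have hm : MeasurableSet {ω | σ n ω ∈ range j} := hσm n (MeasurableSet.of_discrete)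
    -- Adding `hsnocμ` over the undrawn indices a recovers the whole probability of the first n
    -- draws, so a repetition is null.
    have h1 : μ ({ω | ∀ k : Fin n, σ k ω = j k} \ {ω | σ n ω ∈ range j}) =
        μ {ω | ∀ k : Fin n, σ k ω = j k} := by
      have hset : {ω | ∀ k : Fin n, σ k ω = j k} \ {ω | σ n ω ∈ range j} =
          ⋃ a : ((range j)ᶜ : Set ℕ), {ω | ∀ k : Fin n, σ k ω = j k} ∩ {ω | σ n ω = a} := by
        ext ω
        simp only [mem_sdiff, mem_iUnion, mem_inter_iff, mem_ofPred_eq]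
        constructor
        · rintro ⟨h1, h2⟩
          exact ⟨⟨σ n ω, h2⟩, h1, rfl⟩
        · rintro ⟨a, h1, h2⟩
          exact ⟨h1, h2 ▸ a.2⟩
      rw [hset, measure_iUnion ?_ fun a => (hJ j).inter (hσs n _)]
      · rw [tsum_congr fun a : ((range j)ᶜ : Set ℕ) => hsnocμ hj a.2, ← lintegral_tsum]
        · rw [hJμ hj]
          refine lintegral_congr_ae ?_
          filter_upwards [hV] with ω hω
          rw [ENNReal.tsum_mul_left,
            tsum_subtype _ fun a => ENNReal.ofReal (V a ω / (1 - ∑ l, V (j l) ω)),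
            hω.tsum_indicator_div hj, mul_one]
        · intro a
          exact ((hwm j).mul (by fun_prop)).aemeasurable
      · intro a b hab
        refine Disjoint.mono inter_subset_right inter_subset_right ?_
        refine disjoint_left.2 fun ω ha hb => hab (Subtype.ext ?_)
        exact (ha : σ n ω = a).symm.trans hb
    have h2 := measure_sdiff_add_inter (μ := μ) {ω | ∀ k : Fin n, σ k ω = j k} hm
    rw [h1] at h2
    have h3 : μ ({ω | ∀ k : Fin n, σ k ω = j k} ∩ {ω | σ n ω ∈ range j}) = 0 :=
      
      (ENNReal.add_right_inj (measure_ne_top _ _)).1 (h2.trans (add_zero _).symm)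
    refine (measure_eq_zero_iff_ae_notMem.1 h3).mono fun ω hω _ hk hr => hω ⟨hk, hr⟩
  have hinj : ∀ᵐ ω ∂μ, Function.Injective (fun n => σ n ω) := by
    filter_upwards [hnew] with ω hω
    have hfin : ∀ n, Function.Injective fun k : Fin n => σ k ω := by
      intro n
      induction n with
      | zero => exact fun k => k.elim0
      | succ n ih =>
        have := Fin.snoc_injective_iff.2 ⟨ih, hω n _ ih fun k => rfl⟩
        convert this using 1
        ext k
        refine Fin.lastCases ?_ (fun k => ?_) k <;> simp
    intro a b hab
    have := @hfin (max a b + 1) ⟨a, by omega⟩ ⟨b, by omega⟩ hab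
    simpa using this
  have hpos : ∀ᵐ ω ∂μ, ∀ n, 0 < V (σ n ω) ω := by
    have h1 : ∀ᵐ ω ∂μ, ∀ n (j : Fin (n + 1) → ℕ), Function.Injective j →
        (∀ k : Fin (n + 1), σ k ω = j k) → 0 < V (j (Fin.last n)) ω := by
      refine ae_all_iff.2 fun n => ae_all_iff.2 fun j => ?_
      by_cases hj : Function.Injective j
      swap
      · exact Filter.Eventually.of_forall fun ω h => absurd h hj
      have hB : MeasurableSet {v : ℕ → ℝ | v (j (Fin.last n)) ≤ 0} :=
        measurableSet_le (measurable_pi_apply _) measurable_const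
      have h := hσ (n + 1) j hj _ hB
      rw [lintegral_eq_zero_of_ae_eq_zero] at h
      · refine (measure_eq_zero_iff_ae_notMem.1 h).mono fun ω hω _ hk => ?_
        by_contra hcon
        exact hω ⟨not_lt.1 hcon, hk⟩
      · refine (ae_restrict_iff' (hVv hB)).2 ?_
        filter_upwards [hV] with ω hω hle
        have h0 : V (j (Fin.last n)) ω = 0 := le_antisymm hle (hω.nonneg _)
        rw [Finset.prod_eq_zero (Finset.mem_univ (Fin.last n)) (by rw [h0, zero_div])]
        simp
    filter_upwards [h1, hinj] with ω h1 h2 n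
    exact h1 n (fun k => σ k ω) (fun a b hab => Fin.ext (h2 hab)) fun k => rfl
  -- every block is drawn
  have hall : ∀ᵐ ω ∂μ, ∀ i, 0 < V i ω → ∃ n, σ n ω = i := by
    refine ae_all_iff.2 fun i => ?_
    have hE : MeasurableSet {ω | ∀ n, σ n ω ≠ i} := by
      rw [ofPred_forall]
      exact MeasurableSet.iInter fun k => (hσs k i).compl
    set c := ∫⁻ ω in {ω | ∀ n, σ n ω ≠ i}, ENNReal.ofReal (V i ω) ∂μ with hc
    have hDm : ∀ n : ℕ, MeasurableSet {ω | σ n ω = i ∧ ∀ k : Fin n, σ k ω ≠ i} := fun n => by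
      refine (hσs n i).inter ?_
      have : MeasurableSet (⋂ k : Fin n, {ω | σ k ω ≠ i}) :=
        MeasurableSet.iInter fun k => (hσs k i).compl
      rwa [← ofPred_forall] at this
    have hle : ∀ n : ℕ, c ≤ μ {ω | σ n ω = i ∧ ∀ k : Fin n, σ k ω ≠ i} := by
      intro n
      let I := {j : Fin n → ℕ // Function.Injective j ∧ i ∉ range j}
      have hdis : Pairwise (Function.onFun Disjoint
          fun j : I => {ω | ∀ k : Fin n, σ k ω = j.1 k}) := by
        intro j j' hjj'
        refine disjoint_left.2 fun ω h1 h2 => hjj' (Subtype.ext (funext fun k => ?_))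
        exact (h1 k).symm.trans (h2 k)
      calc c ≤ ∫⁻ ω in ⋃ j : I, {ω | ∀ k : Fin n, σ k ω = j.1 k}, ENNReal.ofReal (V i ω) ∂μ := by
            refine lintegral_mono_set' ?_
            filter_upwards [hinj] with ω hω hmem
            refine mem_iUnion.2 ⟨⟨fun k => σ k ω, fun a b hab => Fin.ext (hω hab), ?_⟩, fun k => rfl⟩
            rintro ⟨k, hk⟩
            exact hmem k hk
        _ = ∑' j : I, ∫⁻ ω in {ω | ∀ k : Fin n, σ k ω = j.1 k}, ENNReal.ofReal (V i ω) ∂μ :=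
            lintegral_iUnion (fun j : I => hJ j.1) hdis _
        _ = ∑' j : I, ∫⁻ ω, ENNReal.ofReal (drawWeight (fun i => V i ω) j.1) *
              ENNReal.ofReal (V i ω) ∂μ := by
            refine tsum_congr fun j => ?_
            exact hdraw j.2.1 (g := fun v => ENNReal.ofReal (v i)) (by fun_prop)
        _ ≤ ∑' j : I, μ ({ω | ∀ k : Fin n, σ k ω = j.1 k} ∩ {ω | σ n ω = i}) := by
            refine ENNReal.tsum_le_tsum fun j => ?_
            rw [hsnocμ j.2.1 j.2.2]
            refine lintegral_mono_ae ?_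
            filter_upwards [hV] with ω hω
            gcongr
            rw [le_div_iff₀ (hω.remainder_pos j.2.1)]
            have : 0 ≤ ∑ l, V (j.1 l) ω := Finset.sum_nonneg fun l _ => hω.nonneg _
            nlinarith [hω.nonneg i]
        _ = μ (⋃ j : I, {ω | ∀ k : Fin n, σ k ω = j.1 k} ∩ {ω | σ n ω = i}) := by
            rw [measure_iUnion (fun j j' hjj' => (hdis hjj').mono inter_subset_left
              inter_subset_left) fun j => (hJ j.1).inter (hσs n i)]
        _ ≤ _ := by
            refine measure_mono (iUnion_subset fun j => ?_)
            rintro ω ⟨h1, h2⟩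
            refine ⟨h2, fun k hk => j.2.2 ⟨k, ?_⟩⟩
            rw [← h1 k, hk]
    have hsum : ∑' _ : ℕ, c ≤ 1 := by
      calc ∑' _ : ℕ, c ≤ ∑' n : ℕ, μ {ω | σ n ω = i ∧ ∀ k : Fin n, σ k ω ≠ i} :=
            ENNReal.tsum_le_tsum hle
        _ = μ (⋃ n : ℕ, {ω | σ n ω = i ∧ ∀ k : Fin n, σ k ω ≠ i}) := by
            rw [measure_iUnion ?_ hDm]
            intro a b hab
            refine disjoint_left.2 fun ω h1 h2 => ?_
            rcases lt_or_gt_of_ne hab with h | h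
            · exact h2.2 ⟨a, h⟩ h1.1
            · exact h1.2 ⟨b, h⟩ h2.1
        _ ≤ 1 := prob_le_one
    have hc0 : c = 0 := by
      by_contra hne
      rw [ENNReal.tsum_const_eq_top_of_ne_zero hne] at hsum
      simp at hsum
    rw [hc, lintegral_eq_zero_iff (hVm i).ennreal_ofReal, Filter.EventuallyEq,
      ae_restrict_iff' hE] at hc0
    filter_upwards [hc0] with ω hω hposi
    by_contra! hcon
    have h0 := hω hcon
    simp only [Pi.zero_apply, ENNReal.ofReal_eq_zero] at h0
    linarith
  refine ⟨σ, hσm, hWσ, fun i g hg => ?_, ?_⟩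
  · have h := hdraw (j := fun _ : Fin 1 => i) (Function.injective_of_subsingleton _) hg
    simpa [drawWeight] using h
  · filter_upwards [hinj, hpos, hall] with ω h1 h2 h3
    refine ⟨h1, Subset.antisymm ?_ fun i hi => h3 i hi⟩
    rintro _ ⟨n, rfl⟩
    exact h2 n

lemma sum_dirac_draws {v : ℕ → ℝ} {s : ℕ → ℕ} (hs : Function.Injective s)
    (hr : range s = {i | 0 < v i}) :
    (Measure.sum fun n => Measure.dirac (v (s (n + 1)))) = otherBlocks v (s 0) := by
  classical
  ext A hA
  rw [Measure.sum_apply _ hA, otherBlocks, Measure.sum_apply _ hA]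
  have hinj : Function.Injective fun n => s (n + 1) := fun a b hab => by
    simpa using hs hab
  rw [← hinj.tsum_eq (f := fun k => (if k ≠ s 0 ∧ 0 < v k then Measure.dirac (v k)
    else (0 : Measure ℝ)) A)]
  · refine tsum_congr fun n => ?_
    have h1 : s (n + 1) ≠ s 0 := fun h => by simpa using hs h
    have h2 : 0 < v (s (n + 1)) := by
      have : s (n + 1) ∈ range s := ⟨_, rfl⟩
      rwa [hr] at this
    rw [if_pos ⟨h1, h2⟩]
  · intro k hk
    have hk' : k ≠ s 0 ∧ 0 < v k := by
      by_contra hcon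
      simp [hcon] at hk
    have : k ∈ range s := by rw [hr]; exact hk'.2
    obtain ⟨n, rfl⟩ := this
    cases n with
    | zero => exact absurd rfl hk'.1
    | succ n => exact ⟨n, rfl⟩

lemma measurable_otherBlocks (i : ℕ) : Measurable fun v => otherBlocks v i := by
  unfold otherBlocks
  refine measurable_sum_ite_dirac (fun k => ?_) fun k => measurable_pi_apply k
  by_cases h : k = i
  · simp [h]
  · simp only [ne_eq, h, not_false_eq_true, true_and]
    exact measurableSet_lt measurable_const (measurable_pi_apply k)

/-- As a counting measure the later draws are all the other positive blocks, whatever their order.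
They are a function of the partition and the first index, so only the first draw has to be
integrated. -/
theorem IsSizeBiasedOrdering.lintegral_eq [IsProbabilityMeasure μ] {W : ℕ → Ω → ℝ}
    (hVm : ∀ i, Measurable (V i))
    (hV : ∀ᵐ ω ∂μ, IsMassPartition fun i => V i ω) (hW : IsSizeBiasedOrdering V W μ)
    {H : ℝ → Measure ℝ → ℝ≥0∞} (hH : Measurable fun q : ℝ × Measure ℝ => H q.1 q.2) :
    ∫⁻ ω, H (W 0 ω) (Measure.sum fun n => Measure.dirac (W (n + 1) ω)) ∂μ =
      ∑' i, ∫⁻ ω, ENNReal.ofReal (V i ω) *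
        H (V i ω) (otherBlocks (fun k => V k ω) i) ∂μ := by
  obtain ⟨σ, hσm, hWσ, hg, hae⟩ := hW.exists_draws hVm hV
  have hσs : ∀ a, MeasurableSet {ω | σ 0 ω = a} := fun a => hσm 0 (measurableSet_singleton a)
  have hHi : ∀ i, Measurable fun v : ℕ → ℝ => H (v i) (otherBlocks v i) := fun i =>
    hH.comp ((measurable_pi_apply i).prodMk (measurable_otherBlocks i))
  have hset : ⋃ i, {ω | σ 0 ω = i} = univ := by
    ext ω
    simp
  rw [← setLIntegral_univ, ← hset, lintegral_iUnion
    hσs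
    (fun a b hab => disjoint_left.2 fun ω (h1 : σ 0 ω = a) h2 => hab (h1.symm.trans h2))]
  refine tsum_congr fun i => ?_
  rw [← hg i _ (hHi i)]
  refine setLIntegral_congr_fun_ae (hσs i) ?_
  filter_upwards [hae] with ω hω hi
  have hi : σ 0 ω = i := hi
  have h := sum_dirac_draws hω.1 hω.2
  simp only [hWσ]
  rw [h, hi]

lemma IsSizeBiasedOrdering.measurable {W : ℕ → Ω → ℝ} (hVm : ∀ i, Measurable (V i))
    (hW : IsSizeBiasedOrdering V W μ) (n : ℕ) : Measurable (W n) := by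
  obtain ⟨σ, hσm, hWσ, -⟩ := hW
  have h : Measurable fun q : ℕ × Ω => V q.1 q.2 := measurable_from_prod_countable_right hVm
  have : W n = fun ω => V (σ n ω) ω := funext (hWσ n)
  rw [this]
  exact h.comp ((hσm n).prodMk measurable_id)

end SizeBiased

/-! ### Functionals of a point configuration, and integration of the crossing jump -/

section JumpFunctionals

/-- The mass `∫ p` of the points `(t, p)` of `m` with `t < u`. -/
noncomputable def massOf (m : Measure (ℝ × ℝ)) (u : ℝ) : ℝ≥0∞ :=
  ∫⁻ y in {y | y.1 < u}, ENNReal.ofReal y.2 ∂m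

/-- The image under `(t, p) ↦ p / x` of the points of `m` with `t < u`. -/
noncomputable def jumpsOf (m : Measure (ℝ × ℝ)) (u x : ℝ) : Measure ℝ :=
  (m.restrict {y | y.1 < u}).map fun y => y.2 / x

variable {X Y : Type*} [MeasurableSpace X] [MeasurableSpace Y]

lemma setLIntegral_sum_ite_dirac {z : ℕ → X} {q : ℕ → Prop} [DecidablePred q] {D : Set X}
    (hD : MeasurableSet D) [DecidablePred (· ∈ D)] {f : X → ℝ≥0∞} (hf : Measurable f) :
    ∫⁻ y in D, f y ∂(Measure.sum fun i => if q i then Measure.dirac (z i) else 0) =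
      ∑' i, if q i ∧ z i ∈ D then f (z i) else 0 := by
  rw [← lintegral_indicator hD, lintegral_sum_measure]
  refine tsum_congr fun i => ?_
  by_cases hq : q i
  · rw [if_pos hq, lintegral_dirac' _ (hf.indicator hD)]
    by_cases hz : z i ∈ D <;> simp [hq, hz]
  · simp [hq]

lemma restrict_map_sum_ite_dirac {z : ℕ → X} {q : ℕ → Prop} [DecidablePred q] {D : Set X}
    (hD : MeasurableSet D) [DecidablePred (· ∈ D)] {φ : X → Y} (hφ : Measurable φ) :
    ((Measure.sum fun i => if q i then Measure.dirac (z i) else 0).restrict D).map φ =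
      Measure.sum fun i => if q i ∧ z i ∈ D then Measure.dirac (φ (z i)) else 0 := by
  ext A hA
  rw [Measure.map_apply hφ hA, Measure.restrict_apply (hφ hA),
    Measure.sum_apply _ ((hφ hA).inter hD), Measure.sum_apply _ hA]
  refine tsum_congr fun i => ?_
  by_cases hq : q i
  · rw [if_pos hq, Measure.dirac_apply' _ ((hφ hA).inter hD)]
    by_cases hz : z i ∈ D
    · rw [if_pos ⟨hq, hz⟩, Measure.dirac_apply' _ hA]
      by_cases hA' : φ (z i) ∈ A <;> simp [hz, hA']
    · simp [hz]
  · simp [hq]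

lemma sum_dirac_eq_ite (z : ℕ → X) : (Measure.sum fun i => Measure.dirac (z i)) =
    Measure.sum fun i => if True then Measure.dirac (z i) else 0 := by
  simp

lemma sumDiracErase_eq_ite (z : ℕ → X) (i : ℕ) : sumDiracErase z i =
    Measure.sum fun j => if j ≠ i then Measure.dirac (z j) else 0 := by
  rw [sumDiracErase]
  congr 1
  ext1 j
  by_cases h : j = i <;> simp [h]

lemma measurableSet_time_lt (u : ℝ) : MeasurableSet {y : ℝ × ℝ | y.1 < u} :=
  measurableSet_lt measurable_fst measurable_const

lemma massOf_sum_dirac (t p : ℕ → ℝ) (u : ℝ) :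
    massOf (Measure.sum fun i => Measure.dirac (t i, p i)) u = massBefore t p u := by
  classical
  rw [massOf, sum_dirac_eq_ite, setLIntegral_sum_ite_dirac (measurableSet_time_lt u) (by fun_prop)]
  exact tsum_congr fun i => by simp

lemma jumpsOf_sum_dirac (t p : ℕ → ℝ) (u x : ℝ) :
    jumpsOf (Measure.sum fun i => Measure.dirac (t i, p i)) u x = jumpsBefore t p u x := by
  classical
  rw [jumpsOf, sum_dirac_eq_ite,
    restrict_map_sum_ite_dirac (measurableSet_time_lt u) (by fun_prop), jumpsBefore]
  congr 1
  ext1 i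
  simp

/-- The jump i is not strictly before its own time, so its erasure is invisible here. This makes
Mecke's formula applicable to functionals of the past of a jump. -/
lemma massOf_sumDiracErase (t p : ℕ → ℝ) (i : ℕ) :
    massOf (sumDiracErase (fun j => (t j, p j)) i) (t i) = massBefore t p (t i) := by
  classical
  rw [massOf, sumDiracErase_eq_ite,
    setLIntegral_sum_ite_dirac (measurableSet_time_lt _) (by fun_prop)]
  refine tsum_congr fun j => ?_
  by_cases h : j = i <;> simp [h]

lemma jumpsOf_sumDiracErase (t p : ℕ → ℝ) (i : ℕ) (x : ℝ) :
    jumpsOf (sumDiracErase (fun j => (t j, p j)) i) (t i) x = jumpsBefore t p (t i) x := by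
  classical
  rw [jumpsOf, sumDiracErase_eq_ite,
    restrict_map_sum_ite_dirac (measurableSet_time_lt _) (by fun_prop), jumpsBefore]
  congr 1
  ext1 j
  by_cases h : j = i <;> simp [h]

variable {A : Type*} [MeasurableSpace A] {u x q : A → ℝ}

lemma measurable_massBefore {t p : ℕ → A → ℝ} (ht : ∀ i, Measurable (t i))
    (hp : ∀ i, Measurable (p i)) (hu : Measurable u) :
    Measurable fun a => massBefore (fun i => t i a) (fun i => p i a) (u a) :=
  Measurable.tsum fun i => Measurable.ite (measurableSet_lt (ht i) hu)
    (hp i).ennreal_ofReal measurable_const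

lemma measurable_jumpsBefore {t p : ℕ → A → ℝ} (ht : ∀ i, Measurable (t i))
    (hp : ∀ i, Measurable (p i)) (hu : Measurable u) (hx : Measurable x) :
    Measurable fun a => jumpsBefore (fun i => t i a) (fun i => p i a) (u a) (x a) :=
  measurable_sum_ite_dirac (fun i => measurableSet_lt (ht i) hu) fun i => (hp i).div hx

lemma measurable_massOf (κ : Kernel A (ℝ × ℝ)) [IsSFiniteKernel κ] (hu : Measurable u) :
    Measurable fun a => massOf (κ a) (u a) :=
  measurable_setLIntegral_kernel κ (D := fun a => {y | y.1 < u a})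
    (measurableSet_lt (measurable_fst.comp measurable_snd) (hu.comp measurable_fst)) (by fun_prop)

lemma measurable_jumpsOf (κ : Kernel A (ℝ × ℝ)) [IsSFiniteKernel κ] (hu : Measurable u)
    (hx : Measurable x) : Measurable fun a => jumpsOf (κ a) (u a) (x a) :=
  measurable_restrict_map_kernel κ (D := fun a => {y | y.1 < u a})
    (measurableSet_lt (measurable_fst.comp measurable_snd) (hu.comp measurable_fst))
    (F := fun a y => y.2 / x a) (by fun_prop)

lemma measurable_crossingTriple {m : A → ℝ≥0∞} {J : A → Measure ℝ} (hx : Measurable x)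
    (hq : Measurable q) (hm : Measurable m) (hJ : Measurable J) :
    Measurable fun a => crossingTriple (x a) (q a) (m a) (J a) := by
  have h1 : Measurable fun a => (x a - (m a).toReal) / x a := by fun_prop
  have h2 : Measurable fun a => ((m a).toReal + q a - x a) / x a := by fun_prop
  exact h1.prodMk (hJ.prodMk h2)

/-- The value of `H` at the crossing triple if a jump of size `q` from the mass `m` crosses the
level `x`, and `0` otherwise. -/
noncomputable def crossingValue (H : ℝ × Measure ℝ × ℝ → ℝ≥0∞) (x q : ℝ) (m : ℝ≥0∞)
    (J : Measure ℝ) : ℝ≥0∞ :=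
  if m < ENNReal.ofReal x ∧ ENNReal.ofReal x < m + ENNReal.ofReal q then
    H (crossingTriple x q m J) else 0

lemma measurable_crossingValue {H : ℝ × Measure ℝ × ℝ → ℝ≥0∞} (hH : Measurable H)
    {m : A → ℝ≥0∞} {J : A → Measure ℝ} (hx : Measurable x)
    (hq : Measurable q) (hm : Measurable m) (hJ : Measurable J) :
    Measurable fun a => crossingValue H (x a) (q a) (m a) (J a) := by
  refine Measurable.ite ?_ (hH.comp (measurable_crossingTriple hx hq hm hJ)) measurable_const
  exact (measurableSet_lt hm hx.ennreal_ofReal).inter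
    (measurableSet_lt hx.ennreal_ofReal (hm.add hq.ennreal_ofReal))

/-- The average of `H (y, J, y * (u ^ (-1 / α) - 1))` over `u` uniform on `(0, 1)`. -/
noncomputable def paretoAverage (α : ℝ) (H : ℝ × Measure ℝ × ℝ → ℝ≥0∞) (y : ℝ) (J : Measure ℝ) :
    ℝ≥0∞ :=
  ∫⁻ u in Ioo (0 : ℝ) 1, H (y, J, y * (1 / u ^ (1 / α) - 1))

lemma measurable_paretoAverage {α : ℝ} {H : ℝ × Measure ℝ × ℝ → ℝ≥0∞} (hH : Measurable H)
    {y : A → ℝ} {J : A → Measure ℝ} (hy : Measurable y) (hJ : Measurable J) :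
    Measurable fun a => paretoAverage α H (y a) (J a) := by
  have h : Measurable fun b : A × ℝ =>
      H (y b.1, J b.1, y b.1 * (1 / b.2 ^ (1 / α) - 1)) := by
    refine hH.comp ?_
    exact (hy.comp measurable_fst).prodMk ((hJ.comp measurable_fst).prodMk (by fun_prop))
  exact h.lintegral_prod_right'

/-- The crossing jump must exceed y = x - m, so under the normalized Lévy measure it is y U^(-1/α),
and the overshoot is y (U^(-1/α) - 1). -/
lemma lintegral_crossingValue {α K : ℝ} (hα : 0 < α) (hK : 0 < K)
    {H : ℝ × Measure ℝ × ℝ → ℝ≥0∞} (hH : Measurable H) {x : ℝ} (m : ℝ≥0∞) (J : Measure ℝ) :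
    ∫⁻ q, crossingValue H x q m J ∂(stableLevyMeasure α K) =
      if m < ENNReal.ofReal x then ENNReal.ofReal (K * (x - m.toReal) ^ (-α)) *
        paretoAverage α H ((x - m.toReal) / x) J else 0 := by
  split_ifs with hm
  · have hmt : m ≠ ∞ := (hm.trans ENNReal.ofReal_lt_top).ne
    have hmx : m.toReal < x := (ENNReal.lt_ofReal_iff_toReal_lt hmt).1 hm
    have hx : 0 < x := ENNReal.toReal_nonneg.trans_lt hmx
    have hφ : Measurable fun q => H (crossingTriple x q m J) :=
      hH.comp (measurable_crossingTriple measurable_const measurable_id measurable_const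
        measurable_const)
    have h1 : ∀ q, crossingValue H x q m J =
        (Ioi (x - m.toReal)).indicator (fun q => H (crossingTriple x q m J)) q := by
      intro q
      have hiff : (m < ENNReal.ofReal x ∧ ENNReal.ofReal x < m + ENNReal.ofReal q) ↔
          q ∈ Ioi (x - m.toReal) := by
        rw [mem_Ioi, sub_lt_iff_lt_add']
        refine ⟨fun h => ?_, fun h => ⟨hm, ?_⟩⟩
        · have h2 := h.2
          by_contra hcon
          rcases le_total 0 q with hq | hq
          · rw [← ENNReal.ofReal_toReal hmt, ← ENNReal.ofReal_add ENNReal.toReal_nonneg hq] at h2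
            exact absurd (ENNReal.ofReal_le_ofReal (not_lt.1 hcon)) (not_le.2 h2)
          · rw [ENNReal.ofReal_of_nonpos hq, add_zero] at h2
            exact absurd (h.1.trans h2) (lt_irrefl _)
        · have hq : 0 ≤ q := by linarith
          rw [← ENNReal.ofReal_toReal hmt, ← ENNReal.ofReal_add ENNReal.toReal_nonneg hq]
          exact (ENNReal.ofReal_lt_ofReal_iff_of_nonneg hx.le).2 h
      rw [crossingValue, indicator_apply]
      exact if_congr hiff rfl rfl
    simp_rw [h1]
    rw [setLIntegral_Ioi_stableLevyMeasure hα hK (by linarith) hφ]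
    congr 1
    refine lintegral_congr fun u => ?_
    congr 1
    simp only [crossingTriple, Prod.mk.injEq, true_and]
    ring
  · simp [crossingValue, hm]

end JumpFunctionals

/-! ### Rescaling to the jumps up to time s, and the law at a fixed level -/

section JumpsUpToTime

/-- The sum of the jumps up to time `s`. -/
noncomputable def massUpTo (t p : ℕ → ℝ) (s : ℝ) : ℝ≥0∞ :=
  ∑' j, if t j ≤ s then ENNReal.ofReal (p j) else 0

/-- The counting measure of the jumps up to time `s`, multiplied by `v`. -/
noncomputable def scaledJumps (t p : ℕ → ℝ) (s v : ℝ) : Measure ℝ :=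
  Measure.sum fun j => if t j ≤ s then Measure.dirac (v * p j) else 0

variable {A : Type*} [MeasurableSpace A]

lemma measurable_massUpTo {t p : ℕ → A → ℝ} (ht : ∀ i, Measurable (t i))
    (hp : ∀ i, Measurable (p i)) (s : ℝ) :
    Measurable fun a => massUpTo (fun i => t i a) (fun i => p i a) s :=
  Measurable.tsum fun i => Measurable.ite (measurableSet_le (ht i) measurable_const)
    (hp i).ennreal_ofReal measurable_const

lemma measurable_scaledJumps {t p : ℕ → A → ℝ} (ht : ∀ i, Measurable (t i))
    (hp : ∀ i, Measurable (p i)) (s : ℝ) {v : A → ℝ} (hv : Measurable v) :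
    Measurable fun a => scaledJumps (fun i => t i a) (fun i => p i a) s (v a) :=
  measurable_sum_ite_dirac (fun i => measurableSet_le (ht i) measurable_const)
    fun i => hv.mul (hp i)

variable {Ω Ω' : Type*} [MeasurableSpace Ω] [MeasurableSpace Ω'] {μ : Measure Ω} {μ' : Measure Ω'}
  {α K K' : ℝ} {T P : ℕ → Ω → ℝ} {T' P' : ℕ → Ω' → ℝ}

lemma IsStableJumpProcess.isPoissonPointProcess_jumps (hN : IsStableJumpProcess α K T P μ)
    {S : Set ℝ} (hS : MeasurableSet S) {c : ℝ} (hc : 0 ≤ c)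
    (hvol : volume (S ∩ Ioi 0) = ENNReal.ofReal c) :
    IsPoissonPointProcess (fun ω => ((Measure.sum fun i =>
      Measure.dirac (T i ω, P i ω)).restrict (S ×ˢ univ)).map Prod.snd)
      (stableLevyMeasure α (c * K)) μ := by
  have h := hN.poisson.restrict_map (hS.prod MeasurableSet.univ) measurable_snd
  have hlam : (((volume.restrict (Ioi (0 : ℝ))).prod (stableLevyMeasure α K)).restrict
      (S ×ˢ univ)).map Prod.snd = stableLevyMeasure α (c * K) := by
    rw [stableLevyMeasure_const_mul α hc]
    ext B hB
    rw [Measure.map_apply measurable_snd hB, Measure.restrict_apply (measurable_snd hB)]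
    have : Prod.snd ⁻¹' B ∩ S ×ˢ univ = S ×ˢ B := by
      ext y
      simp [and_comm]
    rw [this, Measure.prod_prod, Measure.restrict_apply hS, hvol]
    rfl
  rwa [hlam] at h

/-- The jumps before time `u` have the law of the rescaled jumps up to time `s` of another stable
subordinator of the same index. -/
lemma IsStableJumpProcess.lintegral_jumpsBefore_eq (hα : 0 < α) (hK : 0 < K) (hK' : 0 < K')
    (hN : IsStableJumpProcess α K T P μ) (hN' : IsStableJumpProcess α K' T' P' μ')
    {s u : ℝ} (hs : 0 < s) (hu : 0 < u) (x : ℝ)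
    {F : ℝ≥0∞ → Measure ℝ → ℝ≥0∞} (hF : Measurable fun q : ℝ≥0∞ × Measure ℝ => F q.1 q.2) :
    ∫⁻ ω, F (massBefore (fun i => T i ω) (fun i => P i ω) u)
        (jumpsBefore (fun i => T i ω) (fun i => P i ω) u x) ∂μ =
      ∫⁻ ω, F (ENNReal.ofReal ((K * u / (s * K')) ^ (1 / α)) *
          massUpTo (fun i => T' i ω) (fun i => P' i ω) s)
        (scaledJumps (fun i => T' i ω) (fun i => P' i ω) s
          ((K * u / (s * K')) ^ (1 / α) / x)) ∂μ' := by
  classical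
  -- Chosen so that w^α (s K') = u K. By self-similarity the two collections of jumps then have the
  -- same intensity, hence the same law.
  set w := (K * u / (s * K')) ^ (1 / α) with hw
  have hb : 0 < K * u / (s * K') := by positivity
  have hw0 : 0 < w := Real.rpow_pos_of_pos hb _
  have hwα : w ^ α * (s * K') = u * K := by
    rw [hw, ← Real.rpow_mul hb.le, one_div_mul_cancel hα.ne', Real.rpow_one]
    field_simp
  have h1 := hN.isPoissonPointProcess_jumps (measurableSet_Iio (a := u)) hu.le (by
    rw [inter_comm, Ioi_inter_Iio, Real.volume_Ioo, sub_zero])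
  have h2 := (hN'.isPoissonPointProcess_jumps (measurableSet_Iic (a := s)) hs.le (by
    rw [inter_comm, Ioi_inter_Iic, Real.volume_Ioc, sub_zero])).restrict_map
      MeasurableSet.univ (measurable_const_mul w)
  rw [Measure.restrict_univ, map_mul_stableLevyMeasure hα _ hw0, hwα] at h2
  have hlaw := h1.map_eq_map h2
  have hG : Measurable fun M : Measure ℝ => F (∫⁻ y, ENNReal.ofReal y ∂M)
      (M.map fun y => y / x) :=
    hF.comp ((Measure.measurable_lintegral ENNReal.measurable_ofReal).prodMk
      (Measure.measurable_map _ (measurable_id.div_const x)))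
  have hint := congrArg
    (fun Q => ∫⁻ M, F (∫⁻ y, ENNReal.ofReal y ∂M) (M.map fun y => y / x) ∂Q) hlaw
  rw [lintegral_map hG h1.measurable, lintegral_map hG h2.measurable] at hint
  convert hint using 1
  · refine lintegral_congr fun ω => ?_
    congr 1
    · rw [lintegral_map (by fun_prop) measurable_snd, sum_dirac_eq_ite,
        setLIntegral_sum_ite_dirac (measurableSet_Iio.prod MeasurableSet.univ) (by fun_prop)]
      exact tsum_congr fun i => by simp
    · rw [Measure.map_map (by fun_prop) measurable_snd, sum_dirac_eq_ite,
        restrict_map_sum_ite_dirac (measurableSet_Iio.prod MeasurableSet.univ) (by fun_prop),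
        jumpsBefore]
      congr 1
      ext1 i
      simp
  · refine lintegral_congr fun ω => ?_
    rw [Measure.restrict_univ, Measure.map_map (by fun_prop) measurable_snd]
    congr 1
    · rw [lintegral_map (by fun_prop) (by fun_prop), sum_dirac_eq_ite,
        setLIntegral_sum_ite_dirac (measurableSet_Iic.prod MeasurableSet.univ) (by fun_prop),
        massUpTo, ← ENNReal.tsum_mul_left]
      exact tsum_congr fun i => by simp [ENNReal.ofReal_mul hw0.le]
    · rw [Measure.map_map (by fun_prop) (by fun_prop), sum_dirac_eq_ite,
        restrict_map_sum_ite_dirac (measurableSet_Iic.prod MeasurableSet.univ) (by fun_prop),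
        scaledJumps]
      congr 1
      ext1 i
      simp [div_mul_eq_mul_div]

/-- The law of the size-biased pick from the jumps up to time `s`, in terms of an independent jump
from the Lévy measure. -/
noncomputable def sizeBiasedValue (μ : Measure Ω) (α κ s : ℝ) (T P : ℕ → Ω → ℝ)
    (H : ℝ × Measure ℝ × ℝ → ℝ≥0∞) : ℝ≥0∞ :=
  ∫⁻ ω, ∫⁻ p, ENNReal.ofReal (p / ((massUpTo (fun i => T i ω) (fun i => P i ω) s).toReal + p)) *
    paretoAverage α H
      -- With v = 1 / (τ + p) this is 1 - v τ, the form of the normalized undershoot, and it equals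
      -- p / (τ + p) when τ + p > 0.
      (1 - 1 / ((massUpTo (fun i => T i ω) (fun i => P i ω) s).toReal + p) *
        (massUpTo (fun i => T i ω) (fun i => P i ω) s).toReal)
      (scaledJumps (fun i => T i ω) (fun i => P i ω) s
        (1 / ((massUpTo (fun i => T i ω) (fun i => P i ω) s).toReal + p)))
    ∂(stableLevyMeasure α κ) ∂μ

lemma IsJumpSequence.massUpTo_pos {t p : ℕ → ℝ} (h : IsJumpSequence t p) {s : ℝ} (hs : 0 < s) :
    massUpTo t p s ≠ 0 := by
  obtain ⟨i, hi⟩ := (h.infinite s hs).nonempty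
  have hi : t i ≤ s := hi
  have : ENNReal.ofReal (p i) ≤ massUpTo t p s := by
    refine le_trans ?_ (ENNReal.le_tsum i)
    rw [if_pos hi]
  exact ((ENNReal.ofReal_pos.2 (h.jump_pos i)).trans_le this).ne'

/-- Integrate the crossing jump, replace the past of time t by the rescaled jumps of N' up to s, and
for each path of N' trade t for an extra jump p. The right-hand side contains neither x nor K, which
gives the independence of the level. -/
theorem IsStableJumpProcess.lintegral_crossingValue_eq (hα₀ : 0 < α) (hα₁ : α < 1)
    (hK : 0 < K) (hK' : 0 < K')
    (hN : IsStableJumpProcess α K T P μ) (hN' : IsStableJumpProcess α K' T' P' μ')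
    {s x : ℝ} (hs : 0 < s) (hx : 0 < x) {H : ℝ × Measure ℝ × ℝ → ℝ≥0∞} (hH : Measurable H) :
    ∫⁻ z, ∫⁻ ω, crossingValue H x z.2 (massBefore (fun i => T i ω) (fun i => P i ω) z.1)
        (jumpsBefore (fun i => T i ω) (fun i => P i ω) z.1 x) ∂μ
        ∂((volume.restrict (Ioi (0 : ℝ))).prod (stableLevyMeasure α K)) =
      sizeBiasedValue μ' α (s * K') s T' P' H := by
  have := hN.poisson.isProbabilityMeasure
  have := hN'.poisson.isProbabilityMeasure
  have hmeas : Measurable fun b : (ℝ × ℝ) × Ω =>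
      crossingValue H x b.1.2 (massBefore (fun i => T i b.2) (fun i => P i b.2) b.1.1)
        (jumpsBefore (fun i => T i b.2) (fun i => P i b.2) b.1.1 x) := by
    have hT : ∀ i, Measurable fun b : (ℝ × ℝ) × Ω => T i b.2 := fun i =>
      (hN.measurable_time i).comp measurable_snd
    have hP : ∀ i, Measurable fun b : (ℝ × ℝ) × Ω => P i b.2 := fun i =>
      (hN.measurable_jump i).comp measurable_snd
    exact measurable_crossingValue hH measurable_const (by fun_prop)
      (measurable_massBefore hT hP (by fun_prop))
      (measurable_jumpsBefore hT hP (by fun_prop) measurable_const)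
  rw [lintegral_prod _ hmeas.lintegral_prod_right'.aemeasurable]
  let F : ℝ≥0∞ → Measure ℝ → ℝ≥0∞ := fun m J =>
    if m < ENNReal.ofReal x then ENNReal.ofReal (K * (x - m.toReal) ^ (-α)) *
        paretoAverage α H ((x - m.toReal) / x) J else 0
  have hFm : Measurable fun q : ℝ≥0∞ × Measure ℝ => F q.1 q.2 := by
    refine Measurable.ite (measurableSet_lt measurable_fst measurable_const) ?_ measurable_const
    exact Measurable.mul (by fun_prop)
      (measurable_paretoAverage hH (by fun_prop) measurable_snd)
  have hstep : ∀ t ∈ Ioi (0 : ℝ), ∫⁻ q, ∫⁻ ω,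
      crossingValue H x q (massBefore (fun i => T i ω) (fun i => P i ω) t)
        (jumpsBefore (fun i => T i ω) (fun i => P i ω) t x) ∂μ ∂(stableLevyMeasure α K) =
      ∫⁻ ω, F (ENNReal.ofReal ((K * t / (s * K')) ^ (1 / α)) *
          massUpTo (fun i => T' i ω) (fun i => P' i ω) s)
        (scaledJumps (fun i => T' i ω) (fun i => P' i ω) s
          ((K * t / (s * K')) ^ (1 / α) / x)) ∂μ' := by
    intro t ht
    rw [lintegral_lintegral_swap]
    · simp_rw [lintegral_crossingValue hα₀ hK hH]
      exact hN.lintegral_jumpsBefore_eq hα₀ hK hK' hN' hs ht x hFm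
    · have : Measurable fun b : ℝ × Ω => (((t, b.1), b.2) : (ℝ × ℝ) × Ω) := by fun_prop
      exact (hmeas.comp this).aemeasurable
  rw [setLIntegral_congr_fun measurableSet_Ioi hstep, lintegral_lintegral_swap]
  · refine lintegral_congr_ae ?_
    filter_upwards [hN'.ae_isJumpSequence hα₀ hα₁ hK'] with ω hω
    have hτt : massUpTo (fun i => T' i ω) (fun i => P' i ω) s ≠ ∞ := hω.tsum_ne_top s
    set τ := (massUpTo (fun i => T' i ω) (fun i => P' i ω) s).toReal with hτ
    have hτ0 : 0 < τ := ENNReal.toReal_pos (hω.massUpTo_pos hs) hτt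
    have hh : Measurable fun v => paretoAverage α H (1 - v * τ)
        (scaledJumps (fun i => T' i ω) (fun i => P' i ω) s v) :=
      measurable_paretoAverage hH (by fun_prop)
        (measurable_scaledJumps (fun i => measurable_const) (fun i => measurable_const) s
          measurable_id)
    have hcv := lintegral_level_change_of_variables hα₀ hK (mul_pos hs hK') hx hτ0 hh
    rw [← hcv]
    refine setLIntegral_congr_fun measurableSet_Ioi fun t ht => ?_
    have ht : 0 < t := ht
    set w := (K * t / (s * K')) ^ (1 / α) with hw
    have hw0 : 0 ≤ w := Real.rpow_nonneg (by positivity) _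
    have hmass : (ENNReal.ofReal w * massUpTo (fun i => T' i ω) (fun i => P' i ω) s).toReal =
        w * τ := by
      rw [ENNReal.toReal_mul, ENNReal.toReal_ofReal hw0]
    have hiff : ENNReal.ofReal w * massUpTo (fun i => T' i ω) (fun i => P' i ω) s <
        ENNReal.ofReal x ↔ w * τ < x := by
      rw [ENNReal.lt_ofReal_iff_toReal_lt (ENNReal.mul_ne_top ENNReal.ofReal_ne_top hτt), hmass]
    simp only [F, hmass]
    rw [indicator_apply]
    refine if_congr hiff ?_ rfl
    congr 2
    rw [sub_div, div_self hx.ne', div_mul_eq_mul_div]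
  · have hT : ∀ i, Measurable fun b : ℝ × Ω' => T' i b.2 := fun i =>
      (hN'.measurable_time i).comp measurable_snd
    have hP : ∀ i, Measurable fun b : ℝ × Ω' => P' i b.2 := fun i =>
      (hN'.measurable_jump i).comp measurable_snd
    have hw : Measurable fun b : ℝ × Ω' => (K * b.1 / (s * K')) ^ (1 / α) := by fun_prop
    exact (hFm.comp ((hw.ennreal_ofReal.mul (measurable_massUpTo hT hP s)).prodMk
      (measurable_scaledJumps hT hP s (hw.div_const x)))).aemeasurable

end JumpsUpToTime

/-! ### Mecke's formula for the size-biased pick -/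

section SizeBiasedJumps

lemma IsJumpSequence.subordinator_eq_massUpTo {t p : ℕ → ℝ} (h : IsJumpSequence t p) (s : ℝ) :
    subordinator t p s = (massUpTo t p s).toReal := h.subordinator_eq s

lemma IsJumpSequence.isMassPartition {t p : ℕ → ℝ} (h : IsJumpSequence t p) {s : ℝ}
    (hs : 0 < s) : IsMassPartition (normalizedJumps t p s) := by
  have hτt : massUpTo t p s ≠ ∞ := h.tsum_ne_top s
  have hτ0 := h.massUpTo_pos hs
  have hτ : 0 < (massUpTo t p s).toReal := ENNReal.toReal_pos hτ0 hτt
  refine ⟨fun i => ?_, ?_, ?_⟩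
  · rw [normalizedJumps, h.subordinator_eq_massUpTo]
    have := h.jump_pos i
    split_ifs
    · positivity
    · exact le_rfl
  · have h1 : ∀ i, ENNReal.ofReal (normalizedJumps t p s i) =
        (if t i ≤ s then ENNReal.ofReal (p i) else 0) * (massUpTo t p s)⁻¹ := by
      intro i
      rw [normalizedJumps, h.subordinator_eq_massUpTo]
      split_ifs
      · rw [ENNReal.ofReal_div_of_pos hτ, ENNReal.ofReal_toReal hτt, div_eq_mul_inv]
      · simp
    simp_rw [h1]
    rw [ENNReal.tsum_mul_right]
    exact ENNReal.mul_inv_cancel hτ0 hτt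
  · have : {i | 0 < normalizedJumps t p s i} = {i | t i ≤ s} := by
      ext i
      have := h.jump_pos i
      simp only [mem_ofPred_eq, normalizedJumps, h.subordinator_eq_massUpTo]
      split_ifs with hi
      · simp only [hi, iff_true]
        positivity
      · simp [hi]
    rw [this]
    exact h.infinite s hs

/-- The mass `∫ p` of the points `(t, p)` of `m` with `t ≤ s`. -/
noncomputable def massUpToOf (m : Measure (ℝ × ℝ)) (s : ℝ) : ℝ≥0∞ :=
  ∫⁻ y in {y | y.1 ≤ s}, ENNReal.ofReal y.2 ∂m

/-- The image under `(t, p) ↦ v * p` of the points of `m` with `t ≤ s`. -/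
noncomputable def scaledJumpsOf (m : Measure (ℝ × ℝ)) (s v : ℝ) : Measure ℝ :=
  (m.restrict {y | y.1 ≤ s}).map fun y => v * y.2

lemma measurableSet_time_le (s : ℝ) : MeasurableSet {y : ℝ × ℝ | y.1 ≤ s} :=
  measurableSet_le measurable_fst measurable_const

lemma massUpToOf_sum_dirac (t p : ℕ → ℝ) (s : ℝ) :
    massUpToOf (Measure.sum fun i => Measure.dirac (t i, p i)) s = massUpTo t p s := by
  classical
  rw [massUpToOf, sum_dirac_eq_ite,
    setLIntegral_sum_ite_dirac (measurableSet_time_le s) (by fun_prop)]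
  exact tsum_congr fun i => by simp

lemma scaledJumpsOf_sum_dirac (t p : ℕ → ℝ) (s v : ℝ) :
    scaledJumpsOf (Measure.sum fun i => Measure.dirac (t i, p i)) s v = scaledJumps t p s v := by
  classical
  rw [scaledJumpsOf, sum_dirac_eq_ite,
    restrict_map_sum_ite_dirac (measurableSet_time_le s) (by fun_prop), scaledJumps]
  congr 1
  ext1 i
  simp

lemma massUpTo_eq_massUpToOf_erase_add (t p : ℕ → ℝ) {s : ℝ} {i : ℕ} (hi : t i ≤ s) :
    massUpTo t p s = massUpToOf (sumDiracErase (fun j => (t j, p j)) i) s +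
      ENNReal.ofReal (p i) := by
  classical
  have h1 : ENNReal.ofReal (p i) = ∑' k, if k = i then ENNReal.ofReal (p k) else 0 := by
    rw [tsum_ite_eq]
  rw [massUpToOf, sumDiracErase_eq_ite,
    setLIntegral_sum_ite_dirac (measurableSet_time_le _) (by fun_prop), h1, ← ENNReal.tsum_add]
  refine tsum_congr fun k => ?_
  by_cases hk : k = i
  · subst hk; simp [hi]
  · simp [hk]

lemma scaledJumpsOf_sumDiracErase (t p : ℕ → ℝ) (s v : ℝ) (i : ℕ) :
    scaledJumpsOf (sumDiracErase (fun j => (t j, p j)) i) s v =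
      Measure.sum fun k => if k ≠ i ∧ t k ≤ s then Measure.dirac (v * p k) else 0 := by
  classical
  rw [scaledJumpsOf, sumDiracErase_eq_ite,
    restrict_map_sum_ite_dirac (measurableSet_time_le _) (by fun_prop)]
  rfl

variable {A : Type*} [MeasurableSpace A]

lemma measurable_massUpToOf (κ : Kernel A (ℝ × ℝ)) [IsSFiniteKernel κ] (s : ℝ) :
    Measurable fun a => massUpToOf (κ a) s :=
  measurable_setLIntegral_kernel κ (D := fun _ => {y | y.1 ≤ s})
    (measurableSet_le (measurable_fst.comp measurable_snd) measurable_const) (by fun_prop)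

lemma measurable_scaledJumpsOf (κ : Kernel A (ℝ × ℝ)) [IsSFiniteKernel κ] (s : ℝ) {v : A → ℝ}
    (hv : Measurable v) : Measurable fun a => scaledJumpsOf (κ a) s (v a) :=
  measurable_restrict_map_kernel κ (D := fun _ => {y | y.1 ≤ s})
    (measurableSet_le (measurable_fst.comp measurable_snd) measurable_const)
    (F := fun a y => v a * y.2) (by fun_prop)

/-- The integrand in `sizeBiasedValue`. -/
noncomputable def pickValue (α : ℝ) (H : ℝ × Measure ℝ × ℝ → ℝ≥0∞) (p τ : ℝ) (J : Measure ℝ) :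
    ℝ≥0∞ :=
  ENNReal.ofReal (p / (τ + p)) * paretoAverage α H (1 - 1 / (τ + p) * τ) J

lemma measurable_pickValue {α : ℝ} {H : ℝ × Measure ℝ × ℝ → ℝ≥0∞} (hH : Measurable H)
    {p τ : A → ℝ} {J : A → Measure ℝ} (hp : Measurable p) (hτ : Measurable τ)
    (hJ : Measurable J) : Measurable fun a => pickValue α H (p a) (τ a) (J a) :=
  Measurable.mul (by fun_prop) (measurable_paretoAverage hH (by fun_prop) hJ)

variable {Ω : Type*} [MeasurableSpace Ω] {μ : Measure Ω} {α K : ℝ} {T P : ℕ → Ω → ℝ}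

lemma sizeBiasedValue_eq (μ : Measure Ω) (α κ s : ℝ) (T P : ℕ → Ω → ℝ)
    (H : ℝ × Measure ℝ × ℝ → ℝ≥0∞) : sizeBiasedValue μ α κ s T P H =
      ∫⁻ ω, ∫⁻ p, pickValue α H p (massUpTo (fun i => T i ω) (fun i => P i ω) s).toReal
        (scaledJumps (fun i => T i ω) (fun i => P i ω) s
          (1 / ((massUpTo (fun i => T i ω) (fun i => P i ω) s).toReal + p)))
        ∂(stableLevyMeasure α κ) ∂μ := rfl

lemma IsStableJumpProcess.measurable_normalizedJumps (hN : IsStableJumpProcess α K T P μ) (s : ℝ)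
    (i : ℕ) : Measurable fun ω => normalizedJumps (fun k => T k ω) (fun k => P k ω) s i := by
  have hsub : Measurable fun ω => subordinator (fun k => T k ω) (fun k => P k ω) s :=
    Measurable.tsum fun k => Measurable.ite
      (measurableSet_le (hN.measurable_time k) measurable_const) (hN.measurable_jump k)
      measurable_const
  exact Measurable.ite (measurableSet_le (hN.measurable_time i) measurable_const)
    ((hN.measurable_jump i).div hsub) measurable_const

/-- With τ the mass of the other jumps up to s, the total is τ + p i. Everything is thus expressed
by the point i and the configuration without it, as Mecke's formula requires. -/
lemma IsJumpSequence.normalizedJumps_mul_paretoAverage {t p : ℕ → ℝ} (h : IsJumpSequence t p)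
    {s : ℝ} (H : ℝ × Measure ℝ × ℝ → ℝ≥0∞) {i : ℕ} (hi : t i ≤ s) :
    ENNReal.ofReal (normalizedJumps t p s i) * paretoAverage α H (normalizedJumps t p s i)
        (otherBlocks (normalizedJumps t p s) i) =
      pickValue α H (p i) (massUpToOf (sumDiracErase (fun j => (t j, p j)) i) s).toReal
        (scaledJumpsOf (sumDiracErase (fun j => (t j, p j)) i) s
          (1 / ((massUpToOf (sumDiracErase (fun j => (t j, p j)) i) s).toReal + p i))) := by
  have hp := h.jump_pos i
  have hτt : massUpTo t p s ≠ ∞ := h.tsum_ne_top s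
  have hadd := massUpTo_eq_massUpToOf_erase_add t p hi
  have hmt : massUpToOf (sumDiracErase (fun j => (t j, p j)) i) s ≠ ∞ := fun hcon => by
    rw [hcon, top_add] at hadd
    exact hτt hadd
  have hsub : subordinator t p s =
      (massUpToOf (sumDiracErase (fun j => (t j, p j)) i) s).toReal + p i := by
    rw [h.subordinator_eq_massUpTo, hadd, ENNReal.toReal_add hmt ENNReal.ofReal_ne_top,
      ENNReal.toReal_ofReal hp.le]
  set τ := (massUpToOf (sumDiracErase (fun j => (t j, p j)) i) s).toReal
  have hτ : 0 ≤ τ := ENNReal.toReal_nonneg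
  have hτp : 0 < τ + p i := by positivity
  have hv : ∀ k, normalizedJumps t p s k = if t k ≤ s then 1 / (τ + p i) * p k else 0 := by
    intro k
    rw [normalizedJumps, hsub]
    split_ifs
    · rw [one_div_mul_eq_div]
    · rfl
  rw [pickValue, scaledJumpsOf_sumDiracErase]
  congr 2
  · rw [hv, if_pos hi, one_div_mul_eq_div]
  · rw [hv, if_pos hi]
    field_simp
    ring
  · rw [otherBlocks]
    congr 1
    ext1 k
    have hpk := h.jump_pos k
    by_cases hk : t k ≤ s
    · have h1 : 0 < 1 / (τ + p i) * p k := by positivity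
      simp only [hv, hk, if_true, h1, and_true]
    · simp [hv, hk]

/-- Independence integrates out U, the first draw gives a sum over the jumps weighted by their
normalized sizes, and Mecke's formula replaces the drawn jump by an added point. The time of that
point enters only through t ≤ s, whence the constant s K in the Lévy measure. -/
theorem IsSizeBiasedOrdering.lintegral_normalizedJumps (hα₀ : 0 < α) (hα₁ : α < 1) (hK : 0 < K)
    (hN : IsStableJumpProcess α K T P μ) {s : ℝ} (hs : 0 < s) {V : ℕ → Ω → ℝ}
    (hV : IsSizeBiasedOrdering
      (fun i ω => normalizedJumps (fun k => T k ω) (fun k => P k ω) s i) V μ)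
    {U : Ω → ℝ} (hU : HasLaw U (volume.restrict (Ioo (0 : ℝ) 1)) μ)
    (hUV : IndepFun U (fun ω n => V n ω) μ) {H : ℝ × Measure ℝ × ℝ → ℝ≥0∞} (hH : Measurable H) :
    ∫⁻ ω, H (V 0 ω, Measure.sum fun j => Measure.dirac (V (j + 1) ω),
          V 0 ω * (1 / U ω ^ (1 / α) - 1)) ∂μ = sizeBiasedValue μ α (s * K) s T P H := by
  have := hN.poisson.isProbabilityMeasure
  have hmp : ∀ᵐ ω ∂μ, IsMassPartition
      fun i => normalizedJumps (fun k => T k ω) (fun k => P k ω) s i := by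
    filter_upwards [hN.ae_isJumpSequence hα₀ hα₁ hK] with ω hω
    exact hω.isMassPartition hs
  have hVm : Measurable fun ω n => V n ω := measurable_pi_lambda _
    (hV.measurable (fun i => hN.measurable_normalizedJumps s i))
  have hsum : Measurable fun v : ℕ → ℝ => Measure.sum fun j => Measure.dirac (v (j + 1)) :=
    measurable_measureSum fun j => Measure.measurable_dirac.comp (measurable_pi_apply _)
  have hG : Measurable fun q : ℝ × (ℕ → ℝ) =>
      H (q.2 0, Measure.sum fun j => Measure.dirac (q.2 (j + 1)),
        q.2 0 * (1 / q.1 ^ (1 / α) - 1)) := by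
    refine hH.comp (Measurable.prodMk (by fun_prop)
      ((hsum.comp measurable_snd).prodMk (by fun_prop)))
  have hlaw := (indepFun_iff_map_prod_eq_prod_map_map hU.aemeasurable hVm.aemeasurable).1 hUV
  rw [hU.map_eq] at hlaw
  have hstep1 : ∫⁻ ω, H (V 0 ω, Measure.sum fun j => Measure.dirac (V (j + 1) ω),
      V 0 ω * (1 / U ω ^ (1 / α) - 1)) ∂μ =
      ∫⁻ ω, paretoAverage α H (V 0 ω) (Measure.sum fun j => Measure.dirac (V (j + 1) ω)) ∂μ := by
    have hprob := Measure.isProbabilityMeasure_map (μ := μ) hVm.aemeasurable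
    rw [← lintegral_map' (f := fun q : ℝ × (ℕ → ℝ) =>
      H (q.2 0, Measure.sum fun j => Measure.dirac (q.2 (j + 1)),
        q.2 0 * (1 / q.1 ^ (1 / α) - 1))) (g := fun ω => (U ω, fun n => V n ω))
      hG.aemeasurable (hU.aemeasurable.prodMk hVm.aemeasurable), hlaw,
      lintegral_prod_symm _ hG.aemeasurable, lintegral_map hG.lintegral_prod_left' hVm]
    rfl
  rw [hstep1, hV.lintegral_eq (fun i => hN.measurable_normalizedJumps s i) hmp
    (measurable_paretoAverage hH measurable_fst measurable_snd)]
  let h : ℝ × ℝ → Measure (ℝ × ℝ) → ℝ≥0∞ := fun z m =>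
    (Iic s).indicator 1 z.1 * pickValue α H z.2 (massUpToOf m s).toReal
        (scaledJumpsOf m s (1 / ((massUpToOf m s).toReal + z.2)))
  have hh : ∀ κ : Kernel (Measure (ℝ × ℝ)) (ℝ × ℝ), IsSFiniteKernel κ →
      Measurable fun q : (ℝ × ℝ) × Measure (ℝ × ℝ) => h q.1 (κ q.2) := by
    intro κ _
    have hm := measurable_massUpToOf
      (κ.comap (Prod.snd : (ℝ × ℝ) × Measure (ℝ × ℝ) → _) measurable_snd) s
    have hv : Measurable fun q : (ℝ × ℝ) × Measure (ℝ × ℝ) =>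
        1 / ((massUpToOf (κ q.2) s).toReal + q.1.2) :=
      measurable_const.div (hm.ennreal_toReal.add (by fun_prop))
    have hJ := measurable_scaledJumpsOf
      (κ.comap (Prod.snd : (ℝ × ℝ) × Measure (ℝ × ℝ) → _) measurable_snd) s hv
    refine Measurable.mul ?_ (measurable_pickValue hH (by fun_prop) hm.ennreal_toReal hJ)
    exact (measurable_one.indicator measurableSet_Iic).comp (by fun_prop)
  have hmecke := hN.poisson.mecke hN.measurable_point h hh
  have hleft : ∀ i, ∫⁻ ω, ENNReal.ofReal (normalizedJumps (fun k => T k ω) (fun k => P k ω) s i) *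
      paretoAverage α H (normalizedJumps (fun k => T k ω) (fun k => P k ω) s i)
        (otherBlocks (fun i => normalizedJumps (fun k => T k ω) (fun k => P k ω) s i) i) ∂μ =
      ∫⁻ ω, h (T i ω, P i ω) (sumDiracErase (fun j => (T j ω, P j ω)) i) ∂μ := by
    intro i
    refine lintegral_congr_ae ?_
    filter_upwards [hN.ae_isJumpSequence hα₀ hα₁ hK] with ω hω
    by_cases hi : T i ω ≤ s
    · simp only [h]
      rw [indicator_of_mem (show T i ω ∈ Iic s from hi), Pi.one_apply, one_mul]
      exact hω.normalizedJumps_mul_paretoAverage H hi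
    · simp only [h]
      rw [indicator_of_notMem (show T i ω ∉ Iic s from hi), zero_mul, normalizedJumps, if_neg hi,
        ENNReal.ofReal_zero, zero_mul]
  simp_rw [hleft]
  rw [hmecke, sizeBiasedValue_eq]
  have hgm : Measurable fun q : ℝ × Ω => pickValue α H q.1
      (massUpTo (fun i => T i q.2) (fun i => P i q.2) s).toReal
      (scaledJumps (fun i => T i q.2) (fun i => P i q.2) s
        (1 / ((massUpTo (fun i => T i q.2) (fun i => P i q.2) s).toReal + q.1))) := by
    have hT : ∀ i, Measurable fun q : ℝ × Ω => T i q.2 := fun i =>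
      (hN.measurable_time i).comp measurable_snd
    have hP : ∀ i, Measurable fun q : ℝ × Ω => P i q.2 := fun i =>
      (hN.measurable_jump i).comp measurable_snd
    have hm := (measurable_massUpTo hT hP s).ennreal_toReal
    exact measurable_pickValue hH (by fun_prop) hm (measurable_scaledJumps hT hP s
      (measurable_const.div (hm.add (by fun_prop))))
  simp only [h]
  simp_rw [massUpToOf_sum_dirac, scaledJumpsOf_sum_dirac]
  have hswap := lintegral_lintegral_swap (μ := stableLevyMeasure α (s * K)) (ν := μ)
    (f := fun p ω => pickValue α H p
      (massUpTo (fun i => T i ω) (fun i => P i ω) s).toReal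
      (scaledJumps (fun i => T i ω) (fun i => P i ω) s
        (1 / ((massUpTo (fun i => T i ω) (fun i => P i ω) s).toReal + p)))) hgm.aemeasurable
  rw [← hswap, stableLevyMeasure_const_mul α hs.le, lintegral_smul_measure]
  have hconst : ∀ z : ℝ × ℝ, ∫⁻ ω, (Iic s).indicator 1 z.1 * pickValue α H z.2
      (massUpTo (fun i => T i ω) (fun i => P i ω) s).toReal
      (scaledJumps (fun i => T i ω) (fun i => P i ω) s
        (1 / ((massUpTo (fun i => T i ω) (fun i => P i ω) s).toReal + z.2))) ∂μ =
      (Iic s).indicator 1 z.1 * ∫⁻ ω, pickValue α H z.2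
      (massUpTo (fun i => T i ω) (fun i => P i ω) s).toReal
      (scaledJumps (fun i => T i ω) (fun i => P i ω) s
        (1 / ((massUpTo (fun i => T i ω) (fun i => P i ω) s).toReal + z.2))) ∂μ := fun z =>
    lintegral_const_mul _ (hgm.comp measurable_prodMk_left)
  simp_rw [hconst]
  rw [lintegral_prod_mul (f := (Iic s).indicator (1 : ℝ → ℝ≥0∞))
    (measurable_one.indicator measurableSet_Iic).aemeasurable
    hgm.lintegral_prod_right'.aemeasurable, lintegral_indicator_one measurableSet_Iic,
    Measure.restrict_apply measurableSet_Iic, inter_comm, Ioi_inter_Iic, Real.volume_Ioc, sub_zero]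
  rfl

end SizeBiasedJumps

/-! ### Exponential marks and the memoryless property -/

section ExponentialMarks

instance : IsProbabilityMeasure (expMeasure 1) := isProbabilityMeasure_expMeasure one_pos

lemma expMeasure_one_eq : expMeasure 1 =
    (volume.restrict (Ioi 0)).withDensity fun y => ENNReal.ofReal (Real.exp (-y)) := by
  have h : expMeasure 1 = volume.withDensity (exponentialPDF 1) := rfl
  rw [h, ← withDensity_indicator measurableSet_Ioi]
  refine withDensity_congr_ae ?_
  filter_upwards [Measure.ae_ne volume (0 : ℝ)] with y hy
  rcases lt_or_gt_of_ne hy with hy | hy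
  · rw [exponentialPDF_of_neg hy, indicator_of_notMem (by simpa using hy.le)]
  · rw [exponentialPDF_of_nonneg hy.le, indicator_of_mem (by simpa using hy)]
    simp

lemma expMeasure_one_ge {q : ℝ} (hq : 0 ≤ q) :
    expMeasure 1 {y | q ≤ y} = expNeg (ENNReal.ofReal q) := by
  have h1 : expMeasure 1 (Iic q) = ENNReal.ofReal (1 - Real.exp (-q)) := by
    have := cdf_expMeasure_eq one_pos q
    rw [if_pos hq, one_mul] at this
    rw [← this, ofReal_cdf]
  have h2 : expMeasure 1 (Ioi q) = expNeg (ENNReal.ofReal q) := by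
    rw [← compl_Iic, prob_compl_eq_one_sub measurableSet_Iic, h1, expNeg_ofReal hq,
      ← ENNReal.ofReal_one, ← ENNReal.ofReal_sub _ (by simpa using hq)]
    congr 1
    ring
  rw [← h2]
  have : ({y | q ≤ y} : Set ℝ) =ᵐ[expMeasure 1] Ioi q := by
    have hac : expMeasure 1 ≪ volume := by
      rw [expMeasure_one_eq]
      exact (withDensity_absolutelyContinuous _ _).trans
        Measure.restrict_le_self.absolutelyContinuous
    exact hac.ae_eq Ioi_ae_eq_Ici.symm
  exact measure_congr this

/-- With independent standard exponential marks, the probability that the jump `i` is the first to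
exceed its mark, and that this mark belongs to `S`. -/
lemma infinitePi_firstExceeds {t p : ℕ → ℝ} (hp : ∀ i, 0 < p i) (i : ℕ) {S : Set ℝ}
    (hS : MeasurableSet S) :
    Measure.infinitePi (fun _ : ℕ => expMeasure 1) {e | FirstExceeds t p e i ∧ e i ∈ S} =
      expMeasure 1 {y | y < p i ∧ y ∈ S} * expNeg (massBefore t p (t i)) := by
  classical
  -- For fixed jumps the event is a box: each earlier jump j contributes the factor exp (-p j), and
  -- marks of later jumps are free.
  let B : ℕ → Set ℝ := fun j => if j = i then {y | y < p i ∧ y ∈ S} else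
    if t j < t i then {y | p j ≤ y} else univ
  have hB : ∀ j, MeasurableSet (B j) := by
    intro j
    simp only [B]
    split_ifs
    · exact measurableSet_Iio.inter hS
    · exact measurableSet_Ici
    · exact MeasurableSet.univ
  have hset : {e | FirstExceeds t p e i ∧ e i ∈ S} = univ.pi B := by
    ext e
    simp only [mem_ofPred_eq, mem_univ_pi, B, FirstExceeds]
    constructor
    · rintro ⟨⟨h1, h2⟩, h3⟩ j
      split_ifs with hj ht
      · subst hj; exact ⟨h1, h3⟩
      · exact h2 j ht
      · trivial
    · intro h
      have hi := h i
      rw [if_pos rfl] at hi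
      refine ⟨⟨hi.1, fun j hj => ?_⟩, hi.2⟩
      have hne : j ≠ i := fun hji => by subst hji; exact lt_irrefl _ hj
      have := h j
      rwa [if_neg hne, if_pos hj] at this
  rw [hset, Measure.infinitePi_pi_univ _ hB]
  refine HasProd.tprod_eq ?_
  rw [HasProd, SummationFilter.unconditional_filter]
  -- The infinite product is a limit of finite ones. Continuity of `expNeg` on [0, ∞] covers an
  -- infinite mass as well.
  have hlim : Filter.Tendsto (fun s : Finset ℕ => expMeasure 1 (B i) *
      expNeg (∑ j ∈ s, if t j < t i then ENNReal.ofReal (p j) else 0)) Filter.atTop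
      (𝓝 (expMeasure 1 (B i) * expNeg (massBefore t p (t i)))) :=
    ENNReal.Tendsto.const_mul ((continuous_expNeg.tendsto _).comp ENNReal.summable.hasSum)
      (Or.inr (measure_ne_top _ _))
  have hBi : B i = {y | y < p i ∧ y ∈ S} := if_pos rfl
  rw [hBi] at hlim
  refine hlim.congr' ?_
  filter_upwards [Filter.eventually_ge_atTop {i}] with s hs
  have his : i ∈ s := hs (Finset.mem_singleton_self i)
  rw [expNeg_sum, ← Finset.mul_prod_erase s _ his, if_neg (lt_irrefl _), expNeg_zero, one_mul,
    ← Finset.mul_prod_erase s _ his, hBi]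
  congr 1
  refine Finset.prod_congr rfl fun j hj => ?_
  simp only [B, if_neg (Finset.ne_of_mem_erase hj)]
  split_ifs
  · rw [expMeasure_one_ge (hp j).le]
  · rw [expNeg_zero, measure_univ]

/-- The memoryless property: the level `m + y`, for an exponential `y`, with weight `exp (-m)`. -/
lemma expMeasure_crossingTriple_mul_expNeg {S : Set (ℝ × Measure ℝ × ℝ)} (hS : MeasurableSet S)
    (q : ℝ) (m : ℝ≥0∞) {J : ℝ → Measure ℝ} (hJ : Measurable J) :
    expMeasure 1 {y | y < q ∧ y ∈ {y | crossingTriple (m.toReal + y) q m (J (m.toReal + y)) ∈ S}} *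
        expNeg m =
      ∫⁻ g, crossingValue (S.indicator 1) g q m (J g) ∂(expMeasure 1) := by
  by_cases hm : m = ∞
  · subst hm
    simp [expNeg_top, crossingValue]
  obtain ⟨r, hr, rfl⟩ : ∃ r : ℝ, 0 ≤ r ∧ ENNReal.ofReal r = m :=
    ⟨m.toReal, ENNReal.toReal_nonneg, ENNReal.ofReal_toReal hm⟩
  have hT : Measurable fun y => crossingTriple (r + y) q (ENNReal.ofReal r) (J (r + y)) :=
    measurable_crossingTriple (by fun_prop) measurable_const measurable_const (by fun_prop)
  have hcv : Measurable fun g => crossingValue (S.indicator 1) g q (ENNReal.ofReal r) (J g) :=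
    measurable_crossingValue (measurable_one.indicator hS) measurable_id measurable_const
      measurable_const hJ
  have hexp : Measurable fun y : ℝ => ENNReal.ofReal (Real.exp (-y)) := by fun_prop
  simp only [ENNReal.toReal_ofReal hr]
  have hA : MeasurableSet {y | y < q ∧
      y ∈ {y | crossingTriple (r + y) q (ENNReal.ofReal r) (J (r + y)) ∈ S}} :=
    measurableSet_Iio.inter (hT hS)
  rw [expNeg_ofReal hr, ← lintegral_indicator_one hA, expMeasure_one_eq,
    lintegral_withDensity_eq_lintegral_mul _ hexp (measurable_one.indicator hA),
    lintegral_withDensity_eq_lintegral_mul _ hexp hcv,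
    ← lintegral_mul_const' _ _ ENNReal.ofReal_ne_top, ← lintegral_indicator measurableSet_Ioi,
    ← lintegral_indicator measurableSet_Ioi]
  -- Substitute g = r + y, so that exp (-y) exp (-r) = exp (-g).
  refine Eq.trans ?_ (lintegral_add_left_eq_self (μ := volume) _ r)
  refine lintegral_congr fun y => ?_
  by_cases hy : 0 < y
  · have hry : 0 < r + y := by positivity
    rw [indicator_of_mem (show y ∈ Ioi (0 : ℝ) from hy),
      indicator_of_mem (show r + y ∈ Ioi (0 : ℝ) from hry)]
    simp only [Pi.mul_apply, crossingValue]
    have h1 : ENNReal.ofReal r < ENNReal.ofReal (r + y) := by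
      rw [ENNReal.ofReal_lt_ofReal_iff hry]; linarith
    have h2 : ENNReal.ofReal (r + y) < ENNReal.ofReal r + ENNReal.ofReal q ↔ y < q := by
      rw [ENNReal.ofReal_add hr hy.le, ENNReal.add_lt_add_iff_left ENNReal.ofReal_ne_top]
      exact ⟨fun h => ((ENNReal.ofReal_lt_ofReal_iff'.1 h).1),
        fun h => ENNReal.ofReal_lt_ofReal_iff'.2 ⟨h, hy.trans h⟩⟩
    simp only [h1, h2, true_and]
    rw [show -(r + y) = -y + -r by ring, Real.exp_add, ENNReal.ofReal_mul (Real.exp_nonneg _),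
      mul_right_comm]
    congr 1
    by_cases hyq : y < q
    · by_cases hyS : crossingTriple (r + y) q (ENNReal.ofReal r) (J (r + y)) ∈ S <;> simp [hyq, hyS]
    · simp [hyq]
  · rw [indicator_of_notMem (show y ∉ Ioi (0 : ℝ) from hy), indicator_apply]
    split_ifs with h
    · have h1 : ¬ ENNReal.ofReal r < ENNReal.ofReal (r + y) := by
        refine not_lt.2 (ENNReal.ofReal_le_ofReal ?_)
        linarith [not_lt.1 hy]
      simp [crossingValue, h1]
    · rfl

variable {Ω : Type*} [MeasurableSpace Ω] {μ : Measure Ω} {T P E : ℕ → Ω → ℝ}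

lemma measurableSet_firstExceeds (hT : ∀ i, Measurable (T i)) (hP : ∀ i, Measurable (P i))
    (hE : ∀ i, Measurable (E i)) (i : ℕ) :
    MeasurableSet {ω | FirstExceeds (fun j => T j ω) (fun j => P j ω) (fun j => E j ω) i} := by
  refine (measurableSet_lt (hE i) (hP i)).inter ?_
  change MeasurableSet {ω | ∀ j, T j ω < T i ω → P j ω ≤ E j ω}
  have h : {ω | ∀ j, T j ω < T i ω → P j ω ≤ E j ω} =
      ⋂ j, ({ω | T j ω < T i ω}ᶜ ∪ {ω | P j ω ≤ E j ω}) := by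
    ext ω
    simp [imp_iff_not_or]
  rw [h]
  exact MeasurableSet.iInter fun j =>
    (measurableSet_lt (hT j) (hT i)).compl.union (measurableSet_le (hP j) (hE j))

namespace IsExponentialMarking

lemma aemeasurable_mark (hE : IsExponentialMarking E T P μ) :
    AEMeasurable (fun ω i => E i ω) μ :=
  aemeasurable_pi_lambda _ fun i => (hE.law i).aemeasurable

lemma ae_pos (hE : IsExponentialMarking E T P μ) : ∀ᵐ ω ∂μ, ∀ i, 0 < E i ω := by
  refine ae_all_iff.2 fun i => ?_
  have h : ∀ᵐ y ∂(μ.map (E i)), 0 < y := by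
    rw [(hE.law i).map_eq, expMeasure_one_eq]
    exact (withDensity_absolutelyContinuous _ _) (ae_restrict_mem measurableSet_Ioi)
  exact ae_of_ae_map (hE.law i).aemeasurable h

lemma map_prodMk (hE : IsExponentialMarking E T P μ) (hT : ∀ i, Measurable (T i))
    (hP : ∀ i, Measurable (P i)) :
    μ.map (fun ω => (fun i => E i ω, fun i => (T i ω, P i ω))) =
      (Measure.infinitePi fun _ : ℕ => expMeasure 1).prod (μ.map fun ω i => (T i ω, P i ω)) := by
  have := hE.iIndep.isProbabilityMeasure
  have hz : Measurable fun ω i => (T i ω, P i ω) :=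
    measurable_pi_lambda _ fun i => (hT i).prodMk (hP i)
  rw [(indepFun_iff_map_prod_eq_prod_map_map hE.aemeasurable_mark hz.aemeasurable).1 hE.indep,
    (hE.iIndep.hasLaw_infinitePi hE.law hE.aemeasurable_mark).map_eq]

/-- The law of the path and the mark of the jump `i`, if that is the first to exceed its mark. -/
lemma measure_firstExceeds (hE : IsExponentialMarking E T P μ) (hT : ∀ i, Measurable (T i))
    (hP : ∀ i, Measurable (P i)) (hpos : ∀ᵐ ω ∂μ, ∀ i, 0 < P i ω) (i : ℕ)
    {S : Set (ℝ × Measure ℝ × ℝ)} (hS : MeasurableSet S) :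
    μ {ω | FirstExceeds (fun j => T j ω) (fun j => P j ω) (fun j => E j ω) i ∧
        crossingTriple ((massBefore (fun j => T j ω) (fun j => P j ω) (T i ω)).toReal + E i ω)
          (P i ω) (massBefore (fun j => T j ω) (fun j => P j ω) (T i ω))
          (jumpsBefore (fun j => T j ω) (fun j => P j ω) (T i ω)
            ((massBefore (fun j => T j ω) (fun j => P j ω) (T i ω)).toReal + E i ω)) ∈ S} =
      ∫⁻ ω, ∫⁻ g, crossingValue (S.indicator 1) g (P i ω)
        (massBefore (fun j => T j ω) (fun j => P j ω) (T i ω))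
        (jumpsBefore (fun j => T j ω) (fun j => P j ω) (T i ω) g) ∂(expMeasure 1) ∂μ := by
  have hz : Measurable fun ω i => (T i ω, P i ω) :=
    measurable_pi_lambda _ fun i => (hT i).prodMk (hP i)
  have := hE.iIndep.isProbabilityMeasure
  have := Measure.isProbabilityMeasure_map (μ := μ) hz.aemeasurable
  have ht : ∀ j, Measurable fun q : (ℕ → ℝ) × (ℕ → ℝ × ℝ) => (q.2 j).1 := fun j => by fun_prop
  have hp : ∀ j, Measurable fun q : (ℕ → ℝ) × (ℕ → ℝ × ℝ) => (q.2 j).2 := fun j => by fun_prop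
  have he : ∀ j, Measurable fun q : (ℕ → ℝ) × (ℕ → ℝ × ℝ) => q.1 j := fun j => by fun_prop
  have hm := measurable_massBefore ht hp (ht i)
  have hl := hm.ennreal_toReal.add (he i)
  have hΦ := measurable_crossingTriple hl (hp i) hm (measurable_jumpsBefore ht hp (ht i) hl)
  -- On the space of pairs (marks, path) the joint law is a product, so the marks can be integrated
  -- first, along a fixed path.
  let D : Set ((ℕ → ℝ) × (ℕ → ℝ × ℝ)) :=
    {q | FirstExceeds (fun j => (q.2 j).1) (fun j => (q.2 j).2) q.1 i ∧
      crossingTriple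
        ((massBefore (fun j => (q.2 j).1) (fun j => (q.2 j).2) (q.2 i).1).toReal + q.1 i)
        (q.2 i).2 (massBefore (fun j => (q.2 j).1) (fun j => (q.2 j).2) (q.2 i).1)
        (jumpsBefore (fun j => (q.2 j).1) (fun j => (q.2 j).2) (q.2 i).1
          ((massBefore (fun j => (q.2 j).1) (fun j => (q.2 j).2) (q.2 i).1).toReal + q.1 i)) ∈ S}
  have hF := measurableSet_firstExceeds ht hp he i
  have hD : MeasurableSet D := hF.inter (hΦ hS)
  have hlaw := congrArg (fun Q => Q D) (hE.map_prodMk hT hP)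
  rw [Measure.map_apply_of_aemeasurable (hE.aemeasurable_mark.prodMk hz.aemeasurable) hD,
    Measure.prod_apply_symm hD, lintegral_map (measurable_measure_prodMk_right hD) hz] at hlaw
  refine hlaw.trans (lintegral_congr_ae ?_)
  filter_upwards [hpos] with ω hω
  have hJ : Measurable fun g => jumpsBefore (fun j => T j ω) (fun j => P j ω) (T i ω) g :=
    measurable_jumpsBefore (fun _ => measurable_const) (fun _ => measurable_const)
      measurable_const measurable_id
  rw [← expMeasure_crossingTriple_mul_expNeg hS _ _ hJ, ← infinitePi_firstExceeds hω i]
  · rfl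
  · have hl' : Measurable fun y : ℝ =>
        (massBefore (fun j => T j ω) (fun j => P j ω) (T i ω)).toReal + y := by fun_prop
    exact measurable_crossingTriple hl' measurable_const measurable_const (hJ.comp hl') hS

end IsExponentialMarking

end ExponentialMarks

/-! ### The laws of the three triples -/

section CrossingLaws

variable {Ω Ω' : Type*} [MeasurableSpace Ω] [MeasurableSpace Ω'] {μ : Measure Ω} {μ' : Measure Ω'}
  {α K K' : ℝ} {T P E : ℕ → Ω → ℝ} {T' P' : ℕ → Ω' → ℝ}

lemma crossingValue_eq_indicator (H : ℝ × Measure ℝ × ℝ → ℝ≥0∞) (t p : ℕ → ℝ) (x : ℝ) (i : ℕ) :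
    crossingValue H x (p i) (massBefore t p (t i)) (jumpsBefore t p (t i) x) =
      {i | Crosses t p x i}.indicator (fun i => H (crossingTriple x (p i) (massBefore t p (t i))
        (jumpsBefore t p (t i) x))) i := by
  classical
  rw [crossingValue, indicator_apply]
  exact if_congr Iff.rfl rfl rfl

namespace IsStableJumpProcess

lemma measurable_massBefore_time (hN : IsStableJumpProcess α K T P μ) (i : ℕ) :
    Measurable fun ω => massBefore (fun j => T j ω) (fun j => P j ω) (T i ω) :=
  measurable_massBefore hN.measurable_time hN.measurable_jump (hN.measurable_time i)

lemma measurableSet_crosses (hN : IsStableJumpProcess α K T P μ) (x : ℝ) (i : ℕ) :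
    MeasurableSet {ω | Crosses (fun j => T j ω) (fun j => P j ω) x i} :=
  (measurableSet_lt (hN.measurable_massBefore_time i) measurable_const).inter
    (measurableSet_lt measurable_const
      ((hN.measurable_massBefore_time i).add (hN.measurable_jump i).ennreal_ofReal))

/-- Whether jump i crosses x depends on its time, its size and the configuration without it, so
Mecke's formula applies to the sum. -/
lemma tsum_lintegral_crossingValue (hα₀ : 0 < α) (hα₁ : α < 1) (hK : 0 < K) (hK' : 0 < K')
    (hN : IsStableJumpProcess α K T P μ) (hN' : IsStableJumpProcess α K' T' P' μ')
    {s x : ℝ} (hs : 0 < s) (hx : 0 < x) {H : ℝ × Measure ℝ × ℝ → ℝ≥0∞} (hH : Measurable H) :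
    ∑' i, ∫⁻ ω, crossingValue H x (P i ω) (massBefore (fun j => T j ω) (fun j => P j ω) (T i ω))
        (jumpsBefore (fun j => T j ω) (fun j => P j ω) (T i ω) x) ∂μ =
      sizeBiasedValue μ' α (s * K') s T' P' H := by
  let h : ℝ × ℝ → Measure (ℝ × ℝ) → ℝ≥0∞ := fun z m =>
    crossingValue H x z.2 (massOf m z.1) (jumpsOf m z.1 x)
  have hh : ∀ κ : Kernel (Measure (ℝ × ℝ)) (ℝ × ℝ), IsSFiniteKernel κ →
      Measurable fun q : (ℝ × ℝ) × Measure (ℝ × ℝ) => h q.1 (κ q.2) := by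
    intro κ _
    let κ' : Kernel ((ℝ × ℝ) × Measure (ℝ × ℝ)) (ℝ × ℝ) := κ.comap Prod.snd measurable_snd
    have hu : Measurable fun q : (ℝ × ℝ) × Measure (ℝ × ℝ) => q.1.1 := by fun_prop
    exact measurable_crossingValue hH measurable_const (by fun_prop) (measurable_massOf κ' hu)
      (measurable_jumpsOf κ' hu measurable_const)
  have hmecke := hN.poisson.mecke hN.measurable_point h hh
  simp only [h] at hmecke
  simp_rw [massOf_sum_dirac, jumpsOf_sum_dirac] at hmecke
  rw [hN.lintegral_crossingValue_eq hα₀ hα₁ hK hK' hN' hs hx hH] at hmecke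
  rw [← hmecke]
  simp_rw [massOf_sumDiracErase, jumpsOf_sumDiracErase]

/-- At most one jump crosses x, and by `h1` the expected number of crossing jumps is one. Neither
unboundedness of the path nor the absence of creeping needs a separate argument. -/
lemma ae_exists_crosses (hα₀ : 0 < α) (hα₁ : α < 1) (hK : 0 < K) (hK' : 0 < K')
    (hN : IsStableJumpProcess α K T P μ) (hN' : IsStableJumpProcess α K' T' P' μ')
    {s x : ℝ} (hs : 0 < s) (hx : 0 < x)
    (h1 : sizeBiasedValue μ' α (s * K') s T' P' (fun _ => 1) = 1) :
    ∀ᵐ ω ∂μ, ∃ i, Crosses (fun j => T j ω) (fun j => P j ω) x i := by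
  have := hN.poisson.isProbabilityMeasure
  refine ae_exists_mem_of_tsum_eq_one
    (C := fun i => {ω | Crosses (fun j => T j ω) (fun j => P j ω) x i})
    (hN.measurableSet_crosses x) ?_ ?_
  · filter_upwards [hN.ae_isJumpSequence hα₀ hα₁ hK] with ω hω i j hi hj
    exact Crosses.unique hω.injective hi hj
  · rw [← h1, ← hN.tsum_lintegral_crossingValue hα₀ hα₁ hK hK' hN' hs hx measurable_const]
    refine tsum_congr fun i => ?_
    rw [← lintegral_indicator_one (hN.measurableSet_crosses x i)]
    refine lintegral_congr fun ω => ?_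
    rw [crossingValue_eq_indicator (fun _ => 1) (fun j => T j ω) (fun j => P j ω) x i]
    rfl

/-- The law of the undershoot, the completed jumps and the overshoot of a fixed level. -/
theorem map_crossing (hα₀ : 0 < α) (hα₁ : α < 1) (hK : 0 < K) (hK' : 0 < K')
    (hN : IsStableJumpProcess α K T P μ) (hN' : IsStableJumpProcess α K' T' P' μ')
    {s x : ℝ} (hs : 0 < s) (hx : 0 < x)
    (h1 : sizeBiasedValue μ' α (s * K') s T' P' (fun _ => 1) = 1) {X : Ω → ℝ × Measure ℝ × ℝ}
    (hX : ∀ ω, X ω = (undershoot (fun i => T i ω) (fun i => P i ω) x / x,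
        completedJumps (fun i => T i ω) (fun i => P i ω) x,
        overshoot (fun i => T i ω) (fun i => P i ω) x / x)) :
    AEMeasurable X μ ∧ ∀ S, MeasurableSet S →
      μ.map X S = sizeBiasedValue μ' α (s * K') s T' P' (S.indicator 1) := by
  have hseq := hN.ae_isJumpSequence hα₀ hα₁ hK
  have hC := hN.measurableSet_crosses x
  have hex := hN.ae_exists_crosses hα₀ hα₁ hK hK' hN' hs hx h1
  have hd : ∀ᵐ ω ∂μ, ∀ i j, ω ∈ {ω | Crosses (fun j => T j ω) (fun j => P j ω) x i} →
      ω ∈ {ω | Crosses (fun j => T j ω) (fun j => P j ω) x j} → i = j := by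
    filter_upwards [hseq] with ω hω i j hi hj
    exact Crosses.unique hω.injective hi hj
  let Φ : ℕ → Ω → ℝ × Measure ℝ × ℝ := fun i ω =>
    crossingTriple x (P i ω) (massBefore (fun j => T j ω) (fun j => P j ω) (T i ω))
      (jumpsBefore (fun j => T j ω) (fun j => P j ω) (T i ω) x)
  have hΦ : ∀ i, Measurable (Φ i) := fun i => measurable_crossingTriple measurable_const
    (hN.measurable_jump i) (hN.measurable_massBefore_time i)
    (measurable_jumpsBefore hN.measurable_time hN.measurable_jump (hN.measurable_time i)
      measurable_const)
  have hXΦ : ∀ᵐ ω ∂μ, ∀ i, ω ∈ {ω | Crosses (fun j => T j ω) (fun j => P j ω) x i} →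
      X ω = Φ i ω := by
    filter_upwards [hseq] with ω hω i hi
    rw [hX]
    exact hω.triple_eq_crossingTriple hx hi
  refine ⟨aemeasurable_of_selected hC hex hΦ hXΦ, fun S hS => ?_⟩
  rw [map_apply_of_selected hC hd hex hΦ hXΦ hS,
    ← hN.tsum_lintegral_crossingValue hα₀ hα₁ hK hK' hN' hs hx (measurable_one.indicator hS)]
  refine tsum_congr fun i => lintegral_congr fun ω => ?_
  rw [crossingValue_eq_indicator _ (fun j => T j ω) (fun j => P j ω) x i]
  rfl

end IsStableJumpProcess

namespace IsExponentialMarking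

/-- `HasLaw` makes the marks almost everywhere measurable only, whereas the selection events have to
be measurable sets. -/
lemma exists_measurable (hE : IsExponentialMarking E T P μ) :
    ∃ E' : ℕ → Ω → ℝ, (∀ i, Measurable (E' i)) ∧ IsExponentialMarking E' T P μ ∧
      ∀ᵐ ω ∂μ, ∀ i, E i ω = E' i ω := by
  have hm := fun i => (hE.law i).aemeasurable
  have hae : ∀ᵐ ω ∂μ, ∀ i, E i ω = (hm i).mk (E i) ω := ae_all_iff.2 fun i => (hm i).ae_eq_mk
  refine ⟨fun i => (hm i).mk (E i), fun i => (hm i).measurable_mk, ⟨fun i => ?_, ?_, ?_⟩, hae⟩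
  · exact (hE.law i).congr (hm i).ae_eq_mk.symm
  · exact hE.iIndep.congr fun i => (hm i).ae_eq_mk
  · refine hE.indep.congr ?_ (Filter.EventuallyEq.refl _ _)
    filter_upwards [hae] with ω hω
    exact funext hω

/-- By the memoryless property the sum is an average, over an exponential level g, of the crossing
sums at level g. These do not depend on g. -/
lemma tsum_measure_firstExceeds (hα₀ : 0 < α) (hα₁ : α < 1) (hK : 0 < K) (hK' : 0 < K')
    (hN : IsStableJumpProcess α K T P μ) (hN' : IsStableJumpProcess α K' T' P' μ')
    {s : ℝ} (hs : 0 < s) (hE : IsExponentialMarking E T P μ)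
    {S : Set (ℝ × Measure ℝ × ℝ)} (hS : MeasurableSet S) :
    ∑' i, μ {ω | FirstExceeds (fun j => T j ω) (fun j => P j ω) (fun j => E j ω) i ∧
        crossingTriple ((massBefore (fun j => T j ω) (fun j => P j ω) (T i ω)).toReal + E i ω)
          (P i ω) (massBefore (fun j => T j ω) (fun j => P j ω) (T i ω))
          (jumpsBefore (fun j => T j ω) (fun j => P j ω) (T i ω)
            ((massBefore (fun j => T j ω) (fun j => P j ω) (T i ω)).toReal + E i ω)) ∈ S} =
      sizeBiasedValue μ' α (s * K') s T' P' (S.indicator 1) := by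
  have := hN.poisson.isProbabilityMeasure
  have hpos : ∀ᵐ ω ∂μ, ∀ i, 0 < P i ω := by
    filter_upwards [hN.ae_isJumpSequence hα₀ hα₁ hK] with ω hω
    exact hω.jump_pos
  have hmeas : ∀ i, Measurable fun q : Ω × ℝ => crossingValue (S.indicator 1) q.2 (P i q.1)
      (massBefore (fun j => T j q.1) (fun j => P j q.1) (T i q.1))
      (jumpsBefore (fun j => T j q.1) (fun j => P j q.1) (T i q.1) q.2) := by
    intro i
    have hT : ∀ i, Measurable fun q : Ω × ℝ => T i q.1 := fun i =>
      (hN.measurable_time i).comp measurable_fst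
    have hP : ∀ i, Measurable fun q : Ω × ℝ => P i q.1 := fun i =>
      (hN.measurable_jump i).comp measurable_fst
    exact measurable_crossingValue (measurable_one.indicator hS) measurable_snd (hP i)
      (measurable_massBefore hT hP (hT i)) (measurable_jumpsBefore hT hP (hT i) measurable_snd)
  simp_rw [fun i => hE.measure_firstExceeds hN.measurable_time hN.measurable_jump hpos i hS,
    fun i => lintegral_lintegral_swap (μ := μ) (ν := expMeasure 1)
      (f := fun ω g => crossingValue (S.indicator 1) g (P i ω)
        (massBefore (fun j => T j ω) (fun j => P j ω) (T i ω))
        (jumpsBefore (fun j => T j ω) (fun j => P j ω) (T i ω) g)) (hmeas i).aemeasurable]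
  rw [← lintegral_tsum fun i => (hmeas i).lintegral_prod_left'.aemeasurable]
  have hg : ∀ᵐ g ∂(expMeasure 1), 0 < g := by
    rw [expMeasure_one_eq]
    exact (withDensity_absolutelyContinuous _ _) (ae_restrict_mem measurableSet_Ioi)
  rw [lintegral_congr_ae (g := fun _ => sizeBiasedValue μ' α (s * K') s T' P' (S.indicator 1))]
  · simp
  · filter_upwards [hg] with g hg
    exact hN.tsum_lintegral_crossingValue hα₀ hα₁ hK hK' hN' hs hg (measurable_one.indicator hS)

/-- The law of the undershoot, the completed jumps and the overshoot of the level obtained by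
thinning with exponential marks. -/
theorem map_thinned (hα₀ : 0 < α) (hα₁ : α < 1) (hK : 0 < K) (hK' : 0 < K')
    (hN : IsStableJumpProcess α K T P μ) (hN' : IsStableJumpProcess α K' T' P' μ')
    {s : ℝ} (hs : 0 < s) (hE : IsExponentialMarking E T P μ)
    (h1 : sizeBiasedValue μ' α (s * K') s T' P' (fun _ => 1) = 1) {X : Ω → ℝ × Measure ℝ × ℝ}
    (hX : ∀ ω, X ω =
      (undershoot (fun i => T i ω) (fun i => P i ω)
          (thinningLevel (fun i => T i ω) (fun i => P i ω) (fun i => E i ω)) /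
          thinningLevel (fun i => T i ω) (fun i => P i ω) (fun i => E i ω),
        thinnedJumps (fun i => T i ω) (fun i => P i ω) (fun i => E i ω)
          (thinningLevel (fun i => T i ω) (fun i => P i ω) (fun i => E i ω)),
        overshoot (fun i => T i ω) (fun i => P i ω)
          (thinningLevel (fun i => T i ω) (fun i => P i ω) (fun i => E i ω)) /
          thinningLevel (fun i => T i ω) (fun i => P i ω) (fun i => E i ω))) :
    AEMeasurable X μ ∧ ∀ S, MeasurableSet S →
      μ.map X S = sizeBiasedValue μ' α (s * K') s T' P' (S.indicator 1) := by
  obtain ⟨F, hF, hEF, hae⟩ := hE.exists_measurable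
  have := hN.poisson.isProbabilityMeasure
  have hseq := hN.ae_isJumpSequence hα₀ hα₁ hK
  let C : ℕ → Set Ω := fun i =>
    {ω | FirstExceeds (fun j => T j ω) (fun j => P j ω) (fun j => F j ω) i}
  have hC : ∀ i, MeasurableSet (C i) := fun i =>
    measurableSet_firstExceeds hN.measurable_time hN.measurable_jump hF i
  have hd : ∀ᵐ ω ∂μ, ∀ i j, ω ∈ C i → ω ∈ C j → i = j := by
    filter_upwards [hseq] with ω hω i j hi hj
    exact FirstExceeds.unique (p := fun j => P j ω) (e := fun j => F j ω) hω.injective hi hj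
  let Φ : ℕ → Ω → ℝ × Measure ℝ × ℝ := fun i ω =>
    crossingTriple ((massBefore (fun j => T j ω) (fun j => P j ω) (T i ω)).toReal + F i ω)
      (P i ω) (massBefore (fun j => T j ω) (fun j => P j ω) (T i ω))
      (jumpsBefore (fun j => T j ω) (fun j => P j ω) (T i ω)
        ((massBefore (fun j => T j ω) (fun j => P j ω) (T i ω)).toReal + F i ω))
  have hΦ : ∀ i, Measurable (Φ i) := by
    intro i
    have hm := hN.measurable_massBefore_time i
    have hl := hm.ennreal_toReal.add (hF i)
    exact measurable_crossingTriple hl (hN.measurable_jump i) hm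
      (measurable_jumpsBefore hN.measurable_time hN.measurable_jump (hN.measurable_time i) hl)
  have htsum := fun S (hS : MeasurableSet S) =>
    hEF.tsum_measure_firstExceeds hα₀ hα₁ hK hK' hN hN' hs hS
  have hex : ∀ᵐ ω ∂μ, ∃ i, ω ∈ C i := by
    refine ae_exists_mem_of_tsum_eq_one hC hd ?_
    -- For S = univ, the probabilities of being the first to exceed add up to one.
    have := htsum univ MeasurableSet.univ
    simp only [mem_univ, and_true, indicator_univ] at this
    exact this.trans h1
  have hXΦ : ∀ᵐ ω ∂μ, ∀ i, ω ∈ C i → X ω = Φ i ω := by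
    filter_upwards [hseq, hae, hEF.ae_pos] with ω hω h2 h3 i hi
    rw [hX, funext h2]
    exact hω.thinned_triple_eq_crossingTriple hi (h3 i)
  refine ⟨aemeasurable_of_selected hC hex hΦ hXΦ, fun S hS => ?_⟩
  rw [map_apply_of_selected hC hd hex hΦ hXΦ hS, ← htsum S hS]
  refine tsum_congr fun i => ?_
  refine Eq.trans ?_ (lintegral_indicator_one ((hC i).inter (hΦ i hS)))
  exact lintegral_congr fun ω => congrFun (indicator_indicator (C i) (Φ i ⁻¹' S) 1) ω

end IsExponentialMarking

/-- The law of the size-biased ordering with an independent overshoot. -/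
theorem IsSizeBiasedOrdering.map_normalizedJumps (hα₀ : 0 < α) (hα₁ : α < 1) (hK : 0 < K)
    (hN : IsStableJumpProcess α K T P μ) {s : ℝ} (hs : 0 < s) {V : ℕ → Ω → ℝ}
    (hV : IsSizeBiasedOrdering
      (fun i ω => normalizedJumps (fun k => T k ω) (fun k => P k ω) s i) V μ)
    {U : Ω → ℝ} (hU : HasLaw U (volume.restrict (Ioo (0 : ℝ) 1)) μ)
    (hUV : IndepFun U (fun ω n => V n ω) μ) {X : Ω → ℝ × Measure ℝ × ℝ}
    (hX : ∀ ω, X ω = (V 0 ω, Measure.sum fun j => Measure.dirac (V (j + 1) ω),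
      V 0 ω * (1 / U ω ^ (1 / α) - 1))) :
    AEMeasurable X μ ∧ ∀ S, MeasurableSet S →
      μ.map X S = sizeBiasedValue μ α (s * K) s T P (S.indicator 1) := by
  obtain rfl : X = fun ω => (V 0 ω, Measure.sum fun j => Measure.dirac (V (j + 1) ω),
      V 0 ω * (1 / U ω ^ (1 / α) - 1)) := funext hX
  have hVm := hV.measurable fun i => hN.measurable_normalizedJumps s i
  have hm : AEMeasurable (fun ω => (V 0 ω, Measure.sum fun j => Measure.dirac (V (j + 1) ω),
      V 0 ω * (1 / U ω ^ (1 / α) - 1))) μ := by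
    have hU' := hU.aemeasurable
    have h3 : AEMeasurable (fun ω => V 0 ω * (1 / U ω ^ (1 / α) - 1)) μ :=
      (hVm 0).aemeasurable.mul (((hU'.pow_const (1 / α)).const_div 1).sub_const 1)
    have h2 : Measurable fun ω => Measure.sum fun j => Measure.dirac (V (j + 1) ω) :=
      measurable_measureSum fun j => Measure.measurable_dirac.comp (hVm (j + 1))
    exact (hVm 0).aemeasurable.prodMk (h2.aemeasurable.prodMk h3)
  refine ⟨hm, fun S hS => ?_⟩
  rw [← hV.lintegral_normalizedJumps hα₀ hα₁ hK hN hs hU hUV (measurable_one.indicator hS),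
    ← lintegral_map' (measurable_one.indicator hS).aemeasurable hm, lintegral_indicator_one hS]

end CrossingLaws

theorem theorem3p2
    {Ω Ω' : Type*} [MeasurableSpace Ω] [MeasurableSpace Ω']
    (μ : Measure Ω) [IsProbabilityMeasure μ] (μ' : Measure Ω') [IsProbabilityMeasure μ']
    (α : ℝ) (hα₀ : 0 < α) (hα₁ : α < 1)
    -- the stable subordinator with Lévy tail `K u ^ (-α)`, and the level `x`
    (K : ℝ) (hK : 0 < K) (T P : ℕ → Ω → ℝ) (hN : IsStableJumpProcess α K T P μ)
    (x : ℝ) (hx : 0 < x)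
    -- the PD(α, 0) partition, from the jumps of such a subordinator up to time `s`
    (K' : ℝ) (hK' : 0 < K') (T' P' : ℕ → Ω' → ℝ) (hN' : IsStableJumpProcess α K' T' P' μ')
    (s : ℝ) (hs : 0 < s)
    -- its size-biased ordering `V 0, V 1, …`, and an independent uniform variable
    (V : ℕ → Ω' → ℝ)
    (hV : IsSizeBiasedOrdering
      (fun i ω => normalizedJumps (fun k => T' k ω) (fun k => P' k ω) s i) V μ')
    (U : Ω' → ℝ) (hU : HasLaw U (volume.restrict (Ioo (0 : ℝ) 1)) μ')
    (hUV : IndepFun U (fun ω n => V n ω) μ') :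
    IdentDistrib
      (fun ω => (undershoot (fun i => T i ω) (fun i => P i ω) x / x,
        completedJumps (fun i => T i ω) (fun i => P i ω) x,
        overshoot (fun i => T i ω) (fun i => P i ω) x / x))
      (fun ω => (V 0 ω, Measure.sum fun j => Measure.dirac (V (j + 1) ω),
        V 0 ω * (1 / U ω ^ (1 / α) - 1))) μ μ' ∧
    ∀ E : ℕ → Ω → ℝ, IsExponentialMarking E T P μ →
      IdentDistrib
        (fun ω => (undershoot (fun i => T i ω) (fun i => P i ω) x / x,
          completedJumps (fun i => T i ω) (fun i => P i ω) x,
          overshoot (fun i => T i ω) (fun i => P i ω) x / x))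
        (fun ω =>
          let t := fun i => T i ω
          let p := fun i => P i ω
          let e := fun i => E i ω
          let g := thinningLevel t p e
          (undershoot t p g / g, thinnedJumps t p e g, overshoot t p g / g)) μ μ ∧
      IdentDistrib
        (fun ω =>
          let t := fun i => T i ω
          let p := fun i => P i ω
          let e := fun i => E i ω
          let g := thinningLevel t p e
          (undershoot t p g / g, thinnedJumps t p e g, overshoot t p g / g))
        (fun ω => (V 0 ω, Measure.sum fun j => Measure.dirac (V (j + 1) ω),
          V 0 ω * (1 / U ω ^ (1 / α) - 1))) μ μ' := by
  -- On the size-biased side H = 1 gives the total mass of a probability measure. This normalization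
  -- feeds the existence arguments for the other two triples.
  have h1 : sizeBiasedValue μ' α (s * K') s T' P' (fun _ => 1) = 1 := by
    rw [← hV.lintegral_normalizedJumps hα₀ hα₁ hK' hN' hs hU hUV measurable_const]
    simp
  obtain ⟨hm₁, hl₁⟩ := hN.map_crossing hα₀ hα₁ hK hK' hN' hs hx h1 fun _ => rfl
  obtain ⟨hm₂, hl₂⟩ := hV.map_normalizedJumps hα₀ hα₁ hK' hN' hs hU hUV fun _ => rfl
  refine ⟨⟨hm₁, hm₂, Measure.ext fun S hS => (hl₁ S hS).trans (hl₂ S hS).symm⟩, fun E hE => ?_⟩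
  obtain ⟨hm₃, hl₃⟩ := hE.map_thinned hα₀ hα₁ hK hK' hN hN' hs h1 fun _ => rfl
  exact ⟨⟨hm₁, hm₃, Measure.ext fun S hS => (hl₁ S hS).trans (hl₃ S hS).symm⟩,
    ⟨hm₃, hm₂, Measure.ext fun S hS => (hl₃ S hS).trans (hl₂ S hS).symm⟩⟩
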